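/- **Theorem (reconstruction formula for the real vector mKdV equation).** Let $n\ge 1$. For a complex matrix of size $n+1$, use the blocks determined by the splitting $1+n$; the subscript $DL$ denotes the lower left block (a column of length $n$). A bar is entrywise complex conjugation and $\dagger$ the conjugate transpose. Put $\theta(x,t;\lambda)=\lambda x+4\lambda^3t$. *Scattering data.* Let $\gamma:\mathbb R\to\mathbb C^{1\times n}$ be a Schwartz function with $\gamma^\dagger(\lambda)=\gamma^{T}(-\lambda)$. Let $\lambda_1,\dots,\lambda_N$ ($N\ge0$) be distinct points of the open upper half-plane such that $\lambda_j=-\bar\lambda_k$ only if $j=k$, let $m_1,\dots,m_N\ge 0$ be integers, and let $\mathbf f$ be a $\mathbb C^n$-valued polynomial of degree less than $\sum_{k}(m_k+1)$ with $\mathbf f(\lambda_k)\neq0$ for all $k$ and, whenever $\operatorname{Re}\lambda_k=0$, $$\mathbf f^{(m_k-l)}(\lambda_k)=(-1)^{l+1}\,\overline{\mathbf f^{(m_k-l)}(\lambda_k)},\qquad l=0,\dots,m_k .$$ Put $$\mathbf J=\begin{pmatrix}1+\gamma\gamma^\dagger&-e^{-2i\theta}\gamma\\-e^{2i\theta}\gamma^\dagger&\mathbf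 I\end{pmatrix},\qquad \mathbf P_k(x,t;\lambda)=\begin{pmatrix}1&0\\-\dfrac{e^{2i\theta(x,t;\lambda)}\mathbf f(\lambda)}{(\lambda-\lambda_k)^{m_k+1}}&\mathbf I\end{pmatrix}.$$ *Contour.* Let $\Omega_k$ be an open disk centred at $\lambda_k$, and let $\Omega_{-k}=-\Omega_k$, $\Omega_k^*=\overline{\Omega_k}$ (complex conjugate set), $\Omega_{-k}^*=-\overline{\Omega_k}$. Assume that the closures of all the disks $\Omega_k$, and of all the disks $\Omega_{-k}^*$ with $\operatorname{Re}\lambda_k\ne0$, lie in the open upper half-plane and are pairwise disjoint. Let $\Sigma$ be the union of $\mathbb R$, of the circles $\partial\Omega_k,\partial\Omega_k^*$ for all $k$, and of the circles $\partial\Omega_{-k},\partial\Omega_{-k}^*$ for the $k$ with $\operatorname{Re}\lambda_k\neq0$. Orient $\mathbb R$ from left to right, $\partial\Omega_{\pm k}$ clockwise and $\partial\Omega^*_{\pm k}$ counterclockwise; the $+$ side is the left one. *Riemann–Hilbert problem.* For given $(x,t)$, an $(n+1)\times(n+1)$ matrix function $\tilde{\mathbf M}(x,t;\cdot)$ solves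 the problem if it is analytic in $\mathbb C\setminus\Sigma$, tends to $\mathbf I$ as $\lambda\to\infty$ in $\mathbb C\setminus\mathbb R$, extends continuously to $\Sigma$ from each side, and its boundary values satisfy $\tilde{\mathbf M}_+=\tilde{\mathbf M}_-\tilde{\mathbf J}$ on $\Sigma$, where $$\tilde{\mathbf J}(x,t;\lambda)=\begin{cases}\mathbf J(x,t;\lambda),&\lambda\in\mathbb R,\\ \mathbf P_k(x,t;\lambda)^{-1},&\lambda\in\partial\Omega_k,\\ \mathbf P_k(x,t;-\lambda)^{T},&\lambda\in\partial\Omega_{-k},\ \operatorname{Re}\lambda_k\ne0,\\ [\mathbf P_k(x,t;\bar\lambda)^{\dagger}]^{-1},&\lambda\in\partial\Omega_k^*,\\ \overline{\mathbf P_k(x,t;-\bar\lambda)},&\lambda\in\partial\Omega_{-k}^*,\ \operatorname{Re}\lambda_k\ne0.\end{cases}$$ *Claim.* If $\tilde{\mathbf M}(x,t;\cdot)$ solves this problem for every $(x,t)\in\mathbb R\times(0,\infty)$, then for every such $(x,t)$ the limit $$\mathbf q(x,t)=-2i\lim_{\lambda\to\infty,\ \lambda\in\mathbb C\setminus\mathbb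 R}\lambda\,\tilde{\mathbf M}_{DL}(x,t;\lambda)$$ exists and lies in $\mathbb R^n$, and $\mathbf q$ is a classical solution on $\mathbb R\times(0,\infty)$ of the vector mKdV equation $$\mathbf q_t+\mathbf q_{xxx}+3\left(\mathbf q_x\mathbf q^{T}\mathbf q+\mathbf q\mathbf q^{T}\mathbf q_x\right)=0,$$ that is, $\mathbf q_t,\mathbf q_x,\mathbf q_{xx},\mathbf q_{xxx}$ exist, are continuous in $(x,t)$, and satisfy the equation. -/

import Mathlib

open scoped Matrix ComplexConjugate Topology

noncomputable section

namespace VmKdV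

/-- Square matrices of size `n + 1`, split into blocks of sizes `1` and `n`:
the index `Sum.inl ()` is the first one, the indices `Sum.inr i` are the last `n` ones. -/
abbrev BlockMat (n : ℕ) : Type := Matrix (Unit ⊕ Fin n) (Unit ⊕ Fin n) ℂ

/-- The phase `θ(x,t;z) = z x + 4 z³ t`. -/
def theta (x t : ℝ) (z : ℂ) : ℂ := z * x + 4 * z ^ 3 * t

/-- Scattering data of the vector mKdV equation with `n` real components:
a rapidly decreasing (Schwartz) reflection coefficient `γ` (a row vector), `N` points in the open
upper half-plane with multiplicities `m k + 1`, and the residue constants, encoded in a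
vector-valued polynomial `f`. -/
structure ScatteringData (n : ℕ) where
  /-- The reflection coefficient. -/
  γ : SchwartzMap ℝ (Fin n → ℂ)
  /-- The symmetry `γ†(s) = γᵀ(-s)`. -/
  γ_symm : ∀ (s : ℝ) (i : Fin n), conj (γ s i) = γ (-s) i
  /-- The number of pairs `{pole k, -conj (pole k)}`. -/
  N : ℕ
  pole : Fin N → ℂ
  m : Fin N → ℕ
  pole_im_pos : ∀ k, 0 < (pole k).im
  pole_injective : Function.Injective pole
  /-- The points `-conj (pole k)` repeat none of the points `pole j`, except that
  `-conj (pole k) = pole k` when `pole k` is purely imaginary. -/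
  pole_ne_neg_conj : ∀ j k, pole j = -conj (pole k) → j = k
  /-- The column vector `f` of polynomials. -/
  f : Fin n → Polynomial ℂ
  f_degree : ∀ i, (f i).degree < ((∑ k, (m k + 1) : ℕ) : WithBot ℕ)
  f_ne_zero : ∀ k, ∃ i, (f i).eval (pole k) ≠ 0
  /-- The symmetry of the residue constants at purely imaginary points. -/
  f_symm : ∀ k, (pole k).re = 0 → ∀ l ≤ m k, ∀ i,
    (Polynomial.derivative^[m k - l] (f i)).eval (pole k) =
      (-1) ^ (l + 1) * conj ((Polynomial.derivative^[m k - l] (f i)).eval (pole k))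

namespace ScatteringData

variable {n : ℕ} (D : ScatteringData n)

/-- The jump matrix on the real line,
`((1 + γ γ†, -e^{-2iθ} γ), (-e^{2iθ} γ†, I))`. -/
def jumpReal (x t s : ℝ) : BlockMat n :=
  Matrix.fromBlocks
    (Matrix.of fun _ _ => 1 + ∑ i, D.γ s i * conj (D.γ s i))
    (Matrix.of fun _ j => -(Complex.exp (-2 * Complex.I * theta x t s) * D.γ s j))
    (Matrix.of fun i _ => -(Complex.exp (2 * Complex.I * theta x t s) * conj (D.γ s i)))
    1

/-- The matrix `P_k(x,t;z) = ((1, 0), (-e^{2iθ} f(z) / (z - pole k)^(m k + 1), I))`. -/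
def P (k : Fin D.N) (x t : ℝ) (z : ℂ) : BlockMat n :=
  Matrix.fromBlocks 1 0
    (Matrix.of fun i _ =>
      -(Complex.exp (2 * Complex.I * theta x t z) * (D.f i).eval z
        / (z - D.pole k) ^ (D.m k + 1)))
    1

/-- The radii `r k` of the disks `Ω_k` around `pole k` are admissible if the closed disks lie in the
open upper half-plane and the closed disks around the points `pole k` (all `k`) and
`-conj (pole k)` (those `k` with `Re (pole k) ≠ 0`) are pairwise disjoint. -/
structure AdmissibleRadii (r : Fin D.N → ℝ) : Prop where
  pos : ∀ k, 0 < r k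
  lt_im : ∀ k, r k < (D.pole k).im
  disjoint : ∀ j k, j ≠ k →
    Disjoint (Metric.closedBall (D.pole j) (r j)) (Metric.closedBall (D.pole k) (r k))
  disjoint_reflected : ∀ j k, (D.pole k).re ≠ 0 →
    Disjoint (Metric.closedBall (D.pole j) (r j)) (Metric.closedBall (-conj (D.pole k)) (r k))

/-- The contour `Σ`: the real line, the circles around `pole k` and `conj (pole k)` for all `k`,
and the circles around `-pole k` and `-conj (pole k)` for the `k` with `Re (pole k) ≠ 0`. -/
def contour (r : Fin D.N → ℝ) : Set ℂ :=
  {z | z.im = 0} ∪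
    (⋃ k, Metric.sphere (D.pole k) (r k) ∪ Metric.sphere (conj (D.pole k)) (r k)) ∪
    (⋃ k, ⋃ _ : (D.pole k).re ≠ 0,
      Metric.sphere (-D.pole k) (r k) ∪ Metric.sphere (-conj (D.pole k)) (r k))

end ScatteringData

/-- `M` takes continuous boundary values `M₊`, `M₋` on `S` from the sides `plus`, `minus`, and
`M₊ = M₋ V` on `S`. -/
def HasJump {n : ℕ} (M : ℂ → BlockMat n) (S plus minus : Set ℂ) (V : ℂ → BlockMat n) : Prop :=
  ∃ Mp Mm : ℂ → BlockMat n, ContinuousOn Mp S ∧ ContinuousOn Mm S ∧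
    ∀ z ∈ S, Filter.Tendsto M (𝓝[plus] z) (𝓝 (Mp z)) ∧
      Filter.Tendsto M (𝓝[minus] z) (𝓝 (Mm z)) ∧ Mp z = Mm z * V z

/-- A jump across a circle oriented clockwise: the `+` side (the left one) is the exterior. -/
def HasJumpClockwise {n : ℕ} (M : ℂ → BlockMat n) (c : ℂ) (r : ℝ) (V : ℂ → BlockMat n) : Prop :=
  HasJump M (Metric.sphere c r) (Metric.closedBall c r)ᶜ (Metric.ball c r) V

/-- A jump across a circle oriented counterclockwise: the `+` side (the left one) is the
interior. -/
def HasJumpCounterclockwise {n : ℕ} (M : ℂ → BlockMat n) (c : ℂ) (r : ℝ) (V : ℂ → BlockMat n) :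
    Prop :=
  HasJump M (Metric.sphere c r) (Metric.ball c r) (Metric.closedBall c r)ᶜ V

/-- The filter of `z → ∞` with `z ∈ ℂ \ ℝ`. -/
def atInfty : Filter ℂ := Bornology.cobounded ℂ ⊓ Filter.principal {z : ℂ | z.im ≠ 0}

/-- `M` solves, for the parameters `x` and `t`, the Riemann–Hilbert problem in which the poles are
replaced by jumps on small circles. -/
structure IsRHSolution {n : ℕ} (D : ScatteringData n) (r : Fin D.N → ℝ) (x t : ℝ)
    (M : ℂ → BlockMat n) : Prop where
  analytic : ∀ i j, DifferentiableOn ℂ (fun z => M z i j) (D.contour r)ᶜ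
  normalization : Filter.Tendsto M atInfty (𝓝 1)
  jump_real : HasJump M {z | z.im = 0} {z | 0 < z.im} {z | z.im < 0}
    (fun z => D.jumpReal x t z.re)
  jump_disk : ∀ k, HasJumpClockwise M (D.pole k) (r k) (fun z => (D.P k x t z)⁻¹)
  jump_neg_disk : ∀ k, (D.pole k).re ≠ 0 →
    HasJumpClockwise M (-D.pole k) (r k) (fun z => (D.P k x t (-z))ᵀ)
  jump_conj_disk : ∀ k,
    HasJumpCounterclockwise M (conj (D.pole k)) (r k) (fun z => ((D.P k x t (conj z))ᴴ)⁻¹)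
  jump_neg_conj_disk : ∀ k, (D.pole k).re ≠ 0 →
    HasJumpCounterclockwise M (-conj (D.pole k)) (r k) (fun z => (D.P k x t (-conj z)).map conj)

/-- `q` is a classical real solution on `ℝ × (0,∞)` of the vector mKdV equation
`q_t + q_xxx + 3 (q_x qᵀ q + q qᵀ q_x) = 0`: the derivatives in the equation exist, are
continuous in `(x,t)`, and satisfy it. -/
structure IsSolution {n : ℕ} (q : ℝ → ℝ → Fin n → ℝ) : Prop where
  contDiff_space : ∀ t, 0 < t → ContDiff ℝ 3 (fun x => q x t)
  differentiable_time : ∀ x t, 0 < t → DifferentiableAt ℝ (fun s => q x s) t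
  continuousOn_space : ∀ j ≤ 3,
    ContinuousOn (fun p : ℝ × ℝ => iteratedDeriv j (fun y => q y p.2) p.1) {p | 0 < p.2}
  continuousOn_time :
    ContinuousOn (fun p : ℝ × ℝ => deriv (fun s => q p.1 s) p.2) {p | 0 < p.2}
  equation : ∀ x t, 0 < t →
    deriv (fun s => q x s) t + iteratedDeriv 3 (fun y => q y t) x
      + (3 : ℝ) • ((q x t ⬝ᵥ q x t) • deriv (fun y => q y t) x
        + (q x t ⬝ᵥ deriv (fun y => q y t) x) • q x t) = 0

end VmKdV

end

/-! Fix one of the last `n` rows of a solution of the Riemann–Hilbert problem. Its first entry jumps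
only across the real line and the circles in the upper half-plane, and its other entries only across
the real line and the circles in the lower half-plane. Each jump is the phase `e^{2iθ}` or its
conjugate times a boundary value of the entries of the other kind. Cauchy's formula therefore
couples the two kinds of entries in a closed linear system (`exists_cauchy_representation`).

Since `e^{2iθ(x+ξ,t;z)} = e^{2iθ(x,t;z)} e^{2izξ}`, writing `1/(σ - z)` as a Laplace integral turns
Cauchy integrals into Laplace transforms in `ξ` of functions translated by `ξ` in `x`. The system
becomes a Marchenko equation on `(0,∞)` whose kernels are the functions `f_j(x + y, t)` called
`kernel`: up to the factor `-1/π`, integrals of `e^{2iθ}` against the scattering data over the real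
line and the upper circles. These `f_j` solve the Airy equation `f_t + f_xxx = 0` and decay as `x →
+∞`; the symmetries of the data make them real (`conj_complexKernel`). In `L²(0,∞)` the Marchenko
equation reads `(1 + S)φ = f_i(x + ·)` with `S = ∑_j ∫_0^∞ ω_j(x+y) ⊗ ω_j(x+y) dy` and `ω_j(x) =
f_j(x + ·)`. As `S ≥ 0`, the solution is unique, and `φ(0)` is the limit defining `q_i`
(`exists_marchenko_representation`, `tendsto_mul_entry`).

Thus `q` is an explicit function `dressed` of the Airy solutions, and nothing about the dependence
of the Riemann–Hilbert solution on `(x,t)` is needed. To prove the mKdV equation, put `R = (1+S)⁻¹`,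
`s_{kl} = ⟨ω^{(k)}, R ω^{(l)}⟩` and let `g_k` be the dressed `k`-th derivative of `f`. Integration
by parts in `L²(0,∞)` leads to the closed system `g_k' = g_{k+1} + g_0 s_{0k}`, `s_{kl}' = -g_k
g_lᵀ`, with the algebraic identity `s_{k+1,l} + s_{k,l+1} + s_{k0} s_{0l} = -g_k g_lᵀ`
(`dressedGram_add`). With the time derivative of `g_0`, the equation for `q = g_0` is then linear
algebra (`isSolution_dressed`). -/

namespace VmKdV

open MeasureTheory Filter Set

/-! ### Airy flows and half-line integrals of bilinear expressions in them -/

section AiryFlow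

variable {E E₁ E₂ E₃ : Type*}
  [NormedAddCommGroup E] [NormedSpace ℝ E] [NormedAddCommGroup E₁] [NormedSpace ℝ E₁]
  [NormedAddCommGroup E₂] [NormedSpace ℝ E₂] [NormedAddCommGroup E₃] [NormedSpace ℝ E₃]

/-- A solution `f 0` of the Airy equation `f_t + f_xxx = 0` together with its space derivatives
`f k`, all decaying like `(1 + x²)^(-p)` as `x → ∞`, locally uniformly in time. -/
structure AiryFlow (p : ℕ) (f : ℕ → ℝ → ℝ → E) : Prop where
  hasDerivAt_space : ∀ k x t, HasDerivAt (fun y => f k y t) (f (k + 1) x t) x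
  hasDerivAt_time : ∀ k x t, HasDerivAt (fun s => f k x s) (-f (k + 3) x t) t
  decay : ∀ k X T, ∃ C, ∀ x t, -X ≤ x → |t| ≤ T → ‖f k x t‖ ≤ C * ((1 + x ^ 2) ^ p)⁻¹

/-- Peetre's inequality, from `y = (x + y) - x`. It transfers decay from `x + y` to `y` at the price
of a factor depending on `x` only. -/
theorem one_add_sq_le_mul (x y : ℝ) : 1 + y ^ 2 ≤ 2 * (1 + x ^ 2) * (1 + (x + y) ^ 2) := by
  nlinarith [sq_nonneg (2 * x + y), sq_nonneg (x * (x + y)), sq_nonneg (x - (x + y))]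

theorem inv_one_add_add_sq_le {X x : ℝ} (hx : |x| ≤ X) (y : ℝ) :
    (1 + (x + y) ^ 2)⁻¹ ≤ 2 * (1 + X ^ 2) * (1 + y ^ 2)⁻¹ := by
  have h1 := one_add_sq_le_mul x y
  have h2 : x ^ 2 ≤ X ^ 2 := sq_le_sq' (by linarith [neg_abs_le x]) (by linarith [le_abs_self x])
  rw [← div_eq_mul_inv, inv_eq_one_div, div_le_div_iff₀ (by positivity) (by positivity), one_mul]
  nlinarith [mul_le_mul_of_nonneg_right h2 (show (0 : ℝ) ≤ 2 * (1 + (x + y) ^ 2) by positivity)]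

/-- A function of two real variables is continuous if it is continuous in the second one and has
a locally bounded derivative in the first one. -/
theorem continuous_of_hasDerivAt_of_bounded {f f' : ℝ → ℝ → E}
    (hf : ∀ x t, HasDerivAt (fun y => f y t) (f' x t) x) (ht : ∀ x, Continuous (f x))
    (hb : ∀ X T : ℝ, ∃ C, ∀ x t, |x| ≤ X → |t| ≤ T → ‖f' x t‖ ≤ C) :
    Continuous fun p : ℝ × ℝ => f p.1 p.2 := by
  rw [continuous_iff_continuousAt]
  rintro ⟨x₀, t₀⟩
  obtain ⟨C, hC⟩ := hb (|x₀| + 1) (|t₀| + 1)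
  have hnx : Metric.ball x₀ 1 ∈ 𝓝 x₀ := Metric.ball_mem_nhds _ one_pos
  have hnt : Metric.ball t₀ 1 ∈ 𝓝 t₀ := Metric.ball_mem_nhds _ one_pos
  have key : ContinuousOn (fun p : ℝ × ℝ => f p.1 p.2) (Metric.ball x₀ 1 ×ˢ Metric.ball t₀ 1) := by
    refine continuousOn_prod_of_continuousOn_lipschitzOnWith _ (Real.toNNReal C)
      (fun x _ => (ht x).continuousOn) ?_
    · intro t ht'
      refine (convex_ball x₀ 1).lipschitzOnWith_of_nnnorm_hasDerivWithin_le
        (f' := fun x => f' x t) (fun x _ => (hf x t).hasDerivWithinAt) fun x hx => ?_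
      have h1 : |x| ≤ |x₀| + 1 := by
        have := abs_sub_abs_le_abs_sub x x₀
        rw [Metric.mem_ball, Real.dist_eq] at hx
        linarith
      have h2 : |t| ≤ |t₀| + 1 := by
        have := abs_sub_abs_le_abs_sub t t₀
        rw [Metric.mem_ball, Real.dist_eq] at ht'
        linarith
      rw [← NNReal.coe_le_coe, coe_nnnorm, Real.coe_toNNReal']
      exact (hC x t h1 h2).trans (le_max_left _ _)
  exact key.continuousAt (prod_mem_nhds hnx hnt)

namespace AiryFlow

variable {p : ℕ} {f : ℕ → ℝ → ℝ → E₁} {g : ℕ → ℝ → ℝ → E₂}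

theorem mono {q : ℕ} (hqp : q ≤ p) (hf : AiryFlow p f) : AiryFlow q f where
  hasDerivAt_space := hf.hasDerivAt_space
  hasDerivAt_time := hf.hasDerivAt_time
  decay k X T := by
    obtain ⟨C, hC⟩ := hf.decay k X T
    refine ⟨|C|, fun x t hx ht => (hC x t hx ht).trans ?_⟩
    have h1 : (1 : ℝ) ≤ 1 + x ^ 2 := by nlinarith [sq_nonneg x]
    have h2 : ((1 + x ^ 2) ^ p)⁻¹ ≤ ((1 + x ^ 2) ^ q)⁻¹ :=
      inv_anti₀ (by positivity) (pow_le_pow_right₀ h1 hqp)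
    calc C * ((1 + x ^ 2) ^ p)⁻¹ ≤ |C| * ((1 + x ^ 2) ^ p)⁻¹ := by
          gcongr; exact le_abs_self C
      _ ≤ |C| * ((1 + x ^ 2) ^ q)⁻¹ := by gcongr

theorem exists_norm_le (hf : AiryFlow p f) (k : ℕ) (X T : ℝ) :
    ∃ C, ∀ x t, -X ≤ x → |t| ≤ T → ‖f k x t‖ ≤ C := by
  obtain ⟨C, hC⟩ := (hf.mono (Nat.zero_le p)).decay k X T
  exact ⟨C, fun x t hx ht => by simpa using hC x t hx ht⟩

theorem continuous (hf : AiryFlow p f) (k : ℕ) : Continuous fun q : ℝ × ℝ => f k q.1 q.2 := by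
  refine continuous_of_hasDerivAt_of_bounded (hf.hasDerivAt_space k) (fun x => ?_) fun X T => ?_
  · exact continuous_iff_continuousAt.2 fun t => (hf.hasDerivAt_time k x t).continuousAt
  · obtain ⟨C, hC⟩ := hf.exists_norm_le (k + 1) X T
    exact ⟨C, fun x t hx => hC x t (by linarith [neg_abs_le x])⟩

theorem continuous_left (hf : AiryFlow p f) (k : ℕ) (t : ℝ) : Continuous fun x => f k x t :=
  (hf.continuous k).comp (by fun_prop : Continuous fun x : ℝ => (x, t))

theorem tendsto_zero (hf : AiryFlow 1 f) (k : ℕ) (x t : ℝ) :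
    Tendsto (fun y => f k (x + y) t) atTop (𝓝 0) := by
  obtain ⟨C, hC⟩ := hf.decay k 0 |t|
  have h1 : Tendsto (fun y : ℝ => C * ((1 + y ^ 2) ^ 1)⁻¹) atTop (𝓝 0) := by
    have : Tendsto (fun y : ℝ => 1 + y ^ 2) atTop atTop :=
      tendsto_atTop_add_const_left _ _ (tendsto_pow_atTop two_ne_zero)
    simpa using this.inv_tendsto_atTop.const_mul C
  have h2 : Tendsto (fun y => f k y t) atTop (𝓝 0) :=
    squeeze_zero_norm' ((eventually_ge_atTop 0).mono fun y hy => hC y t (by simpa using hy) le_rfl)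
      h1
  exact h2.comp (tendsto_atTop_add_const_left _ _ tendsto_id)

section Bilinear

variable (B : E₁ →L[ℝ] E₂ →L[ℝ] E₃) (hf : AiryFlow 1 f) (hg : AiryFlow 1 g)
include hf hg

/-- One factor is used through its decay, the other only through its boundedness. This already gives
an integrable majorant, uniform for `(x,t)` in compact sets, for all differentiations under the
integral below. -/
theorem exists_bilin_bound (k l : ℕ) (X T : ℝ) :
    ∃ C, ∀ x t y, |x| ≤ X → |t| ≤ T → 0 ≤ y →
      ‖B (f k (x + y) t) (g l (x + y) t)‖ ≤ C * (1 + y ^ 2)⁻¹ := by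
  obtain ⟨C₁, h₁⟩ := hf.decay k X T
  obtain ⟨C₂, h₂⟩ := hg.exists_norm_le l X T
  refine ⟨‖B‖ * |C₁| * |C₂| * (2 * (1 + X ^ 2)), fun x t y hx ht hy => ?_⟩
  have hxy : -X ≤ x + y := by linarith [neg_abs_le x]
  calc ‖B (f k (x + y) t) (g l (x + y) t)‖
      ≤ ‖B‖ * ‖f k (x + y) t‖ * ‖g l (x + y) t‖ := B.le_opNorm₂ _ _
    _ ≤ ‖B‖ * (|C₁| * (1 + (x + y) ^ 2)⁻¹) * |C₂| := by
        gcongr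
        · refine (h₁ _ t hxy ht).trans ?_
          rw [pow_one]
          gcongr
          exact le_abs_self _
        · exact (h₂ _ t hxy ht).trans (le_abs_self _)
    _ ≤ ‖B‖ * (|C₁| * (2 * (1 + X ^ 2) * (1 + y ^ 2)⁻¹)) * |C₂| := by
        gcongr
        exact inv_one_add_add_sq_le hx y
    _ = _ := by ring

theorem continuous_bilin (k l : ℕ) (x t : ℝ) :
    Continuous fun y => B (f k (x + y) t) (g l (x + y) t) := by
  have h1 := (hf.continuous_left k t).comp (continuous_const.add continuous_id : Continuous fun y => x + y)
  have h2 := (hg.continuous_left l t).comp (continuous_const.add continuous_id : Continuous fun y => x + y)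
  exact (B.continuous.comp h1).clm_apply h2

theorem integrableOn_bilin (k l : ℕ) (x t : ℝ) :
    IntegrableOn (fun y => B (f k (x + y) t) (g l (x + y) t)) (Ioi 0) := by
  obtain ⟨C, hC⟩ := exists_bilin_bound B hf hg k l |x| |t|
  refine Integrable.mono' ((integrable_inv_one_add_sq.const_mul C).integrableOn)
    (continuous_bilin B hf hg k l x t).aestronglyMeasurable ?_
  filter_upwards [ae_restrict_mem measurableSet_Ioi] with y hy
  exact hC x t y le_rfl le_rfl (le_of_lt hy)

theorem hasDerivAt_bilin_space (k l : ℕ) (x t : ℝ) :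
    HasDerivAt (fun y => B (f k y t) (g l y t))
      (B (f (k + 1) x t) (g l x t) + B (f k x t) (g (l + 1) x t)) x := by
  rw [add_comm]
  exact B.hasDerivAt_of_bilinear (fun _ => hf.hasDerivAt_space k x t)
    (fun _ => hg.hasDerivAt_space l x t)

theorem hasDerivAt_bilin_time (k l : ℕ) (x t : ℝ) :
    HasDerivAt (fun s => B (f k x s) (g l x s))
      (-(B (f (k + 3) x t) (g l x t) + B (f k x t) (g (l + 3) x t))) t := by
  have := B.hasDerivAt_of_bilinear (x := t) (fun _ => hf.hasDerivAt_time k x t)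
    (fun _ => hg.hasDerivAt_time l x t)
  convert this using 1
  simp [add_comm]

theorem integral_bilin_deriv [CompleteSpace E₃] (k l : ℕ) (x t : ℝ) :
    ∫ y in Ioi 0, (B (f (k + 1) (x + y) t) (g l (x + y) t) + B (f k (x + y) t) (g (l + 1) (x + y) t))
      = -B (f k x t) (g l x t) := by
  have hd : ∀ y ∈ Ici (0 : ℝ), HasDerivAt (fun y => B (f k (x + y) t) (g l (x + y) t))
      (B (f (k + 1) (x + y) t) (g l (x + y) t) + B (f k (x + y) t) (g (l + 1) (x + y) t)) y :=
    fun y _ => (hasDerivAt_bilin_space B hf hg k l (x + y) t).comp_const_add x y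
  have hlim : Tendsto (fun y => B (f k (x + y) t) (g l (x + y) t)) atTop (𝓝 0) := by
    have h := (B.isBoundedBilinearMap.continuous.tendsto (0, 0)).comp
      ((hf.tendsto_zero k x t).prodMk_nhds (hg.tendsto_zero l x t))
    simpa [Function.comp_def] using h
  rw [integral_Ioi_of_hasDerivAt_of_tendsto' hd
    ((integrableOn_bilin B hf hg _ _ x t).add (integrableOn_bilin B hf hg _ _ x t)) hlim]
  simp

/-- The integral over a half-line of a bilinear expression in two Airy flows. -/
theorem hasDerivAt_integral_space [CompleteSpace E₃] (x t : ℝ) :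
    HasDerivAt (fun x => ∫ y in Ioi 0, B (f 0 (x + y) t) (g 0 (x + y) t))
      (-B (f 0 x t) (g 0 x t)) x := by
  obtain ⟨C₁, h₁⟩ := exists_bilin_bound B hf hg 1 0 (|x| + 1) |t|
  obtain ⟨C₂, h₂⟩ := exists_bilin_bound B hf hg 0 1 (|x| + 1) |t|
  have := (hasDerivAt_integral_of_dominated_loc_of_deriv_le (μ := volume.restrict (Ioi (0 : ℝ)))
    (F := fun x y => B (f 0 (x + y) t) (g 0 (x + y) t)) (x₀ := x)
    (F' := fun x y => B (f 1 (x + y) t) (g 0 (x + y) t) + B (f 0 (x + y) t) (g 1 (x + y) t))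
    (bound := fun y => (C₁ + C₂) * (1 + y ^ 2)⁻¹)
    (Metric.ball_mem_nhds x one_pos)
    (Eventually.of_forall fun x => (continuous_bilin B hf hg 0 0 x t).aestronglyMeasurable)
    (integrableOn_bilin B hf hg 0 0 x t)
    (((continuous_bilin B hf hg 1 0 x t).add
      (continuous_bilin B hf hg 0 1 x t)).aestronglyMeasurable) ?_
    (integrable_inv_one_add_sq.const_mul _).integrableOn ?_).2
  -- Differentiating in `x` under the integral produces an exact `y`-derivative, so only the
  -- boundary value at `y = 0` survives.
  · rwa [integral_bilin_deriv B hf hg 0 0 x t] at this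
  · filter_upwards [ae_restrict_mem measurableSet_Ioi] with y hy x' hx'
    have hx : |x'| ≤ |x| + 1 := by
      have := abs_sub_abs_le_abs_sub x' x
      rw [Metric.mem_ball, Real.dist_eq] at hx'
      linarith
    rw [add_mul]
    exact (norm_add_le _ _).trans
      (add_le_add (h₁ _ t y hx le_rfl (le_of_lt hy)) (h₂ _ t y hx le_rfl (le_of_lt hy)))
  · filter_upwards with y x' _
    exact (hasDerivAt_bilin_space B hf hg 0 0 (x' + y) t).comp_add_const x' y

/-- The Airy equation replaces time derivatives by third space derivatives, and `f'''g + fg'''` is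
the exact derivative of `f''g - f'g' + fg''`. Both derivatives of the half-line integral are
therefore local in `x`. -/
theorem hasDerivAt_integral_time [CompleteSpace E₃] (x t : ℝ) :
    HasDerivAt (fun t => ∫ y in Ioi 0, B (f 0 (x + y) t) (g 0 (x + y) t))
      (B (f 2 x t) (g 0 x t) - B (f 1 x t) (g 1 x t) + B (f 0 x t) (g 2 x t)) t := by
  obtain ⟨C₁, h₁⟩ := exists_bilin_bound B hf hg 3 0 |x| (|t| + 1)
  obtain ⟨C₂, h₂⟩ := exists_bilin_bound B hf hg 0 3 |x| (|t| + 1)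
  have := (hasDerivAt_integral_of_dominated_loc_of_deriv_le (μ := volume.restrict (Ioi (0 : ℝ)))
    (F := fun t y => B (f 0 (x + y) t) (g 0 (x + y) t)) (x₀ := t)
    (F' := fun t y => -(B (f 3 (x + y) t) (g 0 (x + y) t) + B (f 0 (x + y) t) (g 3 (x + y) t)))
    (bound := fun y => (C₁ + C₂) * (1 + y ^ 2)⁻¹)
    (Metric.ball_mem_nhds t one_pos)
    (Eventually.of_forall fun t => (continuous_bilin B hf hg 0 0 x t).aestronglyMeasurable)
    (integrableOn_bilin B hf hg 0 0 x t)
    (((continuous_bilin B hf hg 3 0 x t).add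
      (continuous_bilin B hf hg 0 3 x t)).neg.aestronglyMeasurable) ?_
    (integrable_inv_one_add_sq.const_mul _).integrableOn ?_).2
  · convert this using 1
    rw [integral_neg]
    have e2 := integral_bilin_deriv B hf hg 2 0 x t
    have e1 := integral_bilin_deriv B hf hg 1 1 x t
    have e0 := integral_bilin_deriv B hf hg 0 2 x t
    have i := integrableOn_bilin B hf hg
    rw [integral_add (i _ _ x t) (i _ _ x t)] at e2 e1 e0 ⊢
    simp only [Nat.reduceAdd, zero_add] at e2 e1 e0
    have : ∀ a b c d u v w : E₃, a + b = -u → b + c = -v → c + d = -w → u - v + w = -(a + d) := by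
      intro a b c d u v w h1 h2 h3
      rw [← neg_eq_iff_eq_neg] at h1 h2 h3
      rw [← h1, ← h2, ← h3]
      abel
    exact this _ _ _ _ _ _ _ e2 e1 e0
  · filter_upwards [ae_restrict_mem measurableSet_Ioi] with y hy t' ht'
    have ht : |t'| ≤ |t| + 1 := by
      have := abs_sub_abs_le_abs_sub t' t
      rw [Metric.mem_ball, Real.dist_eq] at ht'
      linarith
    rw [add_mul, norm_neg]
    exact (norm_add_le _ _).trans
      (add_le_add (h₁ x _ y le_rfl ht (le_of_lt hy)) (h₂ x _ y le_rfl ht (le_of_lt hy)))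
  · filter_upwards with y t' _
    exact hasDerivAt_bilin_time B hf hg 0 0 (x + y) t'

theorem continuous_integral [CompleteSpace E₃] :
    Continuous fun p : ℝ × ℝ => ∫ y in Ioi 0, B (f 0 (p.1 + y) p.2) (g 0 (p.1 + y) p.2) := by
  refine continuous_of_hasDerivAt_of_bounded
    (f := fun x t => ∫ y in Ioi 0, B (f 0 (x + y) t) (g 0 (x + y) t))
    (hasDerivAt_integral_space B hf hg) (fun x => ?_) fun X T => ?_
  · exact continuous_iff_continuousAt.2 fun t =>
      (hasDerivAt_integral_time B hf hg x t).continuousAt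
  · obtain ⟨C, hC⟩ := exists_bilin_bound B hf hg 0 0 X T
    exact ⟨C, fun x t hx ht => by simpa using hC x t 0 hx ht le_rfl⟩

end Bilinear

end AiryFlow

end AiryFlow

end VmKdV

/-! ### Dressing of Airy flows by the resolvent of a nonnegative operator -/

namespace VmKdV

open MeasureTheory Filter Set

section Dressing

variable {H : Type*} [NormedAddCommGroup H] [InnerProductSpace ℝ H]

local notation "⟪" x ", " y "⟫" => inner ℝ x y

/-- The rank one operator `φ ↦ ⟪v, φ⟫ u` as a continuous bilinear map in `(v, u)`. -/
noncomputable def rankOneBilin (H : Type*) [NormedAddCommGroup H] [InnerProductSpace ℝ H] :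
    H →L[ℝ] H →L[ℝ] (H →L[ℝ] H) :=
  LinearMap.mkContinuous₂ (LinearMap.mk₂ ℝ (fun v u => (innerSL ℝ v).smulRight u)
    (by intros; ext; simp [add_smul])
    (by intros; ext; simp [mul_smul])
    (by intros; ext; simp)
    (by intro c v u; ext φ; simpa using smul_comm _ _ _)) 1 (by intro v u; simp)

@[simp]
theorem rankOneBilin_apply (v u φ : H) : rankOneBilin H v u φ = ⟪v, φ⟫ • u := by
  simp [rankOneBilin]

variable [CompleteSpace H] {n : ℕ} (ω : Fin n → ℕ → ℝ → ℝ → H) (γ : Fin n → ℕ → ℝ → ℝ → ℝ)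

/-- The nonnegative operator `∑ⱼ ∫₀^∞ ωⱼ(x + y) ⊗ ωⱼ(x + y) dy`. -/
noncomputable def gramOp (x t : ℝ) : H →L[ℝ] H :=
  ∑ j, ∫ y in Ioi (0 : ℝ), rankOneBilin H (ω j 0 (x + y) t) (ω j 0 (x + y) t)

/-- The vector `∑ⱼ ∫₀^∞ γⱼ(x + y) ωⱼ(x + y) dy`. -/
noncomputable def gramVec (x t : ℝ) : H :=
  ∑ j, ∫ y in Ioi (0 : ℝ), ContinuousLinearMap.lsmul ℝ ℝ (γ j 0 (x + y) t) (ω j 0 (x + y) t)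

/-- The resolvent `(1 + S)⁻¹` of the operator `S = gramOp ω`. -/
noncomputable def resolventOp (x t : ℝ) : H →L[ℝ] H := Ring.inverse (1 + gramOp ω x t)

/-- The boundary values of the dressed functions. -/
noncomputable def dressed (k : ℕ) (x t : ℝ) (i : Fin n) : ℝ :=
  γ i k x t - ⟪gramVec ω γ x t, resolventOp ω x t (ω i k x t)⟫

/-- The matrix elements of the resolvent. -/
noncomputable def dressedGram (k l : ℕ) (x t : ℝ) : Matrix (Fin n) (Fin n) ℝ :=
  Matrix.of fun i j => ⟪ω i k x t, resolventOp ω x t (ω j l x t)⟫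

variable {ω γ} (hω : ∀ i, AiryFlow 1 (ω i)) (hγ : ∀ i, AiryFlow 1 (γ i))

section
include hω

omit [CompleteSpace H] in
theorem gramOp_apply (x t : ℝ) (φ : H) :
    gramOp ω x t φ = ∑ j, ∫ y in Ioi (0 : ℝ), ⟪ω j 0 (x + y) t, φ⟫ • ω j 0 (x + y) t := by
  simp only [gramOp, sum_apply]
  refine Finset.sum_congr rfl fun j _ => ?_
  rw [ContinuousLinearMap.integral_apply
    (AiryFlow.integrableOn_bilin (rankOneBilin H) (hω j) (hω j) 0 0 x t)]
  simp

omit [CompleteSpace H] in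
theorem integrableOn_inner_smul (k l : ℕ) (j : Fin n) (x t : ℝ) (φ : H) :
    IntegrableOn (fun y => ⟪ω j k (x + y) t, φ⟫ • ω j l (x + y) t) (Ioi 0) := by
  have := (AiryFlow.integrableOn_bilin (rankOneBilin H) (hω j) (hω j) k l x t).apply_continuousLinearMap φ
  simpa [IntegrableOn] using this

theorem inner_gramOp (x t : ℝ) (φ ψ : H) :
    ⟪ψ, gramOp ω x t φ⟫ =
      ∑ j, ∫ y in Ioi (0 : ℝ), ⟪ω j 0 (x + y) t, φ⟫ * ⟪ψ, ω j 0 (x + y) t⟫ := by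
  rw [gramOp_apply hω, inner_sum]
  refine Finset.sum_congr rfl fun j _ => ?_
  rw [← integral_inner (integrableOn_inner_smul hω 0 0 j x t φ)]
  simp [inner_smul_right]

theorem inner_gramOp_comm (x t : ℝ) (φ ψ : H) :
    ⟪gramOp ω x t ψ, φ⟫ = ⟪ψ, gramOp ω x t φ⟫ := by
  rw [real_inner_comm, inner_gramOp hω, inner_gramOp hω]
  refine Finset.sum_congr rfl fun j _ => ?_
  congr 1
  ext y
  rw [mul_comm, real_inner_comm φ, real_inner_comm ψ]

/-- `S` is nonnegative as an integral of operators `v ⊗ v`, so `1 + S` is coercive. This sign, which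
reflects the focusing nonlinearity, gives solvability for all `x` and `t` without any smallness. -/
theorem isUnit_one_add_gramOp (x t : ℝ) : IsUnit (1 + gramOp ω x t) := by
  refine ContinuousLinearMap.isUnit_of_forall_le_norm_inner_map _ (c := 1) one_pos fun φ => ?_
  have h1 : 0 ≤ ⟪gramOp ω x t φ, φ⟫ := by
    rw [real_inner_comm, inner_gramOp hω]
    refine Finset.sum_nonneg fun j _ => integral_nonneg fun y => ?_
    rw [real_inner_comm φ]
    exact mul_self_nonneg _
  have h2 : ⟪(1 + gramOp ω x t) φ, φ⟫ = ‖φ‖ ^ 2 + ⟪gramOp ω x t φ, φ⟫ := by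
    simp [inner_add_left]
  rw [h2]
  refine le_trans ?_ (le_abs_self _)
  simpa using h1

theorem resolventOp_add (x t : ℝ) (φ : H) :
    resolventOp ω x t φ + gramOp ω x t (resolventOp ω x t φ) = φ := by
  have := congrArg (fun T : H →L[ℝ] H => T φ)
    (Ring.mul_inverse_cancel _ (isUnit_one_add_gramOp hω x t))
  simpa [resolventOp] using this

theorem eq_resolventOp {x t : ℝ} {φ ψ : H} (h : φ + gramOp ω x t φ = ψ) :
    φ = resolventOp ω x t ψ := by
  have := congrArg (fun T : H →L[ℝ] H => T φ)
    (Ring.inverse_mul_cancel _ (isUnit_one_add_gramOp hω x t))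
  rw [← h]
  simpa [resolventOp] using this.symm

theorem inner_resolventOp_comm (x t : ℝ) (φ ψ : H) :
    ⟪resolventOp ω x t φ, ψ⟫ = ⟪φ, resolventOp ω x t ψ⟫ := by
  conv_lhs => rw [← resolventOp_add hω x t ψ]
  conv_rhs => rw [← resolventOp_add hω x t φ]
  rw [inner_add_right, inner_add_left, inner_gramOp_comm hω]

omit hω in
theorem hasDerivAt_resolventOp_of {S : ℝ → H →L[ℝ] H} {S' : H →L[ℝ] H} {s : ℝ}
    (hS : HasDerivAt S S' s) (hu : IsUnit (1 + S s)) :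
    HasDerivAt (fun s => Ring.inverse (1 + S s))
      (-(Ring.inverse (1 + S s) * S' * Ring.inverse (1 + S s))) s := by
  obtain ⟨u, hu⟩ := hu
  have h1 := hasFDerivAt_ringInverse (𝕜 := ℝ) u
  rw [hu] at h1
  have h2 := h1.comp_hasDerivAt s (hS.const_add 1)
  simpa [Function.comp_def, ← hu] using h2

/-- The two minus signs cancel: one from `R' = -R S' R`, one from `S' = -∑ ω ⊗ ω`, the integral
being over the half-line to the right of `x`. -/
theorem hasDerivAt_resolventOp_space (x t : ℝ) :
    HasDerivAt (fun x => resolventOp ω x t)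
      (resolventOp ω x t * (∑ j, rankOneBilin H (ω j 0 x t) (ω j 0 x t)) * resolventOp ω x t) x := by
  have h : HasDerivAt (fun x => gramOp ω x t) (∑ j, -rankOneBilin H (ω j 0 x t) (ω j 0 x t)) x :=
    HasDerivAt.fun_sum fun j _ =>
      AiryFlow.hasDerivAt_integral_space (rankOneBilin H) (hω j) (hω j) x t
  have := hasDerivAt_resolventOp_of h (isUnit_one_add_gramOp hω x t)
  simpa [resolventOp, Finset.sum_neg_distrib] using this

theorem hasDerivAt_resolventOp_time (x t : ℝ) :
    HasDerivAt (fun t => resolventOp ω x t)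
      (-(resolventOp ω x t * (∑ j, (rankOneBilin H (ω j 2 x t) (ω j 0 x t)
        - rankOneBilin H (ω j 1 x t) (ω j 1 x t) + rankOneBilin H (ω j 0 x t) (ω j 2 x t)))
        * resolventOp ω x t)) t := by
  have h : HasDerivAt (fun t => gramOp ω x t) (∑ j, (rankOneBilin H (ω j 2 x t) (ω j 0 x t)
        - rankOneBilin H (ω j 1 x t) (ω j 1 x t) + rankOneBilin H (ω j 0 x t) (ω j 2 x t))) t :=
    HasDerivAt.fun_sum fun j _ =>
      AiryFlow.hasDerivAt_integral_time (rankOneBilin H) (hω j) (hω j) x t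
  exact hasDerivAt_resolventOp_of h (isUnit_one_add_gramOp hω x t)

theorem continuous_resolventOp : Continuous fun p : ℝ × ℝ => resolventOp ω p.1 p.2 := by
  rw [continuous_iff_continuousAt]
  intro p
  have h1 : Continuous fun p : ℝ × ℝ => 1 + gramOp ω p.1 p.2 :=
    continuous_const.add (continuous_finsetSum _ fun j _ =>
      AiryFlow.continuous_integral (rankOneBilin H) (hω j) (hω j))
  obtain ⟨u, hu⟩ := isUnit_one_add_gramOp hω p.1 p.2
  have h2 := NormedRing.inverse_continuousAt u
  rw [hu] at h2
  exact ContinuousAt.comp (f := fun p : ℝ × ℝ => 1 + gramOp ω p.1 p.2) h2 h1.continuousAt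

theorem continuous_dressedGram (k l : ℕ) (i j : Fin n) :
    Continuous fun p : ℝ × ℝ => dressedGram ω k l p.1 p.2 i j :=
  ((hω i).continuous k).inner ((continuous_resolventOp hω).clm_apply ((hω j).continuous l))

theorem dressedGram_transpose (k l : ℕ) (x t : ℝ) (i j : Fin n) :
    dressedGram ω k l x t i j = dressedGram ω l k x t j i := by
  simp only [dressedGram, Matrix.of_apply]
  rw [← inner_resolventOp_comm hω, real_inner_comm]

theorem hasDerivAt_resolventOp_apply (k : ℕ) (i : Fin n) (x t : ℝ) :
    HasDerivAt (fun x => resolventOp ω x t (ω i k x t))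
      (resolventOp ω x t (ω i (k + 1) x t) + ∑ m, dressedGram ω 0 k x t m i •
        resolventOp ω x t (ω m 0 x t)) x := by
  have := (hasDerivAt_resolventOp_space hω x t).clm_apply ((hω i).hasDerivAt_space k x t)
  refine HasDerivAt.congr_deriv this ?_
  simp [dressedGram, sum_apply, add_comm]

/-- This is only the product rule with the formula for `R'`. By `dressedGram_add` the right side
collapses to a rank-one matrix once integration by parts is available. -/
theorem hasDerivAt_dressedGram_aux (k l : ℕ) (i j : Fin n) (x t : ℝ) :
    HasDerivAt (fun x => dressedGram ω k l x t i j)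
      (dressedGram ω (k + 1) l x t i j + dressedGram ω k (l + 1) x t i j
        + ∑ m, dressedGram ω k 0 x t i m * dressedGram ω 0 l x t m j) x := by
  have := ((hω i).hasDerivAt_space k x t).inner ℝ (hasDerivAt_resolventOp_apply hω l j x t)
  refine HasDerivAt.congr_deriv this ?_
  simp only [dressedGram, Matrix.of_apply, inner_add_right, inner_sum, inner_smul_right]
  rw [add_comm (inner ℝ (ω i k x t) _ + _), add_assoc]
  simp [mul_comm]

end

section
include hω hγ

theorem continuous_dressed (k : ℕ) (i : Fin n) :
    Continuous fun p : ℝ × ℝ => dressed ω γ k p.1 p.2 i :=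
  ((hγ i).continuous k).sub (Continuous.inner (continuous_finsetSum _ fun j _ =>
    AiryFlow.continuous_integral (ContinuousLinearMap.lsmul ℝ ℝ) (hγ j) (hω j))
    ((continuous_resolventOp hω).clm_apply ((hω i).continuous k)))

theorem inner_gramVec (x t : ℝ) (φ : H) :
    ⟪gramVec ω γ x t, φ⟫ =
      ∑ j, ∫ y in Ioi (0 : ℝ), γ j 0 (x + y) t * ⟪ω j 0 (x + y) t, φ⟫ := by
  rw [real_inner_comm, gramVec, inner_sum]
  refine Finset.sum_congr rfl fun j _ => ?_
  rw [← integral_inner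
    (AiryFlow.integrableOn_bilin (ContinuousLinearMap.lsmul ℝ ℝ) (hγ j) (hω j) 0 0 x t)]
  simp [inner_smul_right, real_inner_comm]

/-- The derivative of `gramVec` contributes `∑ γ_m s_{0k}` and that of the resolvent contributes `-∑
⟨gramVec, R ω_m⟩ s_{0k}`. Together they form the coefficient `dressed` of order `0`. -/
theorem hasDerivAt_dressed (k : ℕ) (i : Fin n) (x t : ℝ) :
    HasDerivAt (fun x => dressed ω γ k x t i)
      (dressed ω γ (k + 1) x t i + ∑ m, dressed ω γ 0 x t m * dressedGram ω 0 k x t m i) x := by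
  have hτ : HasDerivAt (fun x => gramVec ω γ x t) (∑ j, -(γ j 0 x t • ω j 0 x t)) x :=
    HasDerivAt.fun_sum fun j _ => by
      simpa using AiryFlow.hasDerivAt_integral_space (ContinuousLinearMap.lsmul ℝ ℝ)
        (hγ j) (hω j) x t
  have := ((hγ i).hasDerivAt_space k x t).sub
    (hτ.inner ℝ (hasDerivAt_resolventOp_apply hω k i x t))
  refine HasDerivAt.congr_deriv this ?_
  simp only [dressed, dressedGram, Matrix.of_apply, inner_add_right, inner_sum, inner_smul_right,
    sum_inner, inner_neg_left, inner_smul_left, sub_mul, Finset.sum_sub_distrib,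
    Finset.sum_neg_distrib, conj_trivial]
  simp_rw [mul_comm ⟪gramVec ω γ x t, _⟫]
  ring

/-- As for the space derivative, but each of `gramVec` and `gramOp` now contributes the three-term
boundary expression of `hasDerivAt_integral_time`. The contributions pair up into dressed functions
of orders `2`, `1`, `0`. -/
theorem hasDerivAt_dressed_time (i : Fin n) (x t : ℝ) :
    HasDerivAt (fun t => dressed ω γ 0 x t i)
      (-(dressed ω γ 3 x t i) - ∑ m, (dressed ω γ 2 x t m * dressedGram ω 0 0 x t m i
        - dressed ω γ 1 x t m * dressedGram ω 1 0 x t m i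
        + dressed ω γ 0 x t m * dressedGram ω 2 0 x t m i)) t := by
  have hτ : HasDerivAt (fun t => gramVec ω γ x t) (∑ j, (γ j 2 x t • ω j 0 x t
      - γ j 1 x t • ω j 1 x t + γ j 0 x t • ω j 2 x t)) t :=
    HasDerivAt.fun_sum fun j _ => by
      simpa using AiryFlow.hasDerivAt_integral_time (ContinuousLinearMap.lsmul ℝ ℝ)
        (hγ j) (hω j) x t
  have hR := (hasDerivAt_resolventOp_time hω x t).clm_apply ((hω i).hasDerivAt_time 0 x t)
  have := ((hγ i).hasDerivAt_time 0 x t).sub (hτ.inner ℝ hR)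
  refine HasDerivAt.congr_deriv this ?_
  simp only [dressed, dressedGram, Matrix.of_apply, inner_add_right, inner_sum, inner_smul_right,
    sum_inner, inner_smul_left, sub_mul, Finset.sum_sub_distrib, inner_sub_left,
    inner_add_left, inner_sub_right, inner_neg_right, map_neg, _root_.neg_apply,
    conj_trivial, mul_apply_eq_comp, sum_apply, add_apply, sub_apply, rankOneBilin_apply,
    map_sum, map_add, map_sub, map_smul, Finset.sum_add_distrib, zero_add]
  simp_rw [mul_comm ⟪gramVec ω γ x t, _⟫]
  ring

end

section Green

variable (ω) in
/-- The space derivative of the dressed function `resolventOp ω x t (ω j l x t)`. -/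
noncomputable def dressedDeriv (l : ℕ) (x t : ℝ) (j : Fin n) : H :=
  ω j (l + 1) x t - ∑ m, ∫ y in Ioi (0 : ℝ),
    ⟪ω m 0 (x + y) t, resolventOp ω x t (ω j l x t)⟫ • ω m 1 (x + y) t

variable (hG : ∀ i j k l x y t, ⟪ω i (k + 1) x t, ω j l y t⟫ + ⟪ω i k x t, ω j (l + 1) y t⟫
  = -(γ i k x t * γ j l y t))

include hω hγ in
-- Abstract integration by parts. In `L²(0,∞)`, with `a'` the derivative of `a` and `c = a(0)`, the
-- hypothesis `h` says that `∫ (a'ω + aω') = -a(0)ω(0)`. Since `R ω` equals `ω` minus a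
-- superposition of the `ω_m`, the same rule passes to `R ω`: its derivative is `dressedDeriv` and
-- its boundary value is `dressed`.
theorem inner_dressedDeriv {t : ℝ} {a a' : H} {c : ℝ}
    (h : ∀ m k y, ⟪a', ω m k y t⟫ + ⟪a, ω m (k + 1) y t⟫ = -(c * γ m k y t))
    (j : Fin n) (l : ℕ) (x : ℝ) :
    ⟪a', resolventOp ω x t (ω j l x t)⟫ + ⟪a, dressedDeriv ω l x t j⟫
      = -(c * dressed ω γ l x t j) := by
  set u := resolventOp ω x t (ω j l x t) with hu
  have h1 : u = ω j l x t - ∑ m, ∫ y in Ioi (0 : ℝ), ⟪ω m 0 (x + y) t, u⟫ • ω m 0 (x + y) t := by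
    rw [← gramOp_apply hω, eq_sub_iff_add_eq]
    exact resolventOp_add hω x t _
  have h2 : ⟪a', u⟫ = ⟪a', ω j l x t⟫
      - ∑ m, ∫ y in Ioi (0 : ℝ), ⟪ω m 0 (x + y) t, u⟫ * ⟪a', ω m 0 (x + y) t⟫ := by
    conv_lhs => rw [h1]
    rw [inner_sub_right, inner_sum]
    congr 1
    refine Finset.sum_congr rfl fun m _ => ?_
    rw [← integral_inner (integrableOn_inner_smul hω 0 0 m x t u)]
    simp [inner_smul_right]
  have h3 : ⟪a, dressedDeriv ω l x t j⟫ = ⟪a, ω j (l + 1) x t⟫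
      - ∑ m, ∫ y in Ioi (0 : ℝ), ⟪ω m 0 (x + y) t, u⟫ * ⟪a, ω m 1 (x + y) t⟫ := by
    rw [dressedDeriv, inner_sub_right, inner_sum]
    congr 1
    refine Finset.sum_congr rfl fun m _ => ?_
    rw [← integral_inner (integrableOn_inner_smul hω 0 1 m x t u)]
    simp [inner_smul_right, hu]
  have h4 : ∀ m, (∫ y in Ioi (0 : ℝ), ⟪ω m 0 (x + y) t, u⟫ * ⟪a', ω m 0 (x + y) t⟫)
      + ∫ y in Ioi (0 : ℝ), ⟪ω m 0 (x + y) t, u⟫ * ⟪a, ω m 1 (x + y) t⟫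
      = -(c * ∫ y in Ioi (0 : ℝ), γ m 0 (x + y) t * ⟪ω m 0 (x + y) t, u⟫) := by
    intro m
    have i1 := (integrableOn_inner_smul hω 0 0 m x t u).const_inner (𝕜 := ℝ) a'
    have i2 := (integrableOn_inner_smul hω 0 1 m x t u).const_inner (𝕜 := ℝ) a
    simp only [inner_smul_right] at i1 i2
    rw [← integral_add i1 i2, ← integral_const_mul, ← integral_neg]
    refine integral_congr_ae (Eventually.of_forall fun y => ?_)
    simp only
    rw [← mul_add, h m 0 (x + y)]
    ring
  have h5 : ∑ m, ((∫ y in Ioi (0 : ℝ), ⟪ω m 0 (x + y) t, u⟫ * ⟪a', ω m 0 (x + y) t⟫)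
      + ∫ y in Ioi (0 : ℝ), ⟪ω m 0 (x + y) t, u⟫ * ⟪a, ω m 1 (x + y) t⟫)
      = -(c * ⟪gramVec ω γ x t, u⟫) := by
    rw [inner_gramVec hω hγ, Finset.mul_sum, ← Finset.sum_neg_distrib]
    exact Finset.sum_congr rfl fun m _ => h4 m
  rw [Finset.sum_add_distrib] at h5
  rw [h2, h3, dressed, ← hu]
  linear_combination h j l x - h5

include hω hγ hG

/-- The heart of the integrability. With `u = R ω_i` and `v = R ω_j`, integration by parts of `u`
against `v` gives the boundary term `-g_k g_l`. The correction between `dressedDeriv` and the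
undressed `ω^{(l+1)}` integrates to the product `s_{k0} s_{0l}`. The left side is the derivative
found in `hasDerivAt_dressedGram_aux`. -/
theorem dressedGram_add (k l : ℕ) (i j : Fin n) (x t : ℝ) :
    dressedGram ω (k + 1) l x t i j + dressedGram ω k (l + 1) x t i j
        + ∑ m, dressedGram ω k 0 x t i m * dressedGram ω 0 l x t m j
      = -(dressed ω γ k x t i * dressed ω γ l x t j) := by
  set u := resolventOp ω x t (ω i k x t) with hu
  set v := resolventOp ω x t (ω j l x t) with hv
  -- A first application, with `a` one of the `ω_m`, shows that `dressedDeriv` acts as the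
  -- derivative of `u` against every `ω_m`. This is the hypothesis needed for a second application
  -- with `a = u`.
  have h1 : ∀ m r y, ⟪dressedDeriv ω k x t i, ω m r y t⟫ + ⟪u, ω m (r + 1) y t⟫
      = -(dressed ω γ k x t i * γ m r y t) := fun m r y => by
    have := inner_dressedDeriv hω hγ (t := t) (a := ω m r y t) (a' := ω m (r + 1) y t)
      (c := γ m r y t) (fun m' k' y' => hG m m' r k' y y' t) i k x
    rw [real_inner_comm, add_comm, real_inner_comm (ω m (r + 1) y t), hu, this]
    ring
  have h2 := inner_dressedDeriv hω hγ h1 j l x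
  rw [← h2, dressedDeriv, dressedDeriv, ← hu, ← hv, inner_sub_left, inner_sub_right, inner_sum,
    sum_inner]
  -- The two integrals add up to that of the derivative of `⟪ω_m, u⟫⟪ω_m, v⟫` along the half-line,
  -- with `u` and `v` frozen.
  have h3 : ∀ m, ⟪∫ y in Ioi (0 : ℝ), ⟪ω m 0 (x + y) t, u⟫ • ω m 1 (x + y) t, v⟫
      + ⟪u, ∫ y in Ioi (0 : ℝ), ⟪ω m 0 (x + y) t, v⟫ • ω m 1 (x + y) t⟫
      = -(⟪ω m 0 x t, u⟫ * ⟪ω m 0 x t, v⟫) := by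
    intro m
    have i1 := (integrableOn_inner_smul hω 0 1 m x t u).const_inner (𝕜 := ℝ) v
    have i2 := (integrableOn_inner_smul hω 0 1 m x t v).const_inner (𝕜 := ℝ) u
    rw [real_inner_comm, ← integral_inner (integrableOn_inner_smul hω 0 1 m x t u),
      ← integral_inner (integrableOn_inner_smul hω 0 1 m x t v), ← integral_add i1 i2]
    have h := AiryFlow.integral_bilin_deriv (rankOneBilin H) (hω m) (hω m) 0 0 x t
    have i3 : IntegrableOn (fun y => rankOneBilin H (ω m 1 (x + y) t) (ω m 0 (x + y) t)
        + rankOneBilin H (ω m 0 (x + y) t) (ω m 1 (x + y) t)) (Ioi 0) := (AiryFlow.integrableOn_bilin (rankOneBilin H) (hω m) (hω m) 1 0 x t).add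
      (AiryFlow.integrableOn_bilin (rankOneBilin H) (hω m) (hω m) 0 1 x t)
    have h' := congrArg (fun T : H →L[ℝ] H => ⟪v, T u⟫) h
    simp only [zero_add] at h'
    rw [ContinuousLinearMap.integral_apply i3, ← integral_inner
      (i3.apply_continuousLinearMap u)] at h'
    refine Eq.trans (integral_congr_ae (Eventually.of_forall fun y => ?_)) (h'.trans ?_)
    · simp only [add_apply, rankOneBilin_apply, inner_add_right, inner_smul_right,
        real_inner_comm v, real_inner_comm u]
      ring
    · simp [inner_smul_right, real_inner_comm v]
  have h4 := Finset.sum_congr (rfl : (Finset.univ : Finset (Fin n)) = _) fun m _ => h3 m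
  rw [Finset.sum_add_distrib, Finset.sum_neg_distrib] at h4
  have h5 : ∑ m, dressedGram ω k 0 x t i m * dressedGram ω 0 l x t m j
      = ∑ m, ⟪ω m 0 x t, u⟫ * ⟪ω m 0 x t, v⟫ :=
    Finset.sum_congr rfl fun m _ => by
      rw [dressedGram_transpose hω k 0]
      rfl
  have h6 : dressedGram ω (k + 1) l x t i j = ⟪ω i (k + 1) x t, v⟫ := rfl
  have h7 : dressedGram ω k (l + 1) x t i j = ⟪u, ω j (l + 1) x t⟫ := by
    rw [hu, inner_resolventOp_comm hω]
    rfl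
  rw [h5, h6, h7]
  linear_combination h4

theorem hasDerivAt_dressedGram (k l : ℕ) (i j : Fin n) (x t : ℝ) :
    HasDerivAt (fun x => dressedGram ω k l x t i j)
      (-(dressed ω γ k x t i * dressed ω γ l x t j)) x := by
  rw [← dressedGram_add hω hγ hG]
  exact hasDerivAt_dressedGram_aux hω k l i j x t

end Green

end Dressing

end VmKdV

/-! ### The vector mKdV equation from the closed system for the dressed quantities -/

namespace VmKdV

open MeasureTheory Filter Set

section Algebra

theorem isSolution_of_hasDerivAt {n : ℕ} {q q₁ q₂ q₃ q' : ℝ → ℝ → Fin n → ℝ}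
    (h₀ : ∀ x t, HasDerivAt (fun y => q y t) (q₁ x t) x)
    (h₁ : ∀ x t, HasDerivAt (fun y => q₁ y t) (q₂ x t) x)
    (h₂ : ∀ x t, HasDerivAt (fun y => q₂ y t) (q₃ x t) x)
    (h' : ∀ x t, HasDerivAt (fun s => q x s) (q' x t) t)
    (c₀ : Continuous fun p : ℝ × ℝ => q p.1 p.2) (c₁ : Continuous fun p : ℝ × ℝ => q₁ p.1 p.2)
    (c₂ : Continuous fun p : ℝ × ℝ => q₂ p.1 p.2) (c₃ : Continuous fun p : ℝ × ℝ => q₃ p.1 p.2)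
    (c' : Continuous fun p : ℝ × ℝ => q' p.1 p.2)
    (heq : ∀ x t, q' x t + q₃ x t
      + (3 : ℝ) • ((q x t ⬝ᵥ q x t) • q₁ x t + (q x t ⬝ᵥ q₁ x t) • q x t) = 0) :
    IsSolution q := by
  have d₀ : ∀ t, deriv (fun y => q y t) = fun y => q₁ y t := fun t => funext fun x => (h₀ x t).deriv
  have d₁ : ∀ t, deriv (fun y => q₁ y t) = fun y => q₂ y t := fun t => funext fun x => (h₁ x t).deriv
  have d₂ : ∀ t, deriv (fun y => q₂ y t) = fun y => q₃ y t := fun t => funext fun x => (h₂ x t).deriv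
  have i₁ : ∀ t, iteratedDeriv 1 (fun y => q y t) = fun y => q₁ y t := fun t => by
    rw [iteratedDeriv_one, d₀]
  have i₂ : ∀ t, iteratedDeriv 2 (fun y => q y t) = fun y => q₂ y t := fun t => by
    rw [iteratedDeriv_succ, i₁, d₁]
  have i₃ : ∀ t, iteratedDeriv 3 (fun y => q y t) = fun y => q₃ y t := fun t => by
    rw [iteratedDeriv_succ, i₂, d₂]
  have hslice : ∀ {r : ℝ → ℝ → Fin n → ℝ}, (Continuous fun p : ℝ × ℝ => r p.1 p.2) →
      ∀ t, Continuous fun y => r y t := fun hr t =>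
    hr.comp (by fun_prop : Continuous fun y : ℝ => (y, t))
  constructor
  · intro t _
    refine contDiff_nat_iff_iteratedDeriv.2 ⟨fun m hm => ?_, fun m hm => ?_⟩
    · interval_cases m
      · simpa using hslice c₀ t
      · simpa only [i₁] using hslice c₁ t
      · simpa only [i₂] using hslice c₂ t
      · simpa only [i₃] using hslice c₃ t
    · interval_cases m
      · rw [iteratedDeriv_zero]
        exact fun x => (h₀ x t).differentiableAt
      · rw [i₁]
        exact fun x => (h₁ x t).differentiableAt
      · rw [i₂]
        exact fun x => (h₂ x t).differentiableAt
  · exact fun x t _ => (h' x t).differentiableAt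
  · intro j hj
    interval_cases j
    · simpa using c₀.continuousOn
    · simpa only [i₁] using c₁.continuousOn
    · simpa only [i₂] using c₂.continuousOn
    · simpa only [i₃] using c₃.continuousOn
  · simpa only [(h' _ _).deriv] using c'.continuousOn
  · intro x t _
    rw [(h' x t).deriv, i₃, d₀]
    exact heq x t

variable {m n : Type*} [Fintype m]

theorem hasDerivAt_vecMul {v : ℝ → m → ℝ} {v' : m → ℝ} {A : ℝ → Matrix m n ℝ}
    {A' : Matrix m n ℝ} {x : ℝ} [Fintype n] (hv : HasDerivAt v v' x)
    (hA : ∀ i j, HasDerivAt (fun x => A x i j) (A' i j) x) :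
    HasDerivAt (fun x => v x ᵥ* A x) (v' ᵥ* A x + v x ᵥ* A') x := by
  rw [hasDerivAt_pi] at hv ⊢
  intro j
  have := HasDerivAt.fun_sum (u := Finset.univ) fun i _ => (hv i).mul (hA i j)
  refine HasDerivAt.congr_deriv this ?_
  simp [Matrix.vecMul, dotProduct, Finset.sum_add_distrib]

theorem hasDerivAt_dotProduct {v w : ℝ → m → ℝ} {v' w' : m → ℝ} {x : ℝ}
    (hv : HasDerivAt v v' x) (hw : HasDerivAt w w' x) :
    HasDerivAt (fun x => v x ⬝ᵥ w x) (v' ⬝ᵥ w x + v x ⬝ᵥ w') x := by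
  rw [hasDerivAt_pi] at hv hw
  have := HasDerivAt.fun_sum (u := Finset.univ) fun i _ => (hv i).mul (hw i)
  refine HasDerivAt.congr_deriv this ?_
  simp [dotProduct, Finset.sum_add_distrib]

end Algebra

section Solution

variable {H : Type*} [NormedAddCommGroup H] [InnerProductSpace ℝ H] [CompleteSpace H]
  {n : ℕ} {ω : Fin n → ℕ → ℝ → ℝ → H} {γ : Fin n → ℕ → ℝ → ℝ → ℝ}

/-- The mKdV equation for the boundary value of a dressed Airy flow. -/
theorem isSolution_dressed (hω : ∀ i, AiryFlow 1 (ω i)) (hγ : ∀ i, AiryFlow 1 (γ i))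
    (hG : ∀ i j k l x y t, inner ℝ (ω i (k + 1) x t) (ω j l y t)
      + inner ℝ (ω i k x t) (ω j (l + 1) y t) = -(γ i k x t * γ j l y t)) :
    IsSolution (dressed ω γ 0) := by
  have hg : ∀ k x t, HasDerivAt (fun x => dressed ω γ k x t)
      (dressed ω γ (k + 1) x t + dressed ω γ 0 x t ᵥ* dressedGram ω 0 k x t) x := fun k x t =>
    hasDerivAt_pi.2 fun i => hasDerivAt_dressed hω hγ k i x t
  have hs : ∀ k x t i j, HasDerivAt (fun x => dressedGram ω 0 k x t i j)
      ((-Matrix.vecMulVec (dressed ω γ 0 x t) (dressed ω γ k x t)) i j) x := fun k x t i j =>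
    hasDerivAt_dressedGram hω hγ hG 0 k i j x t
  have hsum : ∀ k l x t, dressedGram ω (k + 1) l x t + dressedGram ω k (l + 1) x t
      + dressedGram ω k 0 x t * dressedGram ω 0 l x t
      = -Matrix.vecMulVec (dressed ω γ k x t) (dressed ω γ l x t) := fun k l x t => by
    ext i j
    exact dressedGram_add hω hγ hG k l i j x t
  have ht : ∀ x t, HasDerivAt (fun t => dressed ω γ 0 x t) (-dressed ω γ 3 x t
      - (dressed ω γ 2 x t ᵥ* dressedGram ω 0 0 x t - dressed ω γ 1 x t ᵥ* dressedGram ω 1 0 x t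
        + dressed ω γ 0 x t ᵥ* dressedGram ω 2 0 x t)) t := fun x t =>
    hasDerivAt_pi.2 fun i => by
      refine HasDerivAt.congr_deriv (hasDerivAt_dressed_time hω hγ i x t) ?_
      simp [Matrix.vecMul, dotProduct, Finset.sum_add_distrib, Finset.sum_sub_distrib]
  have cg : ∀ k, Continuous fun p : ℝ × ℝ => dressed ω γ k p.1 p.2 := fun k =>
    continuous_pi fun i => continuous_dressed hω hγ k i
  have cs : ∀ k l, Continuous fun p : ℝ × ℝ => dressedGram ω k l p.1 p.2 := fun k l =>
    continuous_matrix fun i j => continuous_dressedGram hω k l i j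
  set g := dressed ω γ with hgdef
  set s := dressedGram ω with hsdef
  -- The derivatives of `g 0` are generated by `g_k' = g_{k+1} + g_0 s_{0k}` and `s_{0k}' = -g_0
  -- g_kᵀ`. In `q₃` the last group differentiates the cubic term in the form `(g_0 ⬝ g_0) g_0`.
  let q₁ : ℝ → ℝ → Fin n → ℝ := fun x t => g 1 x t + g 0 x t ᵥ* s 0 0 x t
  let q₂ : ℝ → ℝ → Fin n → ℝ := fun x t => g 2 x t + g 0 x t ᵥ* s 0 1 x t
    + (q₁ x t ᵥ* s 0 0 x t + g 0 x t ᵥ* -Matrix.vecMulVec (g 0 x t) (g 0 x t))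
  let q₃ : ℝ → ℝ → Fin n → ℝ := fun x t => g 3 x t + g 0 x t ᵥ* s 0 2 x t
    + (q₁ x t ᵥ* s 0 1 x t + g 0 x t ᵥ* -Matrix.vecMulVec (g 0 x t) (g 1 x t))
    + ((q₂ x t ᵥ* s 0 0 x t + q₁ x t ᵥ* -Matrix.vecMulVec (g 0 x t) (g 0 x t))
    - ((g 0 x t ⬝ᵥ g 0 x t) • q₁ x t + (q₁ x t ⬝ᵥ g 0 x t + g 0 x t ⬝ᵥ q₁ x t) • g 0 x t))
  have h₀ : ∀ x t, HasDerivAt (fun x => g 0 x t) (q₁ x t) x := hg 0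
  have h₁ : ∀ x t, HasDerivAt (fun x => q₁ x t) (q₂ x t) x := fun x t =>
    (hg 1 x t).add (hasDerivAt_vecMul (h₀ x t) (hs 0 x t))
  have e : ∀ a b : Fin n → ℝ, a ᵥ* -Matrix.vecMulVec a b = -((a ⬝ᵥ a) • b) := fun a b => by
    rw [Matrix.vecMul_neg, Matrix.vecMul_vecMulVec]
  have h₂ : ∀ x t, HasDerivAt (fun x => q₂ x t) (q₃ x t) x := fun x t => by
    have h := ((hasDerivAt_dotProduct (h₀ x t) (h₀ x t)).smul (h₀ x t)).neg
    have := ((hg 2 x t).add (hasDerivAt_vecMul (h₀ x t) (hs 1 x t))).add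
      ((hasDerivAt_vecMul (h₁ x t) (hs 0 x t)).add h)
    simp only [q₂, e]
    exact this
  refine isSolution_of_hasDerivAt h₀ h₁ h₂ ht (cg 0) ?_ ?_ ?_ ?_ fun x t => ?_
  · fun_prop
  · fun_prop
  · fun_prop
  · fun_prop
  -- Four contractions of the identity for `s` suffice. The entries `s_{11}`, which occur in neither
  -- the space nor the time derivative, cancel between `e1` and `e2`.
  · have e0 := congrArg (fun A => g 1 x t ᵥ* A) (hsum 0 0 x t)
    have e1 := congrArg (fun A => g 0 x t ᵥ* A) (hsum 0 1 x t)
    have e2 := congrArg (fun A => g 0 x t ᵥ* A) (hsum 1 0 x t)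
    have e3 := congrArg (fun A => g 0 x t ᵥ* A ᵥ* s 0 0 x t) (hsum 0 0 x t)
    have c1 : g 1 x t ⬝ᵥ g 0 x t = g 0 x t ⬝ᵥ g 1 x t := dotProduct_comm _ _
    have c2 : g 0 x t ⬝ᵥ (g 0 x t ᵥ* s 0 0 x t) = (g 0 x t ᵥ* s 0 0 x t) ⬝ᵥ g 0 x t :=
      dotProduct_comm _ _
    ext i
    replace e0 := congrFun e0 i
    replace e1 := congrFun e1 i
    replace e2 := congrFun e2 i
    replace e3 := congrFun e3 i
    simp only [Matrix.vecMul_add, Matrix.vecMul_neg, Matrix.vecMul_vecMulVec, Matrix.add_vecMul,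
      Matrix.neg_vecMul, Matrix.smul_vecMul, Matrix.vecMul_vecMul, Nat.reduceAdd, zero_add,
      Pi.add_apply, Pi.neg_apply, Pi.smul_apply, smul_eq_mul, Matrix.mul_assoc,
      c1] at e0 e1 e2 e3
    simp only [q₁, q₂, q₃, e, Matrix.add_vecMul, Matrix.vecMul_vecMul, add_dotProduct,
      dotProduct_add, Matrix.neg_vecMul, Matrix.vecMul_neg, Matrix.vecMul_vecMulVec, c1, c2,
      Matrix.smul_vecMul, Matrix.mul_assoc, Pi.add_apply, Pi.neg_apply, Pi.smul_apply,
      Pi.sub_apply, smul_eq_mul, Pi.zero_apply]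
    linear_combination e0 + e1 - e2 + e3

end Solution

end VmKdV

/-! ### Realization in `L²(0,∞)` and the Marchenko equation -/

namespace VmKdV

open MeasureTheory Filter Set

section HalfLine

/-- The real Hilbert space `L²(0, ∞)`. -/
abbrev HalfLineL2 : Type := Lp ℝ 2 (volume.restrict (Ioi (0 : ℝ)))

local notation "⟪" x ", " y "⟫" => inner ℝ x y

theorem memLp_inv_one_add_sq :
    MemLp (fun y : ℝ => (1 + y ^ 2)⁻¹) 2 (volume.restrict (Ioi (0 : ℝ))) := by
  have hc : Continuous fun y : ℝ => (1 + y ^ 2)⁻¹ :=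
    Continuous.inv₀ (by fun_prop) fun y => by positivity
  refine (memLp_two_iff_integrable_sq hc.aestronglyMeasurable).2 ?_
  refine Integrable.mono' integrable_inv_one_add_sq.integrableOn
    (hc.pow 2).aestronglyMeasurable (Eventually.of_forall fun y => ?_)
  have h1 : (1 + y ^ 2)⁻¹ ≤ 1 := inv_le_one_of_one_le₀ (by nlinarith [sq_nonneg y])
  have h0 : 0 ≤ (1 + y ^ 2)⁻¹ := by positivity
  rw [Real.norm_of_nonneg (sq_nonneg _)]
  nlinarith

theorem memLp_of_le_inv_one_add_sq {φ : ℝ → ℝ} {C : ℝ}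
    (hm : AEStronglyMeasurable φ (volume.restrict (Ioi 0)))
    (hφ : ∀ y, 0 < y → |φ y| ≤ C * (1 + y ^ 2)⁻¹) :
    MemLp φ 2 (volume.restrict (Ioi (0 : ℝ))) := by
  refine (memLp_inv_one_add_sq.const_mul C).mono' hm ?_
  filter_upwards [ae_restrict_mem measurableSet_Ioi] with y hy
  exact hφ y hy

theorem norm_toLp_le_of_le {φ : ℝ → ℝ} {C : ℝ} (hm : MemLp φ 2 (volume.restrict (Ioi (0 : ℝ))))
    (hφ : ∀ y, 0 < y → |φ y| ≤ C * (1 + y ^ 2)⁻¹) :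
    ‖hm.toLp φ‖ ≤ C * ‖memLp_inv_one_add_sq.toLp _‖ := by
  refine Lp.norm_le_mul_norm_of_ae_le_mul ?_
  filter_upwards [hm.coeFn_toLp, memLp_inv_one_add_sq.coeFn_toLp,
    ae_restrict_mem measurableSet_Ioi] with y h1 h2 hy
  rw [h1, h2, Real.norm_of_nonneg (by positivity : 0 ≤ (1 + y ^ 2)⁻¹)]
  exact hφ y hy

theorem inner_toLp {φ ψ : ℝ → ℝ} (hφ : MemLp φ 2 (volume.restrict (Ioi (0 : ℝ))))
    (hψ : MemLp ψ 2 (volume.restrict (Ioi (0 : ℝ)))) :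
    ⟪hφ.toLp φ, hψ.toLp ψ⟫ = ∫ y in Ioi (0 : ℝ), φ y * ψ y := by
  rw [L2.inner_def]
  refine integral_congr_ae ?_
  filter_upwards [hφ.coeFn_toLp, hψ.coeFn_toLp] with y h1 h2
  rw [h1, h2]
  simp [mul_comm]

/-- Differentiability in `L²(0, ∞)` from a bound on the second pointwise derivative. -/
theorem hasDerivAt_toLp {φ φ' φ'' : ℝ → ℝ → ℝ} {p₀ C : ℝ}
    (hφ : ∀ p, MemLp (φ p) 2 (volume.restrict (Ioi (0 : ℝ))))
    (hφ' : MemLp (φ' p₀) 2 (volume.restrict (Ioi (0 : ℝ))))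
    (h₁ : ∀ p y, HasDerivAt (fun p => φ p y) (φ' p y) p)
    (h₂ : ∀ p y, HasDerivAt (fun p => φ' p y) (φ'' p y) p)
    (hb : ∀ p y, |p - p₀| ≤ 1 → 0 < y → |φ'' p y| ≤ C * (1 + y ^ 2)⁻¹) :
    HasDerivAt (fun p => (hφ p).toLp (φ p)) (hφ'.toLp (φ' p₀)) p₀ := by
  have hmv : ∀ {g g' : ℝ → ℝ} {p K δ : ℝ}, |p - p₀| ≤ δ →
      (∀ q, HasDerivAt g (g' q) q) → (∀ q, |q - p₀| ≤ δ → |g' q| ≤ K) →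
      |g p - g p₀| ≤ K * |p - p₀| := by
    intro g g' p K δ hp hg hK
    have h0 : (0 : ℝ) ≤ δ := (abs_nonneg _).trans hp
    exact (convex_closedBall p₀ δ).norm_image_sub_le_of_norm_hasDerivWithin_le
      (fun q _ => (hg q).hasDerivWithinAt) (fun q hq => hK q (by simpa [Real.dist_eq] using hq))
      (by simpa using h0) (by simpa [Real.dist_eq] using hp)
  -- A Taylor estimate for each `y`: the mean value inequality is applied to `φ'` and then to `φ`
  -- minus its linear part. The weight in the quadratic error makes it an `L²` error.
  have key : ∀ p y, |p - p₀| ≤ 1 → 0 < y →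
      |φ p y - φ p₀ y - (p - p₀) * φ' p₀ y| ≤ C * |p - p₀| ^ 2 * (1 + y ^ 2)⁻¹ := by
    intro p y hp hy
    have hd : ∀ q, HasDerivAt (fun q => φ q y - q * φ' p₀ y) (φ' q y - φ' p₀ y) q := fun q => by
      exact ((h₁ q y).sub ((hasDerivAt_id q).mul_const (φ' p₀ y))).congr_deriv (by simp)
    have hK : ∀ q, |q - p₀| ≤ |p - p₀| →
        |φ' q y - φ' p₀ y| ≤ C * (1 + y ^ 2)⁻¹ * |p - p₀| := by
      intro q hq
      refine (hmv (hq.trans hp) (fun q => h₂ q y) fun r hr => hb r y hr hy).trans ?_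
      have : 0 ≤ C * (1 + y ^ 2)⁻¹ := (abs_nonneg _).trans (hb p y hp hy)
      gcongr
    have := hmv le_rfl hd hK
    calc _ = |φ p y - p * φ' p₀ y - (φ p₀ y - p₀ * φ' p₀ y)| := by ring_nf
      _ ≤ _ := this
      _ = _ := by ring
  rw [hasDerivAt_iff_isLittleO]
  refine Asymptotics.IsBigO.trans_isLittleO (g := fun p => |p - p₀| ^ 2) ?_ ?_
  · refine Asymptotics.IsBigO.of_bound (C * ‖memLp_inv_one_add_sq.toLp _‖) ?_
    filter_upwards [Metric.closedBall_mem_nhds p₀ one_pos] with p hp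
    have hp' : |p - p₀| ≤ 1 := by simpa [Real.dist_eq] using hp
    have e : (hφ p).toLp (φ p) - (hφ p₀).toLp (φ p₀) - (p - p₀) • hφ'.toLp (φ' p₀)
        = (((hφ p).sub (hφ p₀)).sub (hφ'.const_smul (p - p₀))).toLp _ := rfl
    rw [e, Real.norm_of_nonneg (by positivity : 0 ≤ |p - p₀| ^ 2)]
    refine (norm_toLp_le_of_le _ fun y hy => ?_).trans_eq
      (by ring : C * |p - p₀| ^ 2 * ‖memLp_inv_one_add_sq.toLp _‖ = _)
    exact key p y hp' hy
  · have h1 : (fun p => |p - p₀| ^ 2) = fun p => (p - p₀) * (p - p₀) := by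
      ext p; rw [sq_abs, sq]
    rw [h1]
    have h2 : (fun p => p - p₀) =o[𝓝 p₀] fun _ => (1 : ℝ) := by
      rw [Asymptotics.isLittleO_one_iff]
      have : ContinuousAt (fun p => p - p₀) p₀ := by fun_prop
      simpa using this.tendsto
    simpa using (Asymptotics.isBigO_refl (fun p => p - p₀) (𝓝 p₀)).mul_isLittleO h2

namespace AiryFlow

variable {f : ℕ → ℝ → ℝ → ℝ}

/-- The two powers in the decay of `AiryFlow 2` are shared out: one makes the translate square
integrable in `y`, the other remains as decay in `x`. -/
theorem exists_translate_bound (hf : AiryFlow 2 f) (k : ℕ) (X T : ℝ) :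
    ∃ C, 0 ≤ C ∧ ∀ x t y, -X ≤ x → |t| ≤ T → 0 ≤ y →
      |f k (x + y) t| ≤ C * (1 + x ^ 2)⁻¹ * (1 + y ^ 2)⁻¹ := by
  obtain ⟨C, hC⟩ := hf.decay k |X| T
  refine ⟨|C| * (2 * (1 + X ^ 2) ^ 2), by positivity, fun x t y hx ht hy => ?_⟩
  have hx' : -|X| ≤ x := (neg_le_neg (le_abs_self X)).trans hx
  have hxy : -|X| ≤ x + y := by linarith
  refine (hC (x + y) t hxy ht).trans ?_
  have key : (1 + x ^ 2) * (1 + y ^ 2) ≤ 2 * (1 + X ^ 2) ^ 2 * (1 + (x + y) ^ 2) ^ 2 := by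
    -- For `x ≥ 0` both `x` and `y` are at most `x + y`. For `x < 0` the variable `x` stays in a
    -- bounded interval and Peetre's inequality handles `y`.
    rcases le_or_gt 0 x with h | h
    · have h1 : 1 + x ^ 2 ≤ 1 + (x + y) ^ 2 := by nlinarith
      have h2 : 1 + y ^ 2 ≤ 1 + (x + y) ^ 2 := by nlinarith
      have h3 : (1 + x ^ 2) * (1 + y ^ 2) ≤ (1 + (x + y) ^ 2) * (1 + (x + y) ^ 2) := by gcongr
      have h4 : (1 : ℝ) ≤ 2 * (1 + X ^ 2) ^ 2 := by nlinarith [sq_nonneg X]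
      nlinarith [mul_le_mul_of_nonneg_right h4 (sq_nonneg (1 + (x + y) ^ 2))]
    · have h1 : x ^ 2 ≤ X ^ 2 := by
        rw [← sq_abs X]; nlinarith
      have h2 := one_add_sq_le_mul x y
      have h3 : (1 : ℝ) ≤ 1 + (x + y) ^ 2 := by nlinarith [sq_nonneg (x + y)]
      calc (1 + x ^ 2) * (1 + y ^ 2)
          ≤ (1 + X ^ 2) * (2 * (1 + X ^ 2) * (1 + (x + y) ^ 2)) := by
            gcongr
            exact h2.trans (by gcongr)
        _ = 2 * (1 + X ^ 2) ^ 2 * ((1 + (x + y) ^ 2) * 1) := by ring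
        _ ≤ 2 * (1 + X ^ 2) ^ 2 * ((1 + (x + y) ^ 2) * (1 + (x + y) ^ 2)) := by gcongr
        _ = _ := by ring
  have h5 : ((1 + (x + y) ^ 2) ^ 2)⁻¹ ≤ 2 * (1 + X ^ 2) ^ 2 * ((1 + x ^ 2)⁻¹ * (1 + y ^ 2)⁻¹) := by
    rw [← mul_inv, ← div_eq_mul_inv, inv_eq_one_div,
      div_le_div_iff₀ (by positivity) (by positivity), one_mul]
    exact key
  calc C * ((1 + (x + y) ^ 2) ^ 2)⁻¹ ≤ |C| * ((1 + (x + y) ^ 2) ^ 2)⁻¹ := by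
        gcongr; exact le_abs_self C
    _ ≤ |C| * (2 * (1 + X ^ 2) ^ 2 * ((1 + x ^ 2)⁻¹ * (1 + y ^ 2)⁻¹)) := by gcongr
    _ = _ := by ring

theorem memLp_translate (hf : AiryFlow 2 f) (k : ℕ) (x t : ℝ) :
    MemLp (fun y => f k (x + y) t) 2 (volume.restrict (Ioi (0 : ℝ))) := by
  obtain ⟨C, _, hC⟩ := hf.exists_translate_bound k |x| |t|
  exact memLp_of_le_inv_one_add_sq
    ((hf.continuous_left k t).comp (by fun_prop : Continuous fun y => x + y)).aestronglyMeasurable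
    fun y hy => hC x t y (neg_abs_le x) le_rfl hy.le

/-- The translates `y ↦ f k (x + y) t` as elements of `L²(0, ∞)`. -/
noncomputable def translate (hf : AiryFlow 2 f) (k : ℕ) (x t : ℝ) : HalfLineL2 :=
  (hf.memLp_translate k x t).toLp _

/-- One power of decay is spent on the `L²` norm, whence `AiryFlow 1`. Differentiability in `L²`
rests on bounds for second derivatives: order `k + 2` in space, and `k + 6` in time because each
time derivative costs three space derivatives. -/
theorem airyFlow_translate (hf : AiryFlow 2 f) : AiryFlow 1 hf.translate where
  hasDerivAt_space k x t := by
    obtain ⟨C, hC0, hC⟩ := hf.exists_translate_bound (k + 2) (|x| + 1) |t|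
    refine hasDerivAt_toLp (φ := fun x y => f k (x + y) t) (φ' := fun x y => f (k + 1) (x + y) t)
      (φ'' := fun x y => f (k + 2) (x + y) t) (C := C) (fun p => hf.memLp_translate k p t)
      (hf.memLp_translate (k + 1) x t)
      (fun p y => (hf.hasDerivAt_space k (p + y) t).comp_add_const p y)
      (fun p y => (hf.hasDerivAt_space (k + 1) (p + y) t).comp_add_const p y) fun p y hp hy => ?_
    have hp' : -(|x| + 1) ≤ p := by linarith [neg_abs_le x, (abs_le.1 hp).1]
    refine (hC p t y hp' le_rfl hy.le).trans ?_
    have : (1 + p ^ 2)⁻¹ ≤ 1 := inv_le_one_of_one_le₀ (by nlinarith [sq_nonneg p])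
    gcongr
    exact mul_le_of_le_one_right hC0 this
  hasDerivAt_time k x t := by
    obtain ⟨C, hC0, hC⟩ := hf.exists_translate_bound (k + 6) |x| (|t| + 1)
    have hm := (hf.memLp_translate (k + 3) x t).neg
    have := hasDerivAt_toLp (φ := fun t y => f k (x + y) t) (φ' := fun t y => -f (k + 3) (x + y) t)
      (φ'' := fun t y => - -f (k + 6) (x + y) t) (C := C) (fun p => hf.memLp_translate k x p) hm
      (fun p y => hf.hasDerivAt_time k (x + y) p)
      (fun p y => (hf.hasDerivAt_time (k + 3) (x + y) p).neg) fun p y hp hy => ?_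
    · exact this
    have hp' : |p| ≤ |t| + 1 := by linarith [abs_sub_abs_le_abs_sub p t]
    rw [neg_neg]
    refine (hC x p y (neg_abs_le x) hp' hy.le).trans ?_
    have : (1 + x ^ 2)⁻¹ ≤ 1 := inv_le_one_of_one_le₀ (by nlinarith [sq_nonneg x])
    gcongr
    exact mul_le_of_le_one_right hC0 this
  decay k X T := by
    obtain ⟨C, _, hC⟩ := hf.exists_translate_bound k X T
    refine ⟨C * ‖memLp_inv_one_add_sq.toLp _‖, fun x t hx ht => ?_⟩
    refine (norm_toLp_le_of_le _ fun y hy => hC x t y hx ht hy.le).trans_eq ?_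
    rw [pow_one]
    ring

theorem inner_translate (f g : ℕ → ℝ → ℝ → ℝ) (hf : AiryFlow 2 f) (hg : AiryFlow 2 g)
    (k l : ℕ) (x y t : ℝ) :
    ⟪hf.translate k x t, hg.translate l y t⟫
      = ∫ z in Ioi (0 : ℝ), f k (x + z) t * g l (y + z) t :=
  inner_toLp _ _

theorem integrableOn_translate_mul {g : ℕ → ℝ → ℝ → ℝ} (hf : AiryFlow 2 f) (hg : AiryFlow 2 g)
    (k l : ℕ) (x y t : ℝ) :
    IntegrableOn (fun z => f k (x + z) t * g l (y + z) t) (Ioi 0) :=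
  (hf.memLp_translate k x t).integrable_mul (hg.memLp_translate l y t)

/-- The fundamental theorem of calculus for `f g` on `(0,∞)`. This supplies the integration-by-parts
hypothesis of the abstract dressing theory, with `f` itself as boundary value of its translates. -/
theorem inner_translate_add {g : ℕ → ℝ → ℝ → ℝ} (hf : AiryFlow 2 f) (hg : AiryFlow 2 g)
    (k l : ℕ) (x y t : ℝ) :
    ⟪hf.translate (k + 1) x t, hg.translate l y t⟫ + ⟪hf.translate k x t, hg.translate (l + 1) y t⟫
      = -(f k x t * g l y t) := by
  rw [inner_translate, inner_translate, ← integral_add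
    (integrableOn_translate_mul hf hg _ _ _ _ _) (integrableOn_translate_mul hf hg _ _ _ _ _)]
  have hd : ∀ z ∈ Ici (0 : ℝ), HasDerivAt (fun z => f k (x + z) t * g l (y + z) t)
      (f (k + 1) (x + z) t * g l (y + z) t + f k (x + z) t * g (l + 1) (y + z) t) z := fun z _ =>
    ((hf.hasDerivAt_space k (x + z) t).comp_const_add x z).mul
      ((hg.hasDerivAt_space l (y + z) t).comp_const_add y z)
  have hlim := ((hf.mono one_le_two).tendsto_zero k x t).mul
    ((hg.mono one_le_two).tendsto_zero l y t)
  rw [integral_Ioi_of_hasDerivAt_of_tendsto' hd ((integrableOn_translate_mul hf hg _ _ _ _ _).add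
    (integrableOn_translate_mul hf hg _ _ _ _ _)) hlim]
  simp

end AiryFlow

variable {n : ℕ} {f : Fin n → ℕ → ℝ → ℝ → ℝ} (hf : ∀ j, AiryFlow 2 (f j))
include hf

theorem isSolution_dressed_translate :
    IsSolution (dressed (fun j => (hf j).translate) f 0) :=
  isSolution_dressed (fun j => (hf j).airyFlow_translate) (fun j => (hf j).mono one_le_two)
    fun i j k l x y t => (hf i).inner_translate_add (hf j) k l x y t

/-- A solution of the Marchenko equation takes the value `dressed` at the origin. -/
theorem eq_dressed_of_marchenko {φ : ℝ → ℝ} {ψ : Fin n → ℝ → ℝ} {c C x t : ℝ} (i : Fin n)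
    (hm : AEStronglyMeasurable φ (volume.restrict (Ioi 0)))
    (hb : ∀ y, 0 < y → |φ y| ≤ C * (1 + y ^ 2)⁻¹)
    (hψ : ∀ j z, 0 ≤ z → ψ j z = -∫ y in Ioi (0 : ℝ), φ y * f j 0 (x + z + y) t)
    (hφ : ∀ y, 0 ≤ y → φ y = c * f i 0 (x + y) t
      + ∑ j, ∫ z in Ioi (0 : ℝ), ψ j z * f j 0 (x + z + y) t) :
    φ 0 = c * dressed (fun j => (hf j).translate) f 0 x t i := by
  set ω : Fin n → ℕ → ℝ → ℝ → HalfLineL2 := fun j => (hf j).translate with hωdef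
  have hω : ∀ j, AiryFlow 1 (ω j) := fun j => (hf j).airyFlow_translate
  have hφm := memLp_of_le_inv_one_add_sq hm hb
  set Φ : HalfLineL2 := hφm.toLp φ with hΦ
  have h1 : ∀ j z, 0 ≤ z → ψ j z = -⟪ω j 0 (x + z) t, Φ⟫ := fun j z hz => by
    rw [hψ j z hz, real_inner_comm, hΦ]
    exact congrArg Neg.neg (inner_toLp _ _).symm
  have hψb : ∀ j, ∃ K, ∀ z, 0 ≤ z → |⟪ω j 0 (x + z) t, Φ⟫| ≤ K := fun j => by
    obtain ⟨K, hK⟩ := (hω j).exists_norm_le 0 |x| |t|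
    refine ⟨K * ‖Φ‖, fun z hz => (abs_real_inner_le_norm _ _).trans ?_⟩
    gcongr
    exact hK _ _ (by linarith [neg_abs_le x]) le_rfl
  -- Eliminating `ψ` from the system gives exactly this operator equation. It is verified against
  -- test vectors `η`, where Fubini exchanges the variable of `L²` with the one in the integral
  -- defining `gramOp`.
  have hΦeq : Φ + gramOp ω x t Φ = c • ω i 0 x t := by
    refine ext_inner_left ℝ fun η => ?_
    have hη : AEStronglyMeasurable η (volume.restrict (Ioi (0 : ℝ))) := (Lp.memLp η).1
    have e0 : ∀ ζ : HalfLineL2, ∀ χ : ℝ → ℝ, (ζ =ᵐ[volume.restrict (Ioi (0 : ℝ))] χ) →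
        ⟪η, ζ⟫ = ∫ y in Ioi (0 : ℝ), η y * χ y := fun ζ χ h => by
      rw [L2.inner_def]
      refine integral_congr_ae ?_
      filter_upwards [h] with y hy
      rw [hy]
      simp [mul_comm]
    have eω : ∀ j z, ⟪η, ω j 0 z t⟫ = ∫ y in Ioi (0 : ℝ), η y * f j 0 (z + y) t := fun j z =>
      e0 _ _ (MemLp.coeFn_toLp _)
    -- Absolute integrability for Fubini: the inner product is bounded, and the two-variable bound
    -- for the kernel separates into an integrable function of `z` and a square integrable weight to
    -- be paired with `η`.
    have hint : ∀ j, Integrable (fun p : ℝ × ℝ =>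
        η p.1 * (⟪ω j 0 (x + p.2) t, Φ⟫ * f j 0 (x + p.2 + p.1) t))
        ((volume.restrict (Ioi (0 : ℝ))).prod (volume.restrict (Ioi (0 : ℝ)))) := fun j => by
      obtain ⟨K, hK⟩ := hψb j
      obtain ⟨C', hC'0, hC'⟩ := (hf j).exists_translate_bound 0 |x| |t|
      have g1 : Integrable (fun y => |η y| * (1 + y ^ 2)⁻¹) (volume.restrict (Ioi (0 : ℝ))) :=
        (Lp.memLp η).abs.integrable_mul memLp_inv_one_add_sq
      have g2 : Integrable (fun z : ℝ => K * (C' * (1 + (x + z) ^ 2)⁻¹))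
          (volume.restrict (Ioi (0 : ℝ))) :=
        (((integrable_inv_one_add_sq.comp_add_left x).const_mul C').const_mul K).integrableOn
      refine (g1.mul_prod g2).mono' ?_ ?_
      · refine hη.comp_fst.mul (Continuous.aestronglyMeasurable ?_)
        have c1 : Continuous fun p : ℝ × ℝ => ω j 0 (x + p.2) t :=
          ((hω j).continuous_left 0 t).comp (by fun_prop)
        have c2 : Continuous fun p : ℝ × ℝ => f j 0 (x + p.2 + p.1) t :=
          ((hf j).continuous_left 0 t).comp (by fun_prop)
        exact (c1.inner continuous_const).mul c2
      · rw [Measure.prod_restrict]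
        filter_upwards [ae_restrict_mem (measurableSet_Ioi.prod measurableSet_Ioi)] with p hp
        have hp1 : 0 < p.1 := hp.1
        have hp2 : 0 < p.2 := hp.2
        have b1 := hK p.2 hp2.le
        have b2 := hC' (x + p.2) t p.1 (by linarith [neg_abs_le x]) le_rfl hp1.le
        have hK0 : 0 ≤ K := (abs_nonneg _).trans b1
        rw [norm_mul, norm_mul, Real.norm_eq_abs, Real.norm_eq_abs, Real.norm_eq_abs]
        calc _ ≤ |η p.1| * (K * (C' * (1 + (x + p.2) ^ 2)⁻¹ * (1 + p.1 ^ 2)⁻¹)) := by gcongr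
          _ = _ := by ring
    have eΦ : ⟪η, Φ⟫ = c * ⟪η, ω i 0 x t⟫
        - ∑ j, ∫ y in Ioi (0 : ℝ), ∫ z in Ioi (0 : ℝ),
          η y * (⟪ω j 0 (x + z) t, Φ⟫ * f j 0 (x + z + y) t) := by
      rw [e0 Φ φ hφm.coeFn_toLp, eω, ← integral_const_mul,
        ← integral_finsetSum _ fun j _ => (hint j).integral_prod_left, ← integral_sub]
      · refine setIntegral_congr_fun measurableSet_Ioi fun y hy => ?_
        have hy' : 0 < y := hy
        simp only
        rw [hφ y hy'.le, mul_add, Finset.mul_sum, sub_eq_add_neg, ← Finset.sum_neg_distrib]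
        congr 1
        · ring
        · refine Finset.sum_congr rfl fun j _ => ?_
          rw [← integral_const_mul, ← integral_neg]
          refine setIntegral_congr_fun measurableSet_Ioi fun z hz => ?_
          rw [h1 j z (le_of_lt hz)]
          ring
      · exact ((Lp.memLp η).integrable_mul ((hf i).memLp_translate 0 x t)).const_mul c
      · exact integrable_finsetSum _ fun j _ => (hint j).integral_prod_left
    rw [inner_add_right, eΦ, inner_gramOp hω, inner_smul_right, sub_add, sub_eq_self, sub_eq_zero]
    refine Finset.sum_congr rfl fun j _ => ?_
    rw [integral_integral_swap (hint j)]
    refine integral_congr_ae (Eventually.of_forall fun z => ?_)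
    simp only
    rw [eω, ← integral_const_mul]
    refine integral_congr_ae (Eventually.of_forall fun y => ?_)
    simp only
    ring
  -- Uniqueness for the Marchenko equation: invertibility of `1 + S` identifies `Φ`.
  have hΦR : Φ = c • resolventOp ω x t (ω i 0 x t) := by
    rw [← map_smul]
    exact eq_resolventOp hω hΦeq
  -- At `y = 0` the function `f j 0 (x + z)` takes the place of the vector `ω j 0 (x + z)`, and the
  -- integral of its products with `⟪ω j 0 (x + z), Φ⟫` is the pairing of `Φ` with `gramVec`.
  rw [hφ 0 le_rfl, dressed, mul_sub, ← real_inner_smul_right, ← hΦR,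
    inner_gramVec hω fun j => (hf j).mono one_le_two]
  rw [sub_eq_add_neg, ← Finset.sum_neg_distrib]
  congr 1
  · simp
  · refine Finset.sum_congr rfl fun j _ => ?_
    rw [← integral_neg]
    refine setIntegral_congr_fun measurableSet_Ioi fun z hz => ?_
    rw [h1 j z (le_of_lt hz), add_zero]
    ring

end HalfLine

end VmKdV

/-! ### Exponential integrals along curves and their decay -/

namespace VmKdV

open MeasureTheory Filter Set

section ExpIntegral

open Complex

/-- The integral of `(2iσ)^k w e^{2iθ(x,t;σ)}`. -/
noncomputable def expIntegral (μ : Measure ℝ) (σ w : ℝ → ℂ) (k : ℕ) (x t : ℝ) : ℂ :=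
  ∫ s, (2 * I * σ s) ^ k * w s * exp (2 * I * theta x t (σ s)) ∂μ

/-- Continuity of the curve `σ` and the weight `w`, and finiteness of all moments. -/
structure HasExpMoments (μ : Measure ℝ) (σ w : ℝ → ℂ) : Prop where
  continuous_curve : Continuous σ
  continuous_weight : Continuous w
  integrable : ∀ (k : ℕ) (X T : ℝ), Integrable (fun s => ‖2 * I * σ s‖ ^ k * ‖w s‖
    * Real.exp (2 * (X * |(σ s).im| + 4 * T * |(σ s ^ 3).im|))) μ

theorem norm_exp_theta (x t : ℝ) (z : ℂ) :
    ‖exp (2 * I * theta x t z)‖ = Real.exp (-2 * (x * z.im + 4 * t * (z ^ 3).im)) := by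
  rw [norm_exp]
  congr 1
  have : (theta x t z).im = x * z.im + 4 * t * (z ^ 3).im := by
    simp only [theta, add_im, mul_im, ofReal_re, ofReal_im, mul_re]
    norm_num
    ring
  rw [← this]
  simp [mul_re, mul_im]

theorem norm_exp_theta_le {x t X T : ℝ} (hx : |x| ≤ X) (ht : |t| ≤ T) (z : ℂ) :
    ‖exp (2 * I * theta x t z)‖ ≤ Real.exp (2 * (X * |z.im| + 4 * T * |(z ^ 3).im|)) := by
  rw [norm_exp_theta]
  apply Real.exp_le_exp.2
  have h1 : -(x * z.im) ≤ X * |z.im| := by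
    refine (neg_le_abs _).trans ?_
    rw [abs_mul]
    gcongr
  have h2 : -(t * (z ^ 3).im) ≤ T * |(z ^ 3).im| := by
    refine (neg_le_abs _).trans ?_
    rw [abs_mul]
    gcongr
  linarith

theorem hasDerivAt_exp_theta_space (x t : ℝ) (z : ℂ) :
    HasDerivAt (fun y : ℝ => exp (2 * I * theta y t z))
      (2 * I * z * exp (2 * I * theta x t z)) x := by
  have h1 : HasDerivAt (fun y : ℝ => 2 * I * theta y t z) (2 * I * z) x := by
    have := (((hasDerivAt_id x).ofReal_comp.const_mul z).add_const (4 * z ^ 3 * t)).const_mul (2 * I)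
    simpa [theta] using this
  simpa [mul_comm] using h1.cexp

/-- Here the dispersion relation enters: `2i · 4z³ = -(2iz)³`, so `e^{2iθ}` solves the Airy
equation. -/
theorem hasDerivAt_exp_theta_time (x t : ℝ) (z : ℂ) :
    HasDerivAt (fun s : ℝ => exp (2 * I * theta x s z))
      (-(2 * I * z) ^ 3 * exp (2 * I * theta x t z)) t := by
  have h1 : HasDerivAt (fun s : ℝ => 2 * I * theta x s z) (-(2 * I * z) ^ 3) t := by
    have := (((hasDerivAt_id t).ofReal_comp.const_mul (4 * z ^ 3)).const_add (z * x)).const_mul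
      (2 * I)
    refine HasDerivAt.congr_deriv (by simpa [theta] using this) ?_
    rw [mul_pow, mul_pow, I_pow_three]
    ring
  simpa [mul_comm] using h1.cexp

theorem continuous_theta (x t : ℝ) : Continuous (theta x t) := by
  unfold theta
  fun_prop

namespace HasExpMoments

variable {μ : Measure ℝ} {σ w : ℝ → ℂ} (h : HasExpMoments μ σ w)
include h

theorem continuous_integrand (k : ℕ) (x t : ℝ) :
    Continuous fun s => (2 * I * σ s) ^ k * w s * exp (2 * I * theta x t (σ s)) := by
  have h1 := h.continuous_curve
  have h2 := h.continuous_weight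
  have h3 := (continuous_theta x t).comp h1
  exact (((continuous_const.mul h1).pow k).mul h2).mul (continuous_const.mul h3).cexp

omit h in
theorem norm_integrand_le {x t X T : ℝ} (hx : |x| ≤ X) (ht : |t| ≤ T) (k : ℕ) (s : ℝ) :
    ‖(2 * I * σ s) ^ k * w s * exp (2 * I * theta x t (σ s))‖ ≤ ‖2 * I * σ s‖ ^ k * ‖w s‖
      * Real.exp (2 * (X * |(σ s).im| + 4 * T * |(σ s ^ 3).im|)) := by
  rw [norm_mul, norm_mul, norm_pow]
  gcongr
  exact norm_exp_theta_le hx ht _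

theorem integrable_integrand (k : ℕ) (x t : ℝ) :
    Integrable (fun s => (2 * I * σ s) ^ k * w s * exp (2 * I * theta x t (σ s))) μ :=
  (h.integrable k |x| |t|).mono' (h.continuous_integrand k x t).aestronglyMeasurable
    (Eventually.of_forall fun s => norm_integrand_le le_rfl le_rfl k s)

theorem hasDerivAt_space (k : ℕ) (x t : ℝ) :
    HasDerivAt (fun y => expIntegral μ σ w k y t) (expIntegral μ σ w (k + 1) x t) x := by
  refine (hasDerivAt_integral_of_dominated_loc_of_deriv_le
    (F := fun y s => (2 * I * σ s) ^ k * w s * exp (2 * I * theta y t (σ s)))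
    (F' := fun y s => (2 * I * σ s) ^ (k + 1) * w s * exp (2 * I * theta y t (σ s)))
    (Metric.ball_mem_nhds x one_pos)
    (Eventually.of_forall fun y => (h.continuous_integrand k y t).aestronglyMeasurable)
    (h.integrable_integrand k x t) (h.continuous_integrand (k + 1) x t).aestronglyMeasurable
    (Eventually.of_forall fun s y hy => ?_) (h.integrable (k + 1) (|x| + 1) |t|)
    (Eventually.of_forall fun s y _ => ?_)).2
  · refine norm_integrand_le ?_ le_rfl (k + 1) s
    rw [Metric.mem_ball, Real.dist_eq] at hy
    linarith [abs_sub_abs_le_abs_sub y x]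
  · refine ((hasDerivAt_exp_theta_space y t (σ s)).const_mul _).congr_deriv ?_
    ring

theorem hasDerivAt_time (k : ℕ) (x t : ℝ) :
    HasDerivAt (fun s => expIntegral μ σ w k x s) (-expIntegral μ σ w (k + 3) x t) t := by
  rw [expIntegral, ← integral_neg]
  refine (hasDerivAt_integral_of_dominated_loc_of_deriv_le
    (F := fun t s => (2 * I * σ s) ^ k * w s * exp (2 * I * theta x t (σ s)))
    (F' := fun t s => -((2 * I * σ s) ^ (k + 3) * w s * exp (2 * I * theta x t (σ s))))
    (Metric.ball_mem_nhds t one_pos)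
    (Eventually.of_forall fun y => (h.continuous_integrand k x y).aestronglyMeasurable)
    (h.integrable_integrand k x t) (h.continuous_integrand (k + 3) x t).neg.aestronglyMeasurable
    (Eventually.of_forall fun s y hy => ?_) (h.integrable (k + 3) |x| (|t| + 1))
    (Eventually.of_forall fun s y _ => ?_)).2
  · rw [norm_neg]
    refine norm_integrand_le le_rfl ?_ (k + 3) s
    rw [Metric.mem_ball, Real.dist_eq] at hy
    linarith [abs_sub_abs_le_abs_sub y t]
  · refine ((hasDerivAt_exp_theta_time x y (σ s)).const_mul _).congr_deriv ?_
    ring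

/-- The multipliers used later are the boundary values of the entries of the Riemann–Hilbert
solution, of which only continuity and boundedness are known. -/
theorem mul_bounded {m : ℝ → ℂ} {C : ℝ} (hm : Continuous m) (hb : ∀ s, ‖m s‖ ≤ C) :
    HasExpMoments μ σ (fun s => m s * w s) where
  continuous_curve := h.continuous_curve
  continuous_weight := hm.mul h.continuous_weight
  integrable k X T := by
    have h1 := h.continuous_curve
    have h2 := h.continuous_weight
    refine ((h.integrable k X T).const_mul C).mono' (Continuous.aestronglyMeasurable ?_)
      (Eventually.of_forall fun s => ?_)
    · fun_prop
    · rw [Real.norm_of_nonneg (by positivity), norm_mul (m s)]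
      calc _ = ‖m s‖ * (‖2 * I * σ s‖ ^ k * ‖w s‖
            * Real.exp (2 * (X * |(σ s).im| + 4 * T * |(σ s ^ 3).im|))) := by ring
        _ ≤ _ := mul_le_mul_of_nonneg_right (hb s) (by positivity)

end HasExpMoments

section RealLine

open SchwartzMap

theorem hasExpMoments_schwartz (φ : 𝓢(ℝ, ℂ)) : HasExpMoments volume (fun s : ℝ => (s : ℂ)) φ where
  continuous_curve := continuous_ofReal
  continuous_weight := φ.continuous
  integrable k X T := by
    have h1 : ∀ s : ℝ, ((s : ℂ) ^ 3).im = 0 := fun s => by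
      rw [← ofReal_pow, ofReal_im]
    have := (φ.integrable_pow_mul volume k).const_mul (2 ^ k)
    refine this.congr (Eventually.of_forall fun s => ?_)
    simp [h1, mul_pow, mul_assoc]

theorem expIntegral_schwartz_succ (φ : 𝓢(ℝ, ℂ)) (k : ℕ) (x t : ℝ) :
    expIntegral volume (fun s : ℝ => (s : ℂ)) φ (k + 1) x t
      = expIntegral volume (fun s : ℝ => (s : ℂ))
        (smulLeftCLM ℂ (fun s : ℝ => 2 * I * (s : ℂ)) φ) k x t := by
  have hg : Function.HasTemperateGrowth (fun s : ℝ => 2 * I * (s : ℂ)) := by fun_prop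
  simp only [expIntegral, smulLeftCLM_apply_apply hg, smul_eq_mul]
  congr 1
  ext s
  ring

/-- Integration by parts against the phase. -/
theorem mul_expIntegral_schwartz (φ : 𝓢(ℝ, ℂ)) (x t : ℝ) :
    2 * I * x * expIntegral volume (fun s : ℝ => (s : ℂ)) φ 0 x t
      = -expIntegral volume (fun s : ℝ => (s : ℂ)) (derivCLM ℂ ℂ φ) 0 x t
        - 24 * I * t * expIntegral volume (fun s : ℝ => (s : ℂ))
          (smulLeftCLM ℂ (fun s : ℝ => (s : ℂ) ^ 2) φ) 0 x t := by
  have hg : Function.HasTemperateGrowth (fun s : ℝ => (s : ℂ) ^ 2) := by fun_prop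
  have i0 := (hasExpMoments_schwartz φ).integrable_integrand 0 x t
  have i1 := (hasExpMoments_schwartz (derivCLM ℂ ℂ φ)).integrable_integrand 0 x t
  have i2 := (hasExpMoments_schwartz (smulLeftCLM ℂ (fun s : ℝ => (s : ℂ) ^ 2) φ)).integrable_integrand
    0 x t
  simp only [pow_zero, one_mul, smulLeftCLM_apply_apply hg, smul_eq_mul, derivCLM_apply] at i0 i1 i2
  have hd : ∀ s : ℝ, HasDerivAt (fun s : ℝ => φ s * exp (2 * I * theta x t s))
      (deriv φ s * exp (2 * I * theta x t s) + 2 * I * x * (φ s * exp (2 * I * theta x t s))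
        + 24 * I * t * (s ^ 2 * φ s * exp (2 * I * theta x t s))) s := by
    intro s
    have hθ : HasDerivAt (fun s : ℝ => 2 * I * theta x t s) (2 * I * (x + 12 * s ^ 2 * t)) s := by
      have h1 : HasDerivAt (fun z : ℂ => 2 * I * theta x t z) (2 * I * (x + 12 * (s : ℂ) ^ 2 * t))
          (s : ℂ) := by
        have := (((hasDerivAt_id (s : ℂ)).mul_const (x : ℂ)).add
          (((hasDerivAt_pow 3 (s : ℂ)).const_mul 4).mul_const (t : ℂ))).const_mul (2 * I)
        refine HasDerivAt.congr_deriv this ?_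
        simp only [one_mul, Nat.reduceSub]
        push_cast
        ring
      exact h1.comp_ofReal
    refine ((φ.hasDerivAt s).mul hθ.cexp).congr_deriv ?_
    ring
  have i3 : Integrable (fun s : ℝ => deriv φ s * exp (2 * I * theta x t s)
      + 2 * I * x * (φ s * exp (2 * I * theta x t s))) := i1.add (i0.const_mul (2 * I * x))
  have key := integral_eq_zero_of_hasDerivAt_of_integrable hd
    (i3.add (i2.const_mul (24 * I * t))) i0
  rw [integral_add i3 (i2.const_mul (24 * I * t)),
    integral_add i1 (i0.const_mul (2 * I * x)), integral_const_mul, integral_const_mul] at key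
  simp only [expIntegral, pow_zero, one_mul, smulLeftCLM_apply_apply hg, smul_eq_mul,
    derivCLM_apply]
  linear_combination key

/-- Each factor `x` is traded for one integration by parts. The term with `t s²` produced by the
cubic part of the phase stays Schwartz, so the induction runs over all Schwartz functions at once
and is uniform for bounded `t`. -/
theorem exists_pow_mul_expIntegral_schwartz_le (p : ℕ) (T : ℝ) (φ : 𝓢(ℝ, ℂ)) :
    ∃ C, ∀ x t, |t| ≤ T → |x| ^ p * ‖expIntegral volume (fun s : ℝ => (s : ℂ)) φ 0 x t‖ ≤ C := by
  induction p generalizing φ with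
  | zero =>
    refine ⟨∫ s, ‖φ s‖, fun x t _ => ?_⟩
    rw [pow_zero, one_mul, expIntegral]
    refine (norm_integral_le_integral_norm _).trans_eq (integral_congr_ae
      (Eventually.of_forall fun s => ?_))
    have h1 : ((s : ℂ) ^ 3).im = 0 := by rw [← ofReal_pow, ofReal_im]
    simp only [pow_zero, one_mul, norm_mul, norm_exp_theta, h1, ofReal_im]
    simp
  | succ p ih =>
    obtain ⟨C₁, h₁⟩ := ih (derivCLM ℂ ℂ φ)
    obtain ⟨C₂, h₂⟩ := ih (smulLeftCLM ℂ (fun s : ℝ => (s : ℂ) ^ 2) φ)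
    refine ⟨(C₁ + 24 * |T| * C₂) / 2, fun x t ht => ?_⟩
    have e := congrArg norm (mul_expIntegral_schwartz φ x t)
    rw [norm_mul] at e
    simp only [norm_mul, norm_I, Complex.norm_real, Real.norm_eq_abs, Complex.norm_ofNat, mul_one] at e
    have e2 := e.le.trans (norm_sub_le _ _)
    simp only [norm_neg, norm_mul, norm_I, Complex.norm_real, Real.norm_eq_abs, Complex.norm_ofNat,
      mul_one] at e2
    have hT : |t| ≤ |T| := ht.trans (le_abs_self T)
    have b1 := h₁ x t ht
    have b2 := h₂ x t ht
    rw [pow_succ, le_div_iff₀ two_pos]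
    calc _ = |x| ^ p * (2 * |x| * ‖expIntegral volume (fun s : ℝ => (s : ℂ)) φ 0 x t‖) := by ring
      _ ≤ |x| ^ p * (‖expIntegral volume (fun s : ℝ => (s : ℂ)) (derivCLM ℂ ℂ φ) 0 x t‖
        + 24 * |t| * ‖expIntegral volume (fun s : ℝ => (s : ℂ))
          (smulLeftCLM ℂ (fun s : ℝ => (s : ℂ) ^ 2) φ) 0 x t‖) := by gcongr
      _ = |x| ^ p * ‖expIntegral volume (fun s : ℝ => (s : ℂ)) (derivCLM ℂ ℂ φ) 0 x t‖
        + 24 * |t| * (|x| ^ p * ‖expIntegral volume (fun s : ℝ => (s : ℂ))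
          (smulLeftCLM ℂ (fun s : ℝ => (s : ℂ) ^ 2) φ) 0 x t‖) := by ring
      _ ≤ C₁ + 24 * |T| * C₂ := by
        gcongr

/-- The factor `(2is)^k` is absorbed in the Schwartz function. On the real line the decay holds as
`x → -∞` as well, which is used later in `exists_line_decay`. -/
theorem exists_expIntegral_schwartz_decay (k : ℕ) (T : ℝ) (φ : 𝓢(ℝ, ℂ)) :
    ∃ C, ∀ x t, |t| ≤ T → ‖expIntegral volume (fun s : ℝ => (s : ℂ)) φ k x t‖
      ≤ C * ((1 + x ^ 2) ^ 2)⁻¹ := by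
  induction k generalizing φ with
  | zero =>
    obtain ⟨C₀, h₀⟩ := exists_pow_mul_expIntegral_schwartz_le 0 T φ
    obtain ⟨C₂, h₂⟩ := exists_pow_mul_expIntegral_schwartz_le 2 T φ
    obtain ⟨C₄, h₄⟩ := exists_pow_mul_expIntegral_schwartz_le 4 T φ
    -- From `(1 + x²)² = 1 + 2x² + x⁴`.
    refine ⟨C₀ + 2 * C₂ + C₄, fun x t ht => ?_⟩
    have b0 := h₀ x t ht
    have b2 := h₂ x t ht
    have b4 := h₄ x t ht
    rw [sq_abs] at b2
    rw [(by norm_num : 4 = 2 * 2), pow_mul, sq_abs] at b4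
    rw [← div_eq_mul_inv, le_div_iff₀ (by positivity)]
    linarith
  | succ k ih =>
    obtain ⟨C, hC⟩ := ih (smulLeftCLM ℂ (fun s : ℝ => 2 * I * (s : ℂ)) φ)
    refine ⟨C, fun x t ht => ?_⟩
    rw [expIntegral_schwartz_succ]
    exact hC x t ht

theorem airyFlow_schwartz (φ : 𝓢(ℝ, ℂ)) :
    AiryFlow 2 (expIntegral volume (fun s : ℝ => (s : ℂ)) φ) where
  hasDerivAt_space := (hasExpMoments_schwartz φ).hasDerivAt_space
  hasDerivAt_time := (hasExpMoments_schwartz φ).hasDerivAt_time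
  decay k _ T := by
    obtain ⟨C, hC⟩ := exists_expIntegral_schwartz_decay k T φ
    exact ⟨C, fun x t _ ht => hC x t ht⟩

end RealLine

section UpperHalfPlane

/-- At height at least `δ` the phase factor decays like `e^{-2δx}` as `x → +∞`, faster than any
power. It may grow as `x → -∞`, which is why the decay in `AiryFlow` is required on `[-X, ∞)` only.
-/
theorem airyFlow_of_im_ge {μ : Measure ℝ} {σ w : ℝ → ℂ} (h : HasExpMoments μ σ w) {δ : ℝ}
    (hδ : 0 < δ) (hσ : ∀ s, δ ≤ (σ s).im) : AiryFlow 2 (expIntegral μ σ w) where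
  hasDerivAt_space := h.hasDerivAt_space
  hasDerivAt_time := h.hasDerivAt_time
  decay k X T := by
    have hi := h.integrable k X T
    set K := ∫ s, ‖2 * I * σ s‖ ^ k * ‖w s‖
      * Real.exp (2 * (X * |(σ s).im| + 4 * T * |(σ s ^ 3).im|)) ∂μ with hK
    have hK0 : 0 ≤ K := integral_nonneg fun s => by positivity
    refine ⟨K * ((2 * (1 + X ^ 2)) ^ 2 * (2 * (1 + 24 / (2 * δ) ^ 4))), fun x t hx ht => ?_⟩
    have hy : 0 ≤ x + X := by linarith
    have h1 : ‖expIntegral μ σ w k x t‖ ≤ K * Real.exp (-(2 * δ * (x + X))) := by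
      rw [hK, ← integral_mul_const]
      refine norm_integral_le_of_norm_le (hi.mul_const _) (Eventually.of_forall fun s => ?_)
      rw [norm_mul, norm_mul, norm_pow, mul_assoc _ (Real.exp _), ← Real.exp_add, norm_exp_theta]
      gcongr
      have h2 : 0 < (σ s).im := hδ.trans_le (hσ s)
      have h3 : -(t * (σ s ^ 3).im) ≤ T * |(σ s ^ 3).im| := by
        refine (neg_le_abs _).trans ?_
        rw [abs_mul]
        gcongr
      rw [abs_of_pos h2]
      nlinarith [mul_le_mul_of_nonneg_left (hσ s) hy]
    have h2 : 1 + x ^ 2 ≤ 2 * (1 + X ^ 2) * (1 + (x + X) ^ 2) := by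
      rw [add_comm x X]
      exact one_add_sq_le_mul X x
    have h3 : (1 + (x + X) ^ 2) ^ 2
        ≤ 2 * (1 + 24 / (2 * δ) ^ 4) * Real.exp (2 * δ * (x + X)) := by
      -- The fourth-order term of the exponential series dominates `(x + X)^4`; hence the constant
      -- `24 = 4!`.
      have e1 := Real.pow_div_factorial_le_exp (2 * δ * (x + X)) (by positivity) 4
      have e2 : (1 : ℝ) ≤ Real.exp (2 * δ * (x + X)) := Real.one_le_exp (by positivity)
      have e3 : (x + X) ^ 4 ≤ 24 / (2 * δ) ^ 4 * Real.exp (2 * δ * (x + X)) := by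
        rw [div_mul_eq_mul_div, le_div_iff₀ (by positivity)]
        rw [div_le_iff₀ (by positivity), (by rfl : Nat.factorial 4 = 24)] at e1
        push_cast at e1
        rw [mul_pow] at e1
        linarith
      nlinarith [sq_nonneg ((x + X) ^ 2 - 1)]
    rw [← div_eq_mul_inv, le_div_iff₀ (by positivity)]
    calc ‖expIntegral μ σ w k x t‖ * (1 + x ^ 2) ^ 2
        ≤ K * Real.exp (-(2 * δ * (x + X)))
          * (2 * (1 + X ^ 2) * (1 + (x + X) ^ 2)) ^ 2 := by gcongr
      _ = K * Real.exp (-(2 * δ * (x + X)))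
          * ((2 * (1 + X ^ 2)) ^ 2 * (1 + (x + X) ^ 2) ^ 2) := by ring
      _ ≤ K * Real.exp (-(2 * δ * (x + X))) * ((2 * (1 + X ^ 2)) ^ 2
          * (2 * (1 + 24 / (2 * δ) ^ 4) * Real.exp (2 * δ * (x + X)))) := by gcongr
      _ = K * ((2 * (1 + X ^ 2)) ^ 2 * (2 * (1 + 24 / (2 * δ) ^ 4)))
          * (Real.exp (-(2 * δ * (x + X))) * Real.exp (2 * δ * (x + X))) := by ring
      _ = _ := by rw [← Real.exp_add]; simp

end UpperHalfPlane

end ExpIntegral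

end VmKdV

/-! ### The Marchenko kernel of the scattering data and its reality -/

namespace VmKdV

open MeasureTheory Filter Set

section FlowOperations

variable {E F ι : Type*} [NormedAddCommGroup E] [NormedSpace ℝ E] [NormedAddCommGroup F]
  [NormedSpace ℝ F] {p : ℕ}

theorem AiryFlow.map {f : ℕ → ℝ → ℝ → E} (hf : AiryFlow p f) (L : E →L[ℝ] F) :
    AiryFlow p fun k x t => L (f k x t) where
  hasDerivAt_space k x t := L.hasFDerivAt.comp_hasDerivAt x (hf.hasDerivAt_space k x t)
  hasDerivAt_time k x t := by
    exact (L.hasFDerivAt.comp_hasDerivAt t (hf.hasDerivAt_time k x t)).congr_deriv (map_neg L _)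
  decay k X T := by
    obtain ⟨C, hC⟩ := hf.decay k X T
    refine ⟨‖L‖ * C, fun x t hx ht => (L.le_opNorm _).trans ?_⟩
    rw [mul_assoc]
    gcongr
    exact hC x t hx ht

theorem AiryFlow.sum [Fintype ι] {f : ι → ℕ → ℝ → ℝ → E} (hf : ∀ i, AiryFlow p (f i)) :
    AiryFlow p fun k x t => ∑ i, f i k x t where
  hasDerivAt_space k x t := HasDerivAt.fun_sum fun i _ => (hf i).hasDerivAt_space k x t
  hasDerivAt_time k x t := by
    rw [← Finset.sum_neg_distrib]
    exact HasDerivAt.fun_sum fun i _ => (hf i).hasDerivAt_time k x t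
  decay k X T := by
    choose C hC using fun i => (hf i).decay k X T
    refine ⟨∑ i, C i, fun x t hx ht => ?_⟩
    rw [Finset.sum_mul]
    exact norm_sum_le_of_le _ fun i _ => hC i x t hx ht

end FlowOperations

open Complex

theorem conj_theta (x t : ℝ) (z : ℂ) : conj (theta x t z) = theta x t (conj z) := by
  simp [theta, map_ofNat]

theorem theta_neg (x t : ℝ) (z : ℂ) : theta x t (-z) = -theta x t z := by
  simp only [theta]
  ring

theorem conj_exp_theta (x t : ℝ) (z : ℂ) :
    conj (exp (2 * I * theta x t z)) = exp (2 * I * theta x t (-conj z)) := by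
  rw [← exp_conj, map_mul, map_mul, conj_I, conj_theta, theta_neg, map_ofNat]
  simp

/-- The reflection `z ↦ -conj z` conjugates circle integrals. -/
theorem circleIntegral_reflect (G : ℂ → ℂ) (c : ℂ) (r : ℝ) :
    (∮ z in C(-conj c, r), conj (G (-conj z))) = conj (∮ z in C(c, r), G z) := by
  -- The reflection corresponds to `s ↦ π - s` in the parameter. It reverses the orientation, and
  -- conjugating the differential compensates for this.
  have hcm : ∀ s : ℝ, circleMap (-conj c) r s = -conj (circleMap c r (Real.pi - s)) := fun s => by
    simp only [circleMap, map_add, map_mul, conj_ofReal, ← exp_conj, conj_I, ofReal_sub, map_sub]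
    have : exp ((Real.pi - s : ℂ) * -I) = -exp (s * I) := by
      rw [show (Real.pi - s : ℂ) * -I = s * I - Real.pi * I by ring, exp_sub, exp_pi_mul_I,
        div_neg, div_one]
    rw [this]
    ring
  have hcd : ∀ s : ℝ, circleMap 0 r s * I = conj (circleMap 0 r (Real.pi - s) * I) := fun s => by
    have h0 := congrArg (fun w => w + conj c) (hcm s)
    simp only [circleMap] at h0 ⊢
    simp only [map_mul, conj_I, map_add, map_zero] at h0 ⊢
    linear_combination I * h0
  have hconj : conj (∮ z in C(c, r), G z) = ∫ s in (0 : ℝ)..2 * Real.pi,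
      conj (circleMap 0 r s * I * G (circleMap c r s)) := by
    rw [circleIntegral, intervalIntegral.integral_of_le Real.two_pi_pos.le,
      intervalIntegral.integral_of_le Real.two_pi_pos.le, integral_conj]
    simp
  have hper : Function.Periodic (fun s => conj (circleMap 0 r s * I * G (circleMap c r s)))
      (2 * Real.pi) := fun s => by
    simp only [periodic_circleMap 0 r s, periodic_circleMap c r s]
  rw [hconj, circleIntegral]
  have e : ∀ s : ℝ, deriv (circleMap (-conj c) r) s • conj (G (-conj (circleMap (-conj c) r s)))
      = (fun s => conj (circleMap 0 r s * I * G (circleMap c r s))) (Real.pi - s) := fun s => by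
    simp only
    rw [deriv_circleMap, hcd s, hcm s, smul_eq_mul, map_neg, Complex.conj_conj, neg_neg, ← map_mul]
  simp_rw [e]
  rw [intervalIntegral.integral_comp_sub_left
    (fun s => conj (circleMap 0 r s * I * G (circleMap c r s))) Real.pi]
  have := hper.intervalIntegral_add_eq (Real.pi - 2 * Real.pi) 0
  simpa using this

namespace Polynomial

open _root_.Polynomial

theorem iterate_derivative_comp_neg_X {R : Type*} [CommRing R] (p : R[X]) (k : ℕ) :
    derivative^[k] (p.comp (-X)) = (-1) ^ k * (derivative^[k] p).comp (-X) := by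
  induction k with
  | zero => simp
  | succ k ih =>
    rw [Function.iterate_succ_apply', ih, Function.iterate_succ_apply', derivative_mul,
      derivative_comp]
    have : derivative ((-1 : R[X]) ^ k) = 0 := by
      rw [show (-1 : R[X]) = C (-1) by simp, ← C_pow, derivative_C]
    rw [this, derivative_neg, derivative_X]
    ring

/-- A polynomial whose derivatives at `-conj a = a` have the alternating symmetry differs from its
reflection by a multiple of a power of `X - a`. -/
theorem exists_sub_reflect_eq {p : ℂ[X]} {a : ℂ} {m : ℕ} (ha : -conj a = a)
    (h : ∀ l ≤ m, (derivative^[m - l] p).eval a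
      = (-1) ^ (l + 1) * conj ((derivative^[m - l] p).eval a)) :
    ∃ q : ℂ[X], ∀ z, p.eval z - (-1) ^ (m + 1) * conj (p.eval (-conj z))
      = (z - a) ^ (m + 1) * q.eval z := by
  set Q : ℂ[X] := p - (-1) ^ (m + 1) * (p.map (starRingEnd ℂ)).comp (-X) with hQ
  have hev : ∀ (r : ℂ[X]) z, ((r.map (starRingEnd ℂ)).comp (-X)).eval z
      = conj (r.eval (-conj z)) := fun r z => by
    rw [eval_comp, eval_neg, eval_X, eval_map, ← eval₂_at_apply, map_neg, Complex.conj_conj]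
  -- It suffices that all derivatives of order at most `m` vanish at `a`, which is what the
  -- alternating symmetry expresses at a point fixed by the reflection.
  have hdvd : (X - C a) ^ (m + 1) ∣ Q := by
    by_cases hQ0 : Q = 0
    · rw [hQ0]; exact dvd_zero _
    · refine (le_rootMultiplicity_iff hQ0).1 ?_
      refine (lt_rootMultiplicity_iff_isRoot_iterate_derivative hQ0).2 fun k hk => ?_
      have hneg : ((-1 : ℂ[X]) ^ (m + 1)) = C ((-1) ^ (m + 1)) := by simp
      -- The symmetry is indexed backwards: order `k` is the case `l = m - k`. The sign
      -- `(-1)^(m-k+1)` splits into `(-1)^(m+1)` and the sign `(-1)^k` from differentiating `p(-z)`.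
      have h1 := h (m - k) (Nat.sub_le _ _)
      rw [Nat.sub_sub_self hk] at h1
      rw [IsRoot.def, hQ, iterate_derivative_sub, hneg, iterate_derivative_C_mul,
        iterate_derivative_comp_neg_X, iterate_derivative_map, eval_sub, eval_mul, eval_mul, hev,
        ha, eval_C, sub_eq_zero]
      have h2 : ((-1 : ℂ[X]) ^ k).eval a = (-1) ^ k := by simp
      have h3 : ((-1 : ℂ)) ^ (m - k + 1) = (-1) ^ (m + 1) * (-1) ^ k := by
        rw [← pow_add, show m + 1 + k = m - k + 1 + 2 * k by omega, pow_add _ (m - k + 1),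
          pow_mul (-1 : ℂ) 2 k]
        simp
      rw [h2, ← mul_assoc, ← h3]
      exact h1
  obtain ⟨q, hq⟩ := hdvd
  refine ⟨q, fun z => ?_⟩
  have := congrArg (eval z) hq
  rw [hQ, eval_sub, eval_mul, hev] at this
  simpa using this

end Polynomial

namespace ScatteringData

variable {n : ℕ} (D : ScatteringData n)

/-- The disks in the upper half-plane: one around each `pole k`, one around each `-conj (pole k)`
different from `pole k`. -/
abbrev Disk : Type := Fin D.N ⊕ {k : Fin D.N // (D.pole k).re ≠ 0}

/-- The centre of a disk. -/
def diskCenter : D.Disk → ℂ := Sum.elim D.pole fun k => -conj (D.pole k)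

/-- The radius of a disk. -/
def diskRadius (r : Fin D.N → ℝ) : D.Disk → ℝ := Sum.elim r fun k => r k

/-- The singular factor `f / (z - pole k)^(m k + 1)` of the jump, and its reflection. -/
noncomputable def diskWeight (j : Fin n) : D.Disk → ℂ → ℂ :=
  Sum.elim (fun k z => (D.f j).eval z / (z - D.pole k) ^ (D.m k + 1))
    fun k z => conj ((D.f j).eval (-conj z) / (-conj z - D.pole k) ^ (D.m k + 1))

/-- The measures parametrizing the pieces of the contour in the closed upper half-plane: the real
line (`none`) and the circles. -/
noncomputable def pieceMeasure : Option D.Disk → Measure ℝ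
  | none => volume
  | some _ => volume.restrict (Ioc 0 (2 * Real.pi))

/-- The parametrizations of the pieces. -/
noncomputable def pieceCurve (r : Fin D.N → ℝ) : Option D.Disk → ℝ → ℂ
  | none => fun s => (s : ℂ)
  | some d => circleMap (D.diskCenter d) (D.diskRadius r d)

/-- The weights of the pieces. -/
noncomputable def pieceWeight (r : Fin D.N → ℝ) (j : Fin n) : Option D.Disk → ℝ → ℂ
  | none => fun s => conj (D.γ s j)
  | some d => fun s => circleMap 0 (D.diskRadius r d) s * I
      * D.diskWeight j d (circleMap (D.diskCenter d) (D.diskRadius r d) s)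

/-- The Schwartz function `s ↦ conj (γ s j)`. -/
noncomputable def conjReflection (j : Fin n) : SchwartzMap ℝ ℂ :=
  SchwartzMap.postcompCLM (𝕜 := ℝ) ((conjCLE : ℂ →L[ℝ] ℂ).comp
    (ContinuousLinearMap.proj (R := ℝ) (φ := fun _ : Fin n => ℂ) j)) D.γ

variable {D} {r : Fin D.N → ℝ} (hr : D.AdmissibleRadii r)

include hr in
theorem diskRadius_pos (d : D.Disk) : 0 < D.diskRadius r d := by
  rcases d with k | k <;> exact hr.pos _

include hr in
theorem diskRadius_lt_im (d : D.Disk) : D.diskRadius r d < (D.diskCenter d).im := by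
  rcases d with k | k <;> simpa [diskRadius, diskCenter] using hr.lt_im _

theorem diskWeight_reflect (k : {k : Fin D.N // (D.pole k).re ≠ 0}) (j : Fin n) (z : ℂ) :
    D.diskWeight j (Sum.inr k) z = conj (D.diskWeight j (Sum.inl k.1) (-conj z)) := rfl

include hr in
theorem continuousOn_diskWeight (j : Fin n) (d : D.Disk) :
    ContinuousOn (D.diskWeight j d) (Metric.sphere (D.diskCenter d) (D.diskRadius r d)) := by
  have key : ∀ k : Fin D.N, ContinuousOn (D.diskWeight j (Sum.inl k))
      (Metric.sphere (D.pole k) (r k)) := fun k => by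
    refine ContinuousOn.div (by fun_prop) (by fun_prop) fun z hz => pow_ne_zero _ ?_
    rw [sub_ne_zero]
    rintro rfl
    have := hr.pos k
    rw [Metric.mem_sphere, dist_self] at hz
    linarith
  rcases d with k | k
  · exact key k
  · have h1 : ContinuousOn (fun z : ℂ => -conj z)
        (Metric.sphere (-conj (D.pole k)) (r k)) := by fun_prop
    refine continuous_conj.comp_continuousOn ((key k).comp h1 fun z hz => ?_)
    rw [Metric.mem_sphere, Complex.dist_eq] at hz ⊢
    refine Eq.trans ?_ hz
    rw [← norm_conj, ← norm_neg]
    congr 1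
    simp [diskCenter, add_comm]

include hr in
theorem hasExpMoments_piece (j : Fin n) (o : Option D.Disk) :
    HasExpMoments (D.pieceMeasure o) (D.pieceCurve r o) (D.pieceWeight r j o) := by
  rcases o with _ | d
  · exact hasExpMoments_schwartz (D.conjReflection j)
  · have h1 : Continuous (D.pieceCurve r (some d)) := continuous_circleMap _ _
    have h2 : Continuous (D.pieceWeight r j (some d)) := by
      have h3 : Continuous fun s =>
          D.diskWeight j d (circleMap (D.diskCenter d) (D.diskRadius r d) s) :=
        (continuousOn_diskWeight hr j d).comp_continuous (continuous_circleMap _ _) fun s =>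
          circleMap_mem_sphere _ (diskRadius_pos hr d).le _
      exact ((continuous_circleMap _ _).mul continuous_const).mul h3
    refine ⟨h1, h2, fun k X T => Continuous.integrableOn_Ioc ?_⟩
    fun_prop

include hr in
theorem exists_im_pieceCurve_ge (d : D.Disk) :
    ∃ δ, 0 < δ ∧ ∀ s, δ ≤ (D.pieceCurve r (some d) s).im := by
  refine ⟨(D.diskCenter d).im - D.diskRadius r d, sub_pos.2 (diskRadius_lt_im hr d), fun s => ?_⟩
  have h := circleMap_mem_sphere (D.diskCenter d) (diskRadius_pos hr d).le s
  rw [Metric.mem_sphere, Complex.dist_eq] at h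
  have h2 := (abs_le.1 ((abs_im_le_norm _).trans h.le)).1
  rw [sub_im] at h2
  have h3 : (D.pieceCurve r (some d) s).im
    = (circleMap (D.diskCenter d) (D.diskRadius r d) s).im := rfl
  linarith

include hr in
theorem airyFlow_piece (j : Fin n) (o : Option D.Disk) :
    AiryFlow 2 (expIntegral (D.pieceMeasure o) (D.pieceCurve r o) (D.pieceWeight r j o)) := by
  rcases o with _ | d
  · exact airyFlow_schwartz (D.conjReflection j)
  · obtain ⟨δ, hδ, h⟩ := exists_im_pieceCurve_ge hr d
    exact airyFlow_of_im_ge (hasExpMoments_piece hr j (some d)) hδ h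

variable (D r) in
/-- The linear data of the Marchenko equation, as a complex function. -/
noncomputable def complexKernel (j : Fin n) (k : ℕ) (x t : ℝ) : ℂ :=
  ∑ o, expIntegral (D.pieceMeasure o) (D.pieceCurve r o) (D.pieceWeight r j o) k x t

variable (D r) in
/-- The linear data of the Marchenko equation. -/
noncomputable def kernel (j : Fin n) (k : ℕ) (x t : ℝ) : ℝ :=
  -(1 / Real.pi) * (D.complexKernel r j k x t).re

include hr in
theorem airyFlow_complexKernel (j : Fin n) : AiryFlow 2 (D.complexKernel r j) :=
  AiryFlow.sum fun o => airyFlow_piece hr j o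

include hr in
theorem airyFlow_kernel (j : Fin n) : AiryFlow 2 (D.kernel r j) :=
  (airyFlow_complexKernel hr j).map ((-(1 / Real.pi)) • reCLM)

theorem expIntegral_disk (j : Fin n) (d : D.Disk) (x t : ℝ) :
    expIntegral (D.pieceMeasure (some d)) (D.pieceCurve r (some d)) (D.pieceWeight r j (some d))
      0 x t = ∮ z in C(D.diskCenter d, D.diskRadius r d),
        D.diskWeight j d z * exp (2 * I * theta x t z) := by
  rw [circleIntegral, intervalIntegral.integral_of_le Real.two_pi_pos.le]
  simp [expIntegral, pieceMeasure, pieceCurve, pieceWeight, mul_assoc]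

/-- The substitution `s ↦ -s`: both `γ` and the phase factor are conjugated by it. -/
theorem conj_expIntegral_line (j : Fin n) (x t : ℝ) :
    conj (expIntegral (D.pieceMeasure none) (D.pieceCurve r none) (D.pieceWeight r j none) 0 x t)
      = expIntegral (D.pieceMeasure none) (D.pieceCurve r none) (D.pieceWeight r j none) 0 x t := by
  simp only [expIntegral, pieceMeasure, pieceCurve, pieceWeight, pow_zero, one_mul]
  rw [← integral_conj, ← integral_neg_eq_self]
  congr 1
  ext s
  rw [map_mul, Complex.conj_conj, ← D.γ_symm s j, conj_exp_theta]
  simp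

theorem conj_expIntegral_disk (k : {k : Fin D.N // (D.pole k).re ≠ 0}) (j : Fin n) (x t : ℝ) :
    expIntegral (D.pieceMeasure (some (Sum.inr k))) (D.pieceCurve r (some (Sum.inr k)))
      (D.pieceWeight r j (some (Sum.inr k))) 0 x t
    = conj (expIntegral (D.pieceMeasure (some (Sum.inl k.1))) (D.pieceCurve r (some (Sum.inl k.1)))
      (D.pieceWeight r j (some (Sum.inl k.1))) 0 x t) := by
  rw [expIntegral_disk, expIntegral_disk]
  refine Eq.trans ?_ (circleIntegral_reflect _ _ _)
  change (∮ z in C(-conj (D.pole k), r k), _) = ∮ z in C(-conj (D.pole k), r k), _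
  congr 1
  funext z
  rw [map_mul, conj_exp_theta, diskWeight_reflect, map_neg, Complex.conj_conj, neg_neg]

include hr in
-- For a purely imaginary pole the circle is its own reflection. The symmetry of the residue
-- constants makes the integrand minus its reflection a polynomial times `e^{2iθ}`, that is an
-- entire function, and its circle integral vanishes.
theorem conj_expIntegral_disk_of_re_eq_zero (k : Fin D.N) (hk : (D.pole k).re = 0) (j : Fin n)
    (x t : ℝ) :
    conj (expIntegral (D.pieceMeasure (some (Sum.inl k))) (D.pieceCurve r (some (Sum.inl k)))
      (D.pieceWeight r j (some (Sum.inl k))) 0 x t)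
    = expIntegral (D.pieceMeasure (some (Sum.inl k))) (D.pieceCurve r (some (Sum.inl k)))
      (D.pieceWeight r j (some (Sum.inl k))) 0 x t := by
  have ha : -conj (D.pole k) = D.pole k := by
    apply Complex.ext <;> simp [hk]
  obtain ⟨q, hq⟩ := Polynomial.exists_sub_reflect_eq ha fun l hl => D.f_symm k hk l hl j
  rw [expIntegral_disk, ← circleIntegral_reflect]
  change (∮ z in C(-conj (D.pole k), r k), _) = ∮ z in C(D.pole k, r k), _
  rw [ha, eq_comm, ← sub_eq_zero]
  have hc := continuousOn_diskWeight hr j (Sum.inl k)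
  have he : Continuous fun z => exp (2 * I * theta x t z) := by
    unfold theta
    fun_prop
  have h1 : ContinuousOn (fun z => D.diskWeight j (Sum.inl k) z * exp (2 * I * theta x t z))
      (Metric.sphere (D.pole k) (r k)) := hc.mul he.continuousOn
  have h2 : ContinuousOn (fun z => conj (D.diskWeight j (Sum.inl k) (-conj z)
      * exp (2 * I * theta x t (-conj z)))) (Metric.sphere (D.pole k) (r k)) := by
    refine continuous_conj.comp_continuousOn (h1.comp (g := fun z => _ * _)
      (f := fun z : ℂ => -conj z) (by fun_prop) fun z hz => ?_)
    rw [Metric.mem_sphere, Complex.dist_eq] at hz ⊢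
    rw [← hz, ← norm_conj, ← norm_neg]
    congr 1
    rw [map_sub, map_neg, Complex.conj_conj]
    linear_combination -ha
  rw [← circleIntegral.integral_sub (h1.circleIntegrable (hr.pos k).le)
    (h2.circleIntegrable (hr.pos k).le)]
  rw [circleIntegral.integral_congr (g := fun z => q.eval z * exp (2 * I * theta x t z))
    (hr.pos k).le fun z hz => ?_]
  · refine circleIntegral_eq_zero_of_differentiable_on_off_countable (hr.pos k).le
      countable_empty (by fun_prop) fun z _ => ?_
    unfold theta
    fun_prop
  · have hz0 : z - D.pole k ≠ 0 := by
      rw [sub_ne_zero]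
      rintro rfl
      have := hr.pos k
      rw [Metric.mem_sphere, dist_self] at hz
      linarith
    have h3 : conj (-conj z - D.pole k) = -(z - D.pole k) := by
      rw [map_sub, map_neg, Complex.conj_conj]
      linear_combination ha
    simp only [diskWeight, Sum.elim_inl]
    rw [map_mul, conj_exp_theta, map_neg, Complex.conj_conj, neg_neg, map_div₀, map_pow, h3,
      ← sub_mul]
    congr 1
    have h4 := hq z
    have h5 : (-(z - D.pole k)) ^ (D.m k + 1) = (-1) ^ (D.m k + 1) * (z - D.pole k) ^ (D.m k + 1) :=
      neg_pow _ _
    have h6 : ((-1 : ℂ) ^ (D.m k + 1)) * (-1) ^ (D.m k + 1) = 1 := by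
      rw [← mul_pow]
      simp
    have h7 : (z - D.pole k) ^ (D.m k + 1) ≠ 0 := pow_ne_zero _ hz0
    have h8 : (-1 : ℂ) ^ (D.m k + 1) ≠ 0 := pow_ne_zero _ (by norm_num)
    rw [h5]
    field_simp
    linear_combination (-1 : ℂ) ^ (D.m k + 1) * h4
      + conj ((D.f j).eval (-conj z)) * h6

include hr in
-- The real line and the self-reflected circles contribute real numbers, and every other circle is
-- paired with its mirror image, whose contribution is the complex conjugate. The symmetry
-- hypotheses on `γ` and `f` enter the proof only through this statement.
theorem conj_complexKernel (j : Fin n) (x t : ℝ) :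
    conj (D.complexKernel r j 0 x t) = D.complexKernel r j 0 x t := by
  classical
  have hsum : ∀ g : Fin D.N → ℂ, ∑ k : {k : Fin D.N // (D.pole k).re ≠ 0}, g k
      = ∑ k, if (D.pole k).re ≠ 0 then g k else 0 := fun g => by
    rw [← Finset.sum_filter, ← Finset.sum_subtype_eq_sum_filter]
    simp
  simp only [complexKernel, Fintype.sum_option, Fintype.sum_sum_type, map_add, map_sum,
    conj_expIntegral_line, conj_expIntegral_disk, Complex.conj_conj]
  congr 1
  rw [hsum fun k => expIntegral (D.pieceMeasure (some (Sum.inl k)))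
      (D.pieceCurve r (some (Sum.inl k))) (D.pieceWeight r j (some (Sum.inl k))) 0 x t,
    hsum fun k => conj (expIntegral (D.pieceMeasure (some (Sum.inl k)))
      (D.pieceCurve r (some (Sum.inl k))) (D.pieceWeight r j (some (Sum.inl k))) 0 x t),
    ← Finset.sum_add_distrib, ← Finset.sum_add_distrib]
  refine Finset.sum_congr rfl fun k _ => ?_
  by_cases hk : (D.pole k).re = 0
  · simp [hk, conj_expIntegral_disk_of_re_eq_zero hr k hk]
  · simp [hk, add_comm]

include hr in
theorem complexKernel_eq (j : Fin n) (x t : ℝ) :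
    D.complexKernel r j 0 x t = -(Real.pi * D.kernel r j 0 x t : ℂ) := by
  rw [← conj_eq_iff_re.1 (conj_complexKernel hr j x t), kernel]
  push_cast
  have : (Real.pi : ℂ) ≠ 0 := ofReal_ne_zero.2 Real.pi_ne_zero
  field_simp

end ScatteringData

end VmKdV

/-! ### Cauchy integrals over circles and removal of a jump across a circle -/

namespace VmKdV

open MeasureTheory Filter Set

/-- Gluing one-sided boundary values onto a function gives continuity on the closed region. This is
what Cauchy's theorem needs when the function itself carries no information on the contour. -/
theorem continuousOn_ite_of_tendsto {X Y : Type*} [TopologicalSpace X] [TopologicalSpace Y]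
    {U S : Set X} {h g : X → Y} [DecidablePred (· ∈ S)] (hS : IsClosed S) (hUS : Disjoint U S)
    (hU : ContinuousOn h U) (hg : ContinuousOn g S)
    (hlim : ∀ z ∈ S, Tendsto h (𝓝[U] z) (𝓝 (g z))) :
    ContinuousOn (fun z => if z ∈ S then g z else h z) (U ∪ S) := by
  rintro z hz
  by_cases hzS : z ∈ S
  · rw [ContinuousWithinAt, nhdsWithin_union, if_pos hzS]
    refine Tendsto.sup ((hlim z hzS).congr' ?_) (Tendsto.congr' ?_ (hg z hzS))
    · filter_upwards [self_mem_nhdsWithin] with w hw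
      rw [if_neg fun hwS => hUS.notMem_of_mem_left hw hwS]
    · filter_upwards [self_mem_nhdsWithin] with w hw
      rw [if_pos hw]
  · have hzU : z ∈ U := hz.resolve_right hzS
    have hSc : Sᶜ ∈ 𝓝 z := hS.isOpen_compl.mem_nhds hzS
    have : ContinuousWithinAt h (U ∪ S) z := by
      refine (hU z hzU).mono_of_mem_nhdsWithin ?_
      filter_upwards [self_mem_nhdsWithin, nhdsWithin_le_nhds hSc] with w hw hwS
      exact hw.resolve_right hwS
    refine this.congr_of_eventuallyEq ?_ (if_neg hzS)
    filter_upwards [nhdsWithin_le_nhds hSc] with w hw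
    exact if_neg hw

section CauchyCircle

open Complex Metric

/-- The Cauchy integral of `g` over a circle. -/
noncomputable def cauchyCircle (g : ℂ → ℂ) (c : ℂ) (r : ℝ) (z : ℂ) : ℂ :=
  (2 * Real.pi * I)⁻¹ * ∮ s in C(c, r), g s / (s - z)

variable {g h hin hout : ℂ → ℂ} {c : ℂ} {r : ℝ}

theorem norm_cauchyCircle_le (hr : 0 ≤ r) {M d : ℝ} {z : ℂ} (hd : 0 < d) (hM : 0 ≤ M)
    (hg : ∀ s ∈ sphere c r, ‖g s‖ ≤ M) (hz : ∀ s ∈ sphere c r, d ≤ ‖s - z‖) :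
    ‖cauchyCircle g c r z‖ ≤ r * (M / d) := by
  have := circleIntegral.norm_two_pi_i_inv_smul_integral_le_of_norm_le_const (f := fun s =>
    g s / (s - z)) (c := c) (R := r) (C := M / d) hr fun s hs => by
      rw [norm_div]
      gcongr
      exacts [hg s hs, hz s hs]
  simpa [cauchyCircle] using this

theorem tendsto_cauchyCircle (hr : 0 ≤ r) (hg : ContinuousOn g (sphere c r)) :
    Tendsto (cauchyCircle g c r) (Bornology.cobounded ℂ) (𝓝 0) := by
  obtain ⟨M, hM⟩ := (isCompact_sphere c r).exists_bound_of_continuousOn hg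
  have h1 : Tendsto (fun z : ℂ => r * (max M 0 / (‖z‖ - (‖c‖ + r)))) (Bornology.cobounded ℂ)
      (𝓝 0) := by
    have h2 : Tendsto (fun z : ℂ => ‖z‖ - (‖c‖ + r)) (Bornology.cobounded ℂ) atTop :=
      tendsto_atTop_add_const_right _ _ tendsto_norm_cobounded_atTop
    simpa using (h2.const_div_atTop (max M 0)).const_mul r
  refine squeeze_zero_norm' ?_ h1
  filter_upwards [tendsto_norm_cobounded_atTop.eventually_gt_atTop (‖c‖ + r)] with z hz
  refine norm_cauchyCircle_le hr (sub_pos.2 hz) (le_max_right _ _)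
    (fun s hs => (hM s hs).trans (le_max_left _ _)) fun s hs => ?_
  have h3 : ‖s‖ ≤ ‖c‖ + r := by
    have := norm_add_le c (s - c)
    rw [mem_sphere, Complex.dist_eq] at hs
    rw [hs] at this
    simpa using this
  have h4 := norm_sub_norm_le z s
  rw [norm_sub_rev] at h4
  linarith

theorem differentiableAt_cauchyCircle (hr : 0 < r) (hg : ContinuousOn g (sphere c r)) {z : ℂ}
    (hz : z ∉ sphere c r) : DifferentiableAt ℂ (cauchyCircle g c r) z := by
  obtain ⟨M, hM⟩ := (isCompact_sphere c r).exists_bound_of_continuousOn hg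
  obtain ⟨d, hd, hball⟩ := Metric.isOpen_iff.1 (isClosed_sphere (x := c) (ε := r)).isOpen_compl z hz
  have hmem : ∀ θ, circleMap c r θ ∈ sphere c r := circleMap_mem_sphere c hr.le
  have hgc : Continuous fun θ => g (circleMap c r θ) :=
    hg.comp_continuous (continuous_circleMap _ _) hmem
  have hdist : ∀ w ∈ ball z (d / 2), ∀ θ, d / 2 ≤ ‖circleMap c r θ - w‖ := fun w hw θ => by
    by_contra! hlt
    refine hball (a := circleMap c r θ) ?_ (hmem θ)
    rw [mem_ball, Complex.dist_eq] at hw ⊢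
    have := norm_add_le (circleMap c r θ - w) (w - z)
    rw [sub_add_sub_cancel] at this
    linarith
  have hne : ∀ w ∈ ball z (d / 2), ∀ θ, circleMap c r θ - w ≠ 0 := fun w hw θ h0 => by
    have := hdist w hw θ
    rw [h0, norm_zero] at this
    linarith
  have hcont : ∀ w ∈ ball z (d / 2), ∀ p : ℕ, Continuous fun θ =>
      deriv (circleMap c r) θ * (g (circleMap c r θ) / (circleMap c r θ - w) ^ p) :=
    fun w hw p => by
      simp only [deriv_circleMap]
      exact ((continuous_circleMap _ _).mul continuous_const).mul
        (hgc.div (((continuous_circleMap _ _).sub continuous_const).pow p)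
          fun θ => pow_ne_zero _ (hne w hw θ))
  have key := (intervalIntegral.hasDerivAt_integral_of_dominated_loc_of_deriv_le (𝕜 := ℂ)
    (μ := volume) (a := 0) (b := 2 * Real.pi) (x₀ := z) (s := ball z (d / 2))
    (F := fun w θ => deriv (circleMap c r) θ * (g (circleMap c r θ) / (circleMap c r θ - w)))
    (F' := fun w θ => deriv (circleMap c r) θ * (g (circleMap c r θ) / (circleMap c r θ - w) ^ 2))
    (bound := fun _ => r * (M / (d / 2) ^ 2)) (ball_mem_nhds z (half_pos hd)) ?_ ?_ ?_ ?_ ?_ ?_).2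
  · exact key.differentiableAt.const_mul _
  · filter_upwards [ball_mem_nhds z (half_pos hd)] with w hw
    have := (hcont w hw 1).aestronglyMeasurable (μ := volume.restrict (uIoc 0 (2 * Real.pi)))
    simpa only [pow_one] using this
  · have := (hcont z (mem_ball_self (half_pos hd)) 1).intervalIntegrable (μ := volume) 0
      (2 * Real.pi)
    simpa only [pow_one] using this
  · exact (hcont z (mem_ball_self (half_pos hd)) 2).aestronglyMeasurable
  · refine Eventually.of_forall fun θ _ w hw => ?_
    rw [norm_mul, norm_div, norm_pow, deriv_circleMap]
    have h1 : ‖circleMap 0 r θ * I‖ = r := by simp [abs_of_pos hr]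
    rw [h1]
    have hM0 : 0 ≤ M := (norm_nonneg _).trans (hM _ (hmem θ))
    have h2 := hM _ (hmem θ)
    have h3 := hdist w hw θ
    gcongr
  · exact intervalIntegrable_const
  · refine Eventually.of_forall fun θ _ w hw => ?_
    have h1 : HasDerivAt (fun w => circleMap c r θ - w) (-1) w := (hasDerivAt_id w).const_sub _
    have h2 := ((hasDerivAt_const w (g (circleMap c r θ))).div h1 (hne w hw θ)).const_mul
      (deriv (circleMap c r) θ)
    refine h2.congr_deriv ?_
    ring

/-- If `h` is analytic on both sides of a circle, subtracting the Cauchy integral of its jump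
gives, near the circle, the Cauchy integral of `h` over a larger circle. -/
theorem sub_cauchyCircle_eq {R : ℝ} (hr : 0 < r) (hrR : r < R)
    (hd : DifferentiableOn ℂ h (ball c R \ sphere c r))
    (hR : ContinuousOn h (closedBall c R \ closedBall c r))
    (hi : ContinuousOn hin (sphere c r)) (ho : ContinuousOn hout (sphere c r))
    (hin_lim : ∀ z ∈ sphere c r, Tendsto h (𝓝[ball c r] z) (𝓝 (hin z)))
    (hout_lim : ∀ z ∈ sphere c r, Tendsto h (𝓝[(closedBall c r)ᶜ] z) (𝓝 (hout z)))
    {z : ℂ} (hz : z ∈ ball c R \ sphere c r) :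
    h z - cauchyCircle (fun s => hin s - hout s) c r z = cauchyCircle h c R z := by
  classical
  have hne2 : (2 * Real.pi * I : ℂ) ≠ 0 := by simp [Real.pi_ne_zero]
  -- Two continuous extensions of `h` that differ only on the circle: `hI` for the closed disk and
  -- `hO` for the closed annulus outside it.
  set hI : ℂ → ℂ := fun z => if z ∈ sphere c r then hin z else h z with hI_def
  set hO : ℂ → ℂ := fun z => if z ∈ sphere c r then hout z else h z with hO_def
  have hIs : ∀ s ∈ sphere c r, hI s = hin s := fun s hs => if_pos hs
  have hOs : ∀ s ∈ sphere c r, hO s = hout s := fun s hs => if_pos hs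
  have hIn : ∀ s, s ∉ sphere c r → hI s = h s := fun s hs => if_neg hs
  have hOn : ∀ s, s ∉ sphere c r → hO s = h s := fun s hs => if_neg hs
  have hopen : IsOpen (ball c R \ sphere c r) := isOpen_ball.sdiff isClosed_sphere
  have hId : ∀ s ∈ ball c R \ sphere c r, DifferentiableAt ℂ hI s := fun s hs =>
    ((hd s hs).differentiableAt (hopen.mem_nhds hs)).congr_of_eventuallyEq
      (by filter_upwards [isClosed_sphere.isOpen_compl.mem_nhds hs.2] with w hw using hIn w hw)
  have hOd : ∀ s ∈ ball c R \ sphere c r, DifferentiableAt ℂ hO s := fun s hs =>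
    ((hd s hs).differentiableAt (hopen.mem_nhds hs)).congr_of_eventuallyEq
      (by filter_upwards [isClosed_sphere.isOpen_compl.mem_nhds hs.2] with w hw using hOn w hw)
  have hbs : ∀ s ∈ ball c r, s ∈ ball c R \ sphere c r := fun s hs =>
    ⟨ball_subset_ball hrR.le hs, fun h0 => (mem_ball.1 hs).ne h0⟩
  have has : ∀ s ∈ ball c R \ closedBall c r, s ∈ ball c R \ sphere c r := fun s hs =>
    ⟨hs.1, fun h0 => hs.2 (sphere_subset_closedBall h0)⟩
  have hIc : ContinuousOn hI (closedBall c r) := by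
    rw [← ball_union_sphere]
    exact continuousOn_ite_of_tendsto isClosed_sphere
      (Set.disjoint_left.2 fun s hs h0 => (mem_ball.1 hs).ne h0)
      (hd.continuousOn.mono fun s hs => hbs s hs) hi hin_lim
  have hOc : ContinuousOn hO (closedBall c R \ ball c r) := by
    have e : closedBall c R \ ball c r = (closedBall c R \ closedBall c r) ∪ sphere c r := by
      ext s
      simp only [Set.mem_sdiff, mem_closedBall, mem_ball, mem_union, mem_sphere, not_lt, not_le]
      constructor
      · rintro ⟨h1, h2⟩
        rcases h2.eq_or_lt with h3 | h3
        · exact Or.inr h3.symm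
        · exact Or.inl ⟨h1, h3⟩
      · rintro (⟨h1, h2⟩ | h2)
        · exact ⟨h1, h2.le⟩
        · exact ⟨by linarith, h2.ge⟩
    rw [e]
    exact continuousOn_ite_of_tendsto isClosed_sphere
      (Set.disjoint_left.2 fun s hs h0 => hs.2 (sphere_subset_closedBall h0)) hR ho
      fun s hs => (hout_lim s hs).mono_left (nhdsWithin_mono _ fun w hw => hw.2)
  have hzs : ∀ s ∈ sphere c r, s - z ≠ 0 := fun s hs h0 => hz.2 (sub_eq_zero.1 h0 ▸ hs)
  have hint : ∀ {k : ℂ → ℂ}, ContinuousOn k (sphere c r) →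
      CircleIntegrable (fun s => k s / (s - z)) c r := fun hk =>
    (hk.div (by fun_prop) hzs).circleIntegrable hr.le
  have hRr : ∀ s ∈ sphere c R, s ∉ sphere c r := fun s hs h0 => by
    rw [mem_sphere] at hs h0
    linarith
  have e1 : (∮ s in C(c, R), h s / (s - z)) = ∮ s in C(c, R), hO s / (s - z) :=
    circleIntegral.integral_congr (hr.trans hrR).le fun s hs => by simp only [hOn s (hRr s hs)]
  have e2 : (∮ s in C(c, r), (hin s - hout s) / (s - z))
      = (∮ s in C(c, r), hI s / (s - z)) - ∮ s in C(c, r), hO s / (s - z) := by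
    rw [← circleIntegral.integral_sub]
    · refine circleIntegral.integral_congr hr.le fun s hs => ?_
      simp only [hIs s hs, hOs s hs, sub_div]
    · exact hint (hi.congr hIs)
    · exact hint (ho.congr hOs)
  suffices h2 : 2 * Real.pi * I * h z - ((∮ s in C(c, r), hI s / (s - z))
      - ∮ s in C(c, r), hO s / (s - z)) = ∮ s in C(c, R), hO s / (s - z) by
    rw [cauchyCircle, cauchyCircle, e1, e2, ← h2]
    field_simp
  rcases lt_or_gt_of_ne (fun h0 => hz.2 h0 : dist z c ≠ r) with hlt | hgt
  -- For `z` in the small disk, `hI` obeys Cauchy's formula, and the integral of `hO` does not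
  -- change when the circle is enlarged, the pole `z` lying inside both circles.
  · have h3 := circleIntegral_div_sub_of_differentiable_on_off_countable countable_empty
      (mem_ball.2 hlt) hIc fun s hs => hId s (hbs s hs.1)
    have h4 : (∮ s in C(c, R), hO s / (s - z)) = ∮ s in C(c, r), hO s / (s - z) := by
      have hne : ∀ s ∉ ball c r, s - z ≠ 0 := fun s hs h0 => hs (sub_eq_zero.1 h0 ▸ hlt)
      refine circleIntegral_eq_of_differentiable_on_annulus_off_countable hr hrR.le
        countable_empty (hOc.div (by fun_prop) fun s hs => hne s hs.2) fun s hs => ?_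
      exact (hOd s (has s hs.1)).fun_div (by fun_prop)
        (hne s fun h0 => hs.1.2 (ball_subset_closedBall h0))
    rw [h3, h4, hIn z hz.2]
    ring
  · have hzr : z ∉ closedBall c r := fun h0 => (mem_closedBall.1 h0).not_gt hgt
    have h3 : (∮ s in C(c, r), hI s / (s - z)) = 0 := by
      have hne : ∀ s ∈ closedBall c r, s - z ≠ 0 := fun s hs h0 => hzr (sub_eq_zero.1 h0 ▸ hs)
      refine circleIntegral_eq_zero_of_differentiable_on_off_countable hr.le countable_empty
        (hIc.div (by fun_prop) hne) fun s hs => ?_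
      exact (hId s (hbs s hs.1)).fun_div (by fun_prop) (hne s (ball_subset_closedBall hs.1))
    have hzA : closedBall c R \ ball c r ∈ 𝓝 z := by
      filter_upwards [isOpen_ball.mem_nhds hz.1, isClosed_closedBall.isOpen_compl.mem_nhds hzr]
        with w h1 h2
      exact ⟨ball_subset_closedBall h1, fun h0 => h2 (ball_subset_closedBall h0)⟩
    -- For `z` in the annulus the pole obstructs the deformation. The divided difference `dslope`
    -- has no pole, and the subtracted constant contributes `2πi` on the outer circle and `0` on the
    -- inner one.
    have h4 : (∮ s in C(c, R), dslope hO z s) = ∮ s in C(c, r), dslope hO z s := by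
      refine circleIntegral_eq_of_differentiable_on_annulus_off_countable hr hrR.le
        (countable_singleton z) ((continuousOn_dslope hzA).2 ⟨hOc, hOd z hz⟩) fun s hs => ?_
      exact (differentiableAt_dslope_of_ne hs.2).2 (hOd s (has s hs.1))
    have hsl : ∀ s, s ≠ z → dslope hO z s = hO s / (s - z) - hO z * (s - z)⁻¹ := fun s hs => by
      rw [dslope_of_ne _ hs, slope_def_field, sub_div, div_eq_mul_inv (hO z)]
    have hzR : ∀ s ∈ sphere c R, s - z ≠ 0 := fun s hs h0 => by
      rw [sub_eq_zero.1 h0] at hs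
      exact (mem_ball.1 hz.1).ne hs
    have hOR : ContinuousOn hO (sphere c R) := hOc.mono fun s hs =>
      ⟨sphere_subset_closedBall hs, fun h0 => by
        rw [mem_sphere] at hs
        rw [mem_ball] at h0
        linarith⟩
    have hOr : ContinuousOn hO (sphere c r) := ho.congr hOs
    have h5 : (∮ s in C(c, R), dslope hO z s)
        = (∮ s in C(c, R), hO s / (s - z)) - hO z * (2 * Real.pi * I) := by
      rw [circleIntegral.integral_congr (hr.trans hrR).le fun s hs =>
        hsl s (sub_ne_zero.1 (hzR s hs)), circleIntegral.integral_sub,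
        circleIntegral.integral_const_mul, circleIntegral.integral_sub_inv_of_mem_ball hz.1]
      · exact (hOR.div (by fun_prop) hzR).circleIntegrable (hr.trans hrR).le
      · exact (continuousOn_const.mul (ContinuousOn.inv₀ (by fun_prop) hzR)).circleIntegrable
          (hr.trans hrR).le
    have h6 : (∮ s in C(c, r), dslope hO z s) = ∮ s in C(c, r), hO s / (s - z) := by
      have h7 : (∮ s in C(c, r), (s - z)⁻¹) = 0 := by
        have hne : ∀ s ∈ closedBall c r, s - z ≠ 0 := fun s hs h0 => hzr (sub_eq_zero.1 h0 ▸ hs)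
        refine circleIntegral_eq_zero_of_differentiable_on_off_countable hr.le countable_empty
          (ContinuousOn.inv₀ (by fun_prop) hne) fun s hs => ?_
        exact DifferentiableAt.fun_inv (by fun_prop) (hne s (ball_subset_closedBall hs.1))
      rw [circleIntegral.integral_congr hr.le fun s hs =>
        hsl s (sub_ne_zero.1 (hzs s hs)), circleIntegral.integral_sub (hint hOr),
        circleIntegral.integral_const_mul, h7, mul_zero, sub_zero]
      exact (continuousOn_const.mul (ContinuousOn.inv₀ (by fun_prop) hzs)).circleIntegrable hr.le
    rw [h5, h6] at h4
    rw [h3, ← h4, hOn z hz.2]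
    ring

/-- Subtracting the Cauchy integral of the jump removes the jump across a circle. -/
theorem exists_differentiableOn_sub_cauchyCircle {U : Set ℂ} (hU : IsOpen U) (hr : 0 < r)
    (hcU : closedBall c r ⊆ U) (hd : DifferentiableOn ℂ h (U \ sphere c r))
    (hi : ContinuousOn hin (sphere c r)) (ho : ContinuousOn hout (sphere c r))
    (hin_lim : ∀ z ∈ sphere c r, Tendsto h (𝓝[ball c r] z) (𝓝 (hin z)))
    (hout_lim : ∀ z ∈ sphere c r, Tendsto h (𝓝[(closedBall c r)ᶜ] z) (𝓝 (hout z))) :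
    ∃ H : ℂ → ℂ, DifferentiableOn ℂ H U ∧ ∀ z ∈ U \ sphere c r,
      H z = h z - cauchyCircle (fun s => hin s - hout s) c r z := by
  classical
  obtain ⟨δ, hδ, hδU⟩ := (isCompact_closedBall c r).exists_cthickening_subset_open hU hcU
  have hRU : closedBall c (r + δ) ⊆ U := by
    rwa [cthickening_closedBall hδ.le hr.le, add_comm] at hδU
  set R := r + δ with hR_def
  have hrR : r < R := by linarith
  have hopen : IsOpen (U \ sphere c r) := hU.sdiff isClosed_sphere
  have key : ∀ z ∈ ball c R \ sphere c r,
      h z - cauchyCircle (fun s => hin s - hout s) c r z = cauchyCircle h c R z := fun z hz =>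
    sub_cauchyCircle_eq hr hrR (hd.mono fun s hs => ⟨hRU (ball_subset_closedBall hs.1), hs.2⟩)
      (hd.continuousOn.mono fun s hs => ⟨hRU hs.1, fun h0 => hs.2 (sphere_subset_closedBall h0)⟩)
      hi ho hin_lim hout_lim hz
  have hRc : ContinuousOn h (sphere c R) := hd.continuousOn.mono fun s hs =>
    ⟨hRU (sphere_subset_closedBall hs), fun h0 => by
      rw [mem_sphere] at hs h0
      linarith⟩
  -- Near the disk the extension is the Cauchy integral over a slightly larger circle, which is
  -- analytic across the small circle.
  refine ⟨fun z => if z ∈ ball c R then cauchyCircle h c R z else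
    h z - cauchyCircle (fun s => hin s - hout s) c r z, fun z hz => ?_, fun z hz => ?_⟩
  · by_cases hzR : z ∈ ball c R
    · refine DifferentiableAt.differentiableWithinAt ?_
      refine (differentiableAt_cauchyCircle (hr.trans hrR) hRc
        fun h0 => (mem_ball.1 hzR).ne h0).congr_of_eventuallyEq ?_
      filter_upwards [isOpen_ball.mem_nhds hzR] with w hw
      rw [if_pos hw]
    · have hzr : z ∉ closedBall c r := fun h0 => hzR (closedBall_subset_ball hrR h0)
      have hzs : z ∉ sphere c r := fun h0 => hzr (sphere_subset_closedBall h0)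
      refine DifferentiableAt.differentiableWithinAt ?_
      refine (((hd z ⟨hz, hzs⟩).differentiableAt (hopen.mem_nhds ⟨hz, hzs⟩)).fun_sub
        (differentiableAt_cauchyCircle hr (hi.sub ho) hzs)).congr_of_eventuallyEq ?_
      filter_upwards [isClosed_sphere.isOpen_compl.mem_nhds hzs] with w hw
      split_ifs with hwR
      · exact (key w ⟨hwR, hw⟩).symm
      · rfl
  · dsimp only
    split_ifs with hzR
    · exact (key z ⟨hzR, hz.2⟩).symm
    · rfl

end CauchyCircle

end VmKdV

/-! ### Cauchy representation of functions with jumps on the line and on circles -/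

namespace VmKdV

open MeasureTheory Filter Set

section CauchyLine

open Complex
open scoped Interval

theorem integral_div_sq_add_sq (a : ℝ) {R : ℝ} (hR : 0 < R) :
    ∫ x in (a - R)..(a + R), R / ((x - a) ^ 2 + R ^ 2) = Real.pi / 2 := by
  have h1 : ∀ x ∈ uIcc (a - R) (a + R),
      HasDerivAt (fun x => Real.arctan ((x - a) / R)) (R / ((x - a) ^ 2 + R ^ 2)) x := fun x _ => by
    have := (((hasDerivAt_id x).sub_const a).div_const R).arctan
    refine this.congr_deriv ?_
    have : R ≠ 0 := hR.ne'
    have h2 : (x - a) ^ 2 + R ^ 2 ≠ 0 := by positivity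
    simp only [id]
    field_simp
    ring
  rw [intervalIntegral.integral_eq_sub_of_hasDerivAt h1]
  · have e1 : (a + R - a) / R = 1 := by field_simp; ring
    have e2 : (a - R - a) / R = -1 := by field_simp; ring
    rw [e1, e2, Real.arctan_neg, Real.arctan_one]
    ring
  · refine Continuous.intervalIntegrable (Continuous.div (by fun_prop) (by fun_prop) fun x => ?_) _ _
    positivity

/-- The winding number of a square around its centre. -/
theorem integral_square_inv_sub (z : ℂ) {R : ℝ} (hR : 0 < R) :
    (∫ x : ℝ in (z.re - R)..(z.re + R), ((x + ((z.im - R : ℝ) : ℂ) * I) - z)⁻¹)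
      - (∫ x : ℝ in (z.re - R)..(z.re + R), ((x + ((z.im + R : ℝ) : ℂ) * I) - z)⁻¹)
      + I * (∫ y : ℝ in (z.im - R)..(z.im + R), ((((z.re + R : ℝ) : ℂ) + y * I) - z)⁻¹)
      - I * (∫ y : ℝ in (z.im - R)..(z.im + R), ((((z.re - R : ℝ) : ℂ) + y * I) - z)⁻¹)
      = 2 * Real.pi * I := by
  have hne1 : ∀ (u : ℝ) (x : ℝ), u ≠ z.im → ((x + (u : ℂ) * I) - z) ≠ 0 := fun u x hu h0 => hu (by
    have := congrArg Complex.im h0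
    simp at this
    linarith)
  have hne2 : ∀ (u : ℝ) (x : ℝ), u ≠ z.re → (((u : ℂ) + x * I) - z) ≠ 0 := fun u x hu h0 => hu (by
    have := congrArg Complex.re h0
    simp at this
    linarith)
  have hi1 : ∀ u : ℝ, u ≠ z.im → IntervalIntegrable (fun x : ℝ => ((x + (u : ℂ) * I) - z)⁻¹) volume
      (z.re - R) (z.re + R) := fun u hu =>
    (Continuous.inv₀ (by fun_prop) fun x => hne1 u x hu).intervalIntegrable _ _
  have hi2 : ∀ u : ℝ, u ≠ z.re → IntervalIntegrable (fun x : ℝ => (((u : ℂ) + x * I) - z)⁻¹) volume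
      (z.im - R) (z.im + R) := fun u hu =>
    (Continuous.inv₀ (by fun_prop) fun x => hne2 u x hu).intervalIntegrable _ _
  have hm : ∀ c : ℝ, c - R ≠ c := fun c h => by linarith
  have hp : ∀ c : ℝ, c + R ≠ c := fun c h => by linarith
  rw [← intervalIntegral.integral_sub (hi1 _ (hm _)) (hi1 _ (hp _)), add_sub_assoc, ← mul_sub,
    ← intervalIntegral.integral_sub (hi2 _ (hp _)) (hi2 _ (hm _))]
  have e1 : ∀ x : ℝ, ((x + ((z.im - R : ℝ) : ℂ) * I) - z)⁻¹ - ((x + ((z.im + R : ℝ) : ℂ) * I) - z)⁻¹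
      = (2 * I) * ((R / ((x - z.re) ^ 2 + R ^ 2) : ℝ) : ℂ) := fun x => by
    have h1 := hne1 _ x (hm z.im)
    have h2 := hne1 _ x (hp z.im)
    have h3 : ((x - z.re : ℂ) ^ 2 + R ^ 2) ≠ 0 := by
      have : (x - z.re) ^ 2 + R ^ 2 ≠ 0 := by positivity
      exact_mod_cast this
    have h4 : ((x + ((z.im - R : ℝ) : ℂ) * I) - z) * ((x + ((z.im + R : ℝ) : ℂ) * I) - z)
        = (x - z.re : ℂ) ^ 2 + R ^ 2 := by
      have h5 : (x : ℂ) + z.im * I - z = x - z.re := by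
        linear_combination (re_add_im z)
      push_cast
      linear_combination ((x : ℂ) + z.im * I - z + (x - z.re)) * h5 - (R : ℂ) ^ 2 * I_sq
    rw [inv_sub_inv h1 h2, h4]
    push_cast
    field_simp
    ring
  have e2 : ∀ y : ℝ, ((((z.re + R : ℝ) : ℂ) + y * I) - z)⁻¹ - ((((z.re - R : ℝ) : ℂ) + y * I) - z)⁻¹
      = 2 * ((R / ((y - z.im) ^ 2 + R ^ 2) : ℝ) : ℂ) := fun x => by
    have h1 := hne2 _ x (hm z.re)
    have h2 := hne2 _ x (hp z.re)
    have h3 : ((x - z.im : ℂ) ^ 2 + R ^ 2) ≠ 0 := by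
      have : (x - z.im) ^ 2 + R ^ 2 ≠ 0 := by positivity
      exact_mod_cast this
    have h4 : ((((z.re + R : ℝ) : ℂ) + x * I) - z) * ((((z.re - R : ℝ) : ℂ) + x * I) - z)
        = -((x - z.im : ℂ) ^ 2 + R ^ 2) := by
      have h5 : (z.re : ℂ) + x * I - z = (x - z.im) * I := by
        linear_combination (re_add_im z)
      push_cast
      linear_combination ((z.re : ℂ) + x * I - z + (x - z.im) * I) * h5
        + (x - z.im : ℂ) ^ 2 * I_sq
    rw [inv_sub_inv h2 h1, h4]
    push_cast
    field_simp
    ring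
  simp_rw [e1, e2]
  rw [intervalIntegral.integral_const_mul, intervalIntegral.integral_const_mul,
    intervalIntegral.integral_ofReal, intervalIntegral.integral_ofReal,
    integral_div_sq_add_sq _ hR, integral_div_sq_add_sq _ hR]
  push_cast
  ring

/-- The Cauchy theorem for `(K - v) / (· - z)` on a rectangle, where either `z` lies outside or
`v = K z`. -/
theorem integral_rect_sub_div_eq_zero {K : ℂ → ℂ} {v z : ℂ} {x₁ x₂ y₁ y₂ : ℝ}
    (hc : ContinuousOn K ([[x₁, x₂]] ×ℂ [[y₁, y₂]])) (hx : x₁ ≤ x₂) (hy : y₁ ≤ y₂)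
    (hd : ∀ s ∈ Ioo x₁ x₂ ×ℂ Ioo y₁ y₂, DifferentiableAt ℂ K s)
    (hzx : z.re ∈ Ioo x₁ x₂) (hz₁ : z.im ≠ y₁) (hz₂ : z.im ≠ y₂) (hv : z.im ∈ Ioo y₁ y₂ → v = K z) :
    (∫ x : ℝ in x₁..x₂, (K (x + (y₁ : ℂ) * I) - v) / (x + (y₁ : ℂ) * I - z))
      - (∫ x : ℝ in x₁..x₂, (K (x + (y₂ : ℂ) * I) - v) / (x + (y₂ : ℂ) * I - z))
      + I * (∫ y : ℝ in y₁..y₂, (K ((x₂ : ℂ) + y * I) - v) / ((x₂ : ℂ) + y * I - z))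
      - I * (∫ y : ℝ in y₁..y₂, (K ((x₁ : ℂ) + y * I) - v) / ((x₁ : ℂ) + y * I - z)) = 0 := by
  -- The integrand is needed on the boundary only, so any extension `F` inside may be used: `dslope
  -- K z` when `z` is in the rectangle, the quotient itself otherwise.
  have key : ∀ F : ℂ → ℂ, (∀ s, s ≠ z → F s = (K s - v) / (s - z)) →
      ContinuousOn F ([[x₁, x₂]] ×ℂ [[y₁, y₂]]) →
      (∀ s ∈ Ioo x₁ x₂ ×ℂ Ioo y₁ y₂, s ≠ z → DifferentiableAt ℂ F s) →
      (∫ x : ℝ in x₁..x₂, (K (x + (y₁ : ℂ) * I) - v) / (x + (y₁ : ℂ) * I - z))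
      - (∫ x : ℝ in x₁..x₂, (K (x + (y₂ : ℂ) * I) - v) / (x + (y₂ : ℂ) * I - z))
      + I * (∫ y : ℝ in y₁..y₂, (K ((x₂ : ℂ) + y * I) - v) / ((x₂ : ℂ) + y * I - z))
      - I * (∫ y : ℝ in y₁..y₂, (K ((x₁ : ℂ) + y * I) - v) / ((x₁ : ℂ) + y * I - z)) = 0 := by
    intro F hF hFc hFd
    have h0 := integral_boundary_rect_eq_zero_of_differentiable_on_off_countable F
      (x₁ + y₁ * I) (x₂ + y₂ * I) {z} (countable_singleton z) (by simpa using hFc) (by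
        simp only [add_re, ofReal_re, mul_re, I_re, mul_zero, ofReal_im, I_im, mul_one, sub_self,
          add_zero, add_im, mul_im, zero_add, min_eq_left hx, max_eq_right hx, min_eq_left hy,
          max_eq_right hy]
        exact fun s hs => hFd s hs.1 hs.2)
    simp only [add_re, ofReal_re, mul_re, I_re, mul_zero, ofReal_im, I_im, mul_one, sub_self,
      add_zero, add_im, mul_im, zero_add, smul_eq_mul] at h0
    have h1 : ∀ (u : ℝ) (x : ℝ), z.im ≠ u → (x + (u : ℂ) * I) ≠ z := fun u x hu h0 => hu (by
      simp [← h0])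
    have h2 : ∀ (u : ℝ) (x : ℝ), z.re ≠ u → ((u : ℂ) + x * I) ≠ z := fun u x hu h0 => hu (by
      simp [← h0])
    simp only [fun x : ℝ => hF _ (h1 y₁ x hz₁), fun x : ℝ => hF _ (h1 y₂ x hz₂),
      fun y : ℝ => hF _ (h2 x₁ y hzx.1.ne'), fun y : ℝ => hF _ (h2 x₂ y hzx.2.ne)] at h0
    exact h0
  have hsub : ∀ s ∈ Ioo x₁ x₂ ×ℂ Ioo y₁ y₂, [[x₁, x₂]] ×ℂ [[y₁, y₂]] ∈ 𝓝 s := fun s hs => by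
    rw [uIcc_of_le hx, uIcc_of_le hy]
    refine Filter.mem_of_superset ((isOpen_Ioo.reProdIm isOpen_Ioo).mem_nhds hs) ?_
    exact reProdIm_subset_iff.2 (Set.prod_mono Ioo_subset_Icc_self Ioo_subset_Icc_self)
  by_cases hzi : z.im ∈ Ioo y₁ y₂
  · have hzin : z ∈ Ioo x₁ x₂ ×ℂ Ioo y₁ y₂ := ⟨hzx, hzi⟩
    refine key (dslope K z) (fun s hs => ?_)
      ((continuousOn_dslope (hsub z hzin)).2 ⟨hc, hd z hzin⟩)
      fun s hs hsz => (differentiableAt_dslope_of_ne hsz).2 (hd s hs)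
    rw [dslope_of_ne _ hs, slope_def_field, hv hzi]
  · have hzout : ∀ s ∈ [[x₁, x₂]] ×ℂ [[y₁, y₂]], s - z ≠ 0 := fun s hs h0 => by
      rw [sub_eq_zero.1 h0, uIcc_of_le hx, uIcc_of_le hy] at hs
      exact hzi ⟨lt_of_le_of_ne hs.2.1 hz₁.symm, lt_of_le_of_ne hs.2.2 hz₂⟩
    refine key (fun s => (K s - v) / (s - z)) (fun s _ => rfl)
      ((hc.sub continuousOn_const).div (by fun_prop) hzout) fun s hs hsz => ?_
    exact ((hd s hs).sub_const v).fun_div (by fun_prop) (sub_ne_zero.2 hsz)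

/-- Apply Cauchy's theorem on a square centred at `z` and cut by the real line into two rectangles;
the cut contributes the integral of the jump. On the outer sides the length is of order `R` and
`1/|s - z| ≤ 1/R`, so convergence of `H` to `0` without any rate suffices to let `R → ∞`. -/
theorem eq_integral_line_of_tendsto_zero {H Hp Hm : ℂ → ℂ}
    (hd : DifferentiableOn ℂ H {z | z.im ≠ 0}) (hinf : Tendsto H atInfty (𝓝 0))
    (hp : ContinuousOn Hp {z | z.im = 0}) (hm : ContinuousOn Hm {z | z.im = 0})
    (hp_lim : ∀ z : ℂ, z.im = 0 → Tendsto H (𝓝[{z | 0 < z.im}] z) (𝓝 (Hp z)))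
    (hm_lim : ∀ z : ℂ, z.im = 0 → Tendsto H (𝓝[{z | z.im < 0}] z) (𝓝 (Hm z)))
    (hj : Integrable fun s : ℝ => Hp s - Hm s) {z : ℂ} (hz : z.im ≠ 0) :
    2 * Real.pi * I * H z = ∫ s : ℝ, (Hp s - Hm s) / (s - z) := by
  classical
  set S : Set ℂ := {z | z.im = 0} with hS
  have hSc : IsClosed S := isClosed_eq Complex.continuous_im continuous_const
  have hopen : IsOpen {z : ℂ | z.im ≠ 0} := isOpen_ne_fun Complex.continuous_im continuous_const
  set U : ℂ → ℂ := fun z => if z ∈ S then Hp z else H z with hU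
  set L : ℂ → ℂ := fun z => if z ∈ S then Hm z else H z with hL
  have hUn : ∀ s : ℂ, s.im ≠ 0 → U s = H s := fun s hs => if_neg hs
  have hLn : ∀ s : ℂ, s.im ≠ 0 → L s = H s := fun s hs => if_neg hs
  have hUs : ∀ s : ℝ, U s = Hp s := fun s => if_pos (ofReal_im s)
  have hLs : ∀ s : ℝ, L s = Hm s := fun s => if_pos (ofReal_im s)
  have hUc : ContinuousOn U {z | 0 ≤ z.im} := by
    have e : {z : ℂ | 0 ≤ z.im} = {z | 0 < z.im} ∪ S := by
      ext s
      exact (le_iff_lt_or_eq (a := (0 : ℝ)) (b := s.im)).trans (or_congr Iff.rfl eq_comm)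
    rw [e]
    exact continuousOn_ite_of_tendsto hSc (Set.disjoint_left.2 fun s hs h0 => hs.ne' h0)
      (hd.continuousOn.mono fun s hs => hs.ne') hp hp_lim
  have hLc : ContinuousOn L {z | z.im ≤ 0} := by
    have e : {z : ℂ | z.im ≤ 0} = {z | z.im < 0} ∪ S := by
      ext s
      exact le_iff_lt_or_eq (a := s.im) (b := (0 : ℝ))
    rw [e]
    exact continuousOn_ite_of_tendsto hSc (Set.disjoint_left.2 fun s hs h0 => hs.ne h0)
      (hd.continuousOn.mono fun s hs => hs.ne) hm hm_lim
  have hda : ∀ K : ℂ → ℂ, (∀ s : ℂ, s.im ≠ 0 → K s = H s) → ∀ s : ℂ, s.im ≠ 0 →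
      DifferentiableAt ℂ K s := fun K hK s hs =>
    ((hd s hs).differentiableAt (hopen.mem_nhds hs)).congr_of_eventuallyEq
      (by filter_upwards [hopen.mem_nhds hs] with w hw using hK w hw)
  -- smallness at infinity
  have hsmall : ∀ ε > 0, ∃ R₀, ∀ s : ℂ, R₀ < ‖s‖ → (0 ≤ s.im → ‖U s‖ ≤ ε)
      ∧ (s.im ≤ 0 → ‖L s‖ ≤ ε) := fun ε hε => by
    have h1 := (tendsto_zero_iff_norm_tendsto_zero.1 hinf).eventually_le_const hε
    rw [atInfty, Filter.eventually_inf_principal] at h1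
    obtain ⟨R₀, -, hR₀⟩ := (Filter.hasBasis_cobounded_norm (E := ℂ)).eventually_iff.1 h1
    have h2 : ∀ s : ℂ, R₀ < ‖s‖ → ∀ᶠ w in 𝓝 s, w.im ≠ 0 → ‖H w‖ ≤ ε := fun s hs => by
      filter_upwards [(isOpen_lt continuous_const continuous_norm).mem_nhds hs] with w hw
      exact hR₀ (le_of_lt hw)
    refine ⟨R₀, fun s hs => ⟨fun h => ?_, fun h => ?_⟩⟩
    · rcases h.eq_or_lt with h | h
      · have h3 : (𝓝[{z : ℂ | 0 < z.im}] s).NeBot := by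
          rw [← mem_closure_iff_nhdsWithin_neBot, closure_setOfPred_lt_im]
          exact h.le
        rw [show U s = Hp s from if_pos h.symm]
        refine le_of_tendsto (hp_lim s h.symm).norm ?_
        filter_upwards [self_mem_nhdsWithin, nhdsWithin_le_nhds (h2 s hs)] with w hw h4
        exact h4 hw.ne'
      · rw [hUn s h.ne']
        exact hR₀ (le_of_lt hs) h.ne'
    · rcases h.eq_or_lt with h | h
      · have h3 : (𝓝[{z : ℂ | z.im < 0}] s).NeBot := by
          rw [← mem_closure_iff_nhdsWithin_neBot, closure_setOfPred_im_lt]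
          exact h.le
        rw [show L s = Hm s from if_pos h]
        refine le_of_tendsto (hm_lim s h).norm ?_
        filter_upwards [self_mem_nhdsWithin, nhdsWithin_le_nhds (h2 s hs)] with w hw h4
        exact h4 hw.ne
      · rw [hLn s h.ne]
        exact hR₀ (le_of_lt hs) h.ne
  set a := z.re with ha
  set b := z.im with hb
  -- the boundary integrals of a function over the outer sides
  set E : ℝ → ℂ := fun R =>
    (∫ x : ℝ in (a - R)..(a + R), L (x + ((b - R : ℝ) : ℂ) * I) / (x + ((b - R : ℝ) : ℂ) * I - z))
    - (∫ x : ℝ in (a - R)..(a + R), U (x + ((b + R : ℝ) : ℂ) * I) / (x + ((b + R : ℝ) : ℂ) * I - z))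
    + I * ((∫ y : ℝ in 0..(b + R), U (((a + R : ℝ) : ℂ) + y * I) / (((a + R : ℝ) : ℂ) + y * I - z))
      + ∫ y : ℝ in (b - R)..0, L (((a + R : ℝ) : ℂ) + y * I) / (((a + R : ℝ) : ℂ) + y * I - z))
    - I * ((∫ y : ℝ in 0..(b + R), U (((a - R : ℝ) : ℂ) + y * I) / (((a - R : ℝ) : ℂ) + y * I - z))
      + ∫ y : ℝ in (b - R)..0, L (((a - R : ℝ) : ℂ) + y * I) / (((a - R : ℝ) : ℂ) + y * I - z))
    with hE
  have hEq : ∀ R, |b| < R → E R + (∫ x : ℝ in (a - R)..(a + R), (Hp x - Hm x) / (x - z))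
      = 2 * Real.pi * I * H z := fun R hR => by
    obtain ⟨hR1, hR2⟩ := abs_lt.1 hR
    have hR0 : 0 < R := (abs_nonneg b).trans_lt hR
    -- Subtracting `H z` from the numerator makes both rectangle integrals vanish, whichever
    -- rectangle contains `z`. The subtracted constant is restored by the winding number `hsq` of
    -- the whole square, as its integrals over the cut cancel.
    have hup := integral_rect_sub_div_eq_zero (K := U) (v := H z) (z := z) (x₁ := a - R)
      (x₂ := a + R) (y₁ := 0) (y₂ := b + R) (hUc.mono fun s hs => by
        rw [uIcc_of_le (by linarith : (0 : ℝ) ≤ b + R)] at hs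
        exact hs.2.1) (by linarith) (by linarith) (fun s hs => hda U hUn s hs.2.1.ne')
      ⟨by linarith, by linarith⟩ hz (by linarith) fun h => (hUn z h.1.ne').symm
    have hlo := integral_rect_sub_div_eq_zero (K := L) (v := H z) (z := z) (x₁ := a - R)
      (x₂ := a + R) (y₁ := b - R) (y₂ := 0) (hLc.mono fun s hs => by
        rw [uIcc_of_le (by linarith : b - R ≤ 0)] at hs
        exact hs.2.2) (by linarith) (by linarith) (fun s hs => hda L hLn s hs.2.2.ne)
      ⟨by linarith, by linarith⟩ (by linarith) hz fun h => (hLn z h.2.ne).symm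
    have hsq := integral_square_inv_sub z hR0
    have hint : ∀ (K : ℂ → ℂ) (T : Set ℂ) (p : ℝ → ℂ) (α β : ℝ), ContinuousOn K T → Continuous p →
        (∀ y ∈ uIcc α β, p y ∈ T) → (∀ y, p y - z ≠ 0) →
        IntervalIntegrable (fun y => K (p y) / (p y - z)) volume α β :=
      fun K T p α β hK hp hT hne => ContinuousOn.intervalIntegrable
        ((hK.comp hp.continuousOn hT).div (by fun_prop) fun y _ => hne y)
    have hinv : ∀ (p : ℝ → ℂ) (α β : ℝ), Continuous p → (∀ y, p y - z ≠ 0) →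
        IntervalIntegrable (fun y => (p y - z)⁻¹) volume α β := fun p α β hp hne =>
      Continuous.intervalIntegrable (Continuous.inv₀ (by fun_prop) hne) _ _
    have hsplit : ∀ (K : ℂ → ℂ) (T : Set ℂ) (p : ℝ → ℂ) (α β : ℝ), ContinuousOn K T →
        Continuous p → (∀ y ∈ uIcc α β, p y ∈ T) → (∀ y, p y - z ≠ 0) →
        (∫ y in α..β, (K (p y) - H z) / (p y - z))
          = (∫ y in α..β, K (p y) / (p y - z)) - H z * ∫ y in α..β, (p y - z)⁻¹ :=
      fun K T p α β hK hp hT hne => by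
        rw [← intervalIntegral.integral_const_mul, ← intervalIntegral.integral_sub
          (hint K T p α β hK hp hT hne) ((hinv p α β hp hne).const_mul _)]
        simp only [div_eq_mul_inv, sub_mul]
    have hne1 : ∀ u : ℝ, u ≠ b → ∀ x : ℝ, ((x + (u : ℂ) * I) - z) ≠ 0 := fun u hu x h0 => hu (by
      have := congrArg Complex.im h0
      simp at this
      linarith)
    have hne2 : ∀ u : ℝ, u ≠ a → ∀ x : ℝ, (((u : ℂ) + x * I) - z) ≠ 0 := fun u hu x h0 => hu (by
      have := congrArg Complex.re h0
      simp at this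
      linarith)
    have hm0 : ∀ c : ℝ, c - R ≠ c := fun c h => by linarith
    have hp0 : ∀ c : ℝ, c + R ≠ c := fun c h => by linarith
    have hu1 : ∀ u : ℝ, 0 ≤ u → ∀ x : ℝ, (x + (u : ℂ) * I) ∈ {z : ℂ | 0 ≤ z.im} := fun u hu x => by
      simpa using hu
    have hl1 : ∀ u : ℝ, u ≤ 0 → ∀ x : ℝ, (x + (u : ℂ) * I) ∈ {z : ℂ | z.im ≤ 0} := fun u hu x => by
      simpa using hu
    have hu2 : ∀ u : ℝ, ∀ y ∈ uIcc 0 (b + R), ((u : ℂ) + y * I) ∈ {z : ℂ | 0 ≤ z.im} :=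
      fun u y hy => by
        rw [uIcc_of_le (by linarith)] at hy
        simpa using hy.1
    have hl2 : ∀ u : ℝ, ∀ y ∈ uIcc (b - R) 0, ((u : ℂ) + y * I) ∈ {z : ℂ | z.im ≤ 0} :=
      fun u y hy => by
        rw [uIcc_of_le (by linarith)] at hy
        simpa using hy.2
    rw [hsplit U _ (fun x : ℝ => x + ((0 : ℝ) : ℂ) * I) _ _ hUc (by fun_prop)
        (fun x _ => hu1 0 le_rfl x) (hne1 0 hz.symm),
      hsplit U _ (fun x : ℝ => x + ((b + R : ℝ) : ℂ) * I) _ _ hUc (by fun_prop)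
        (fun x _ => hu1 _ (by linarith) x) (hne1 _ (hp0 _)),
      hsplit U _ (fun x : ℝ => ((a + R : ℝ) : ℂ) + x * I) _ _ hUc (by fun_prop)
        (hu2 _) (hne2 _ (hp0 _)),
      hsplit U _ (fun x : ℝ => ((a - R : ℝ) : ℂ) + x * I) _ _ hUc (by fun_prop)
        (hu2 _) (hne2 _ (hm0 _))] at hup
    rw [hsplit L _ (fun x : ℝ => x + ((0 : ℝ) : ℂ) * I) _ _ hLc (by fun_prop)
        (fun x _ => hl1 0 le_rfl x) (hne1 0 hz.symm),
      hsplit L _ (fun x : ℝ => x + ((b - R : ℝ) : ℂ) * I) _ _ hLc (by fun_prop)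
        (fun x _ => hl1 _ (by linarith) x) (hne1 _ (hm0 _)),
      hsplit L _ (fun x : ℝ => ((a + R : ℝ) : ℂ) + x * I) _ _ hLc (by fun_prop)
        (hl2 _) (hne2 _ (hp0 _)),
      hsplit L _ (fun x : ℝ => ((a - R : ℝ) : ℂ) + x * I) _ _ hLc (by fun_prop)
        (hl2 _) (hne2 _ (hm0 _))] at hlo
    have hadd : ∀ u : ℝ, u ≠ a → (∫ y : ℝ in (b - R)..(b + R), (((u : ℂ) + y * I) - z)⁻¹)
        = (∫ y : ℝ in (b - R)..0, (((u : ℂ) + y * I) - z)⁻¹)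
          + ∫ y : ℝ in 0..(b + R), (((u : ℂ) + y * I) - z)⁻¹ := fun u hu =>
      (intervalIntegral.integral_add_adjacent_intervals
        (hinv (fun y : ℝ => (u : ℂ) + y * I) _ _ (by fun_prop) (hne2 u hu))
        (hinv (fun y : ℝ => (u : ℂ) + y * I) _ _ (by fun_prop) (hne2 u hu))).symm
    rw [hadd _ (hp0 _), hadd _ (hm0 _)] at hsq
    have hmid : (∫ x : ℝ in (a - R)..(a + R), (Hp x - Hm x) / (x - z))
        = (∫ x : ℝ in (a - R)..(a + R), U (x + ((0 : ℝ) : ℂ) * I) / (x + ((0 : ℝ) : ℂ) * I - z))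
        - ∫ x : ℝ in (a - R)..(a + R), L (x + ((0 : ℝ) : ℂ) * I) / (x + ((0 : ℝ) : ℂ) * I - z) := by
      rw [← intervalIntegral.integral_sub
        (hint U _ (fun x : ℝ => x + ((0 : ℝ) : ℂ) * I) _ _ hUc (by fun_prop)
          (fun x _ => hu1 0 le_rfl x) (hne1 0 hz.symm))
        (hint L _ (fun x : ℝ => x + ((0 : ℝ) : ℂ) * I) _ _ hLc (by fun_prop)
          (fun x _ => hl1 0 le_rfl x) (hne1 0 hz.symm))]
      simp only [ofReal_zero, zero_mul, add_zero, hUs, hLs, sub_div]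
    rw [hmid, hE]
    linear_combination hup + hlo + H z * hsq
  -- Four sides of length `2R`, on each of which the integrand is at most `ε / R`.
  have hEb : ∀ ε > 0, ∀ᶠ R in atTop, ‖E R‖ ≤ 8 * ε := fun ε hε => by
    obtain ⟨R₀, hR₀⟩ := hsmall ε hε
    filter_upwards [eventually_gt_atTop |b|, eventually_gt_atTop (R₀ + ‖z‖)] with R hR hRz
    obtain ⟨hR1, hR2⟩ := abs_lt.1 hR
    have hR0 : 0 < R := (abs_nonneg b).trans_lt hR
    have hfar : ∀ w : ℂ, R ≤ ‖w - z‖ → R₀ < ‖w‖ := fun w hw => by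
      have := norm_sub_le w z
      linarith
    have hbd : ∀ (K : ℂ → ℂ) (p : ℝ → ℂ) (α β : ℝ), (∀ y ∈ Ι α β, ‖K (p y)‖ ≤ ε) →
        (∀ y, R ≤ ‖p y - z‖) → ‖∫ y in α..β, K (p y) / (p y - z)‖ ≤ ε / R * |β - α| :=
      fun K p α β hK hp => intervalIntegral.norm_integral_le_of_norm_le_const fun y hy => by
        rw [norm_div]
        have := hK y hy
        have := hp y
        gcongr
    have hn1 : ∀ u : ℝ, |u - b| = R → ∀ x : ℝ, R ≤ ‖(x + (u : ℂ) * I) - z‖ := fun u hu x => by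
      rw [← hu]
      simpa using abs_im_le_norm ((x + (u : ℂ) * I) - z)
    have hn2 : ∀ u : ℝ, |u - a| = R → ∀ x : ℝ, R ≤ ‖((u : ℂ) + x * I) - z‖ := fun u hu x => by
      rw [← hu]
      simpa using abs_re_le_norm (((u : ℂ) + x * I) - z)
    have hpR : ∀ c : ℝ, |c + R - c| = R := fun c => by rw [add_sub_cancel_left, abs_of_pos hR0]
    have hmR : ∀ c : ℝ, |c - R - c| = R := fun c => by
      rw [sub_sub_cancel_left, abs_neg, abs_of_pos hR0]
    have hU2 : ∀ u : ℝ, |u - a| = R → ‖∫ y : ℝ in 0..(b + R), U ((u : ℂ) + y * I)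
        / ((u : ℂ) + y * I - z)‖ ≤ ε / R * |b + R - 0| := fun u hu =>
      hbd U (fun y : ℝ => (u : ℂ) + y * I) _ _ (fun y hy => by
        rw [uIoc_of_le (by linarith)] at hy
        exact (hR₀ _ (hfar _ (hn2 u hu y))).1 (by simpa using hy.1.le)) (hn2 u hu)
    have hL2 : ∀ u : ℝ, |u - a| = R → ‖∫ y : ℝ in (b - R)..0, L ((u : ℂ) + y * I)
        / ((u : ℂ) + y * I - z)‖ ≤ ε / R * |0 - (b - R)| := fun u hu =>
      hbd L (fun y : ℝ => (u : ℂ) + y * I) _ _ (fun y hy => by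
        rw [uIoc_of_le (by linarith)] at hy
        exact (hR₀ _ (hfar _ (hn2 u hu y))).2 (by simpa using hy.2)) (hn2 u hu)
    have b1 := hbd L (fun x : ℝ => x + ((b - R : ℝ) : ℂ) * I) (a - R) (a + R) (fun y _ =>
      (hR₀ _ (hfar _ (hn1 _ (hmR b) y))).2 (by simp; linarith)) (hn1 _ (hmR b))
    have b2 := hbd U (fun x : ℝ => x + ((b + R : ℝ) : ℂ) * I) (a - R) (a + R) (fun y _ =>
      (hR₀ _ (hfar _ (hn1 _ (hpR b) y))).1 (by simp; linarith)) (hn1 _ (hpR b))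
    have b3 := hU2 _ (hpR a)
    have b4 := hL2 _ (hpR a)
    have b5 := hU2 _ (hmR a)
    have b6 := hL2 _ (hmR a)
    rw [abs_of_nonneg (by linarith : (0 : ℝ) ≤ b + R - 0)] at b3 b5
    rw [abs_of_nonneg (by linarith : (0 : ℝ) ≤ 0 - (b - R))] at b4 b6
    rw [show a + R - (a - R) = 2 * R by ring, abs_of_pos (by linarith : 0 < 2 * R)] at b1 b2
    have hεR : ε / R * R = ε := by field_simp
    rw [hE]
    refine (norm_sub_le _ _).trans ((add_le_add ((norm_add_le _ _).trans (add_le_add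
      ((norm_sub_le _ _).trans (add_le_add b1 b2)) ?_)) ?_).trans_eq
        (?_ : ε / R * (2 * R) + ε / R * (2 * R) + (ε / R * (b + R - 0) + ε / R * (0 - (b - R)))
          + (ε / R * (b + R - 0) + ε / R * (0 - (b - R))) = 8 * ε))
    · rw [norm_mul, norm_I, one_mul]
      exact (norm_add_le _ _).trans (add_le_add b3 b4)
    · rw [norm_mul, norm_I, one_mul]
      exact (norm_add_le _ _).trans (add_le_add b5 b6)
    · linear_combination 8 * hεR
  have hE0 : Tendsto E atTop (𝓝 0) := by
    rw [Metric.tendsto_nhds]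
    intro ε hε
    filter_upwards [hEb (ε / 16) (by positivity)] with R hR
    rw [dist_zero_right]
    linarith
  have hint : Integrable fun s : ℝ => (Hp s - Hm s) / (s - z) := by
    simp only [div_eq_mul_inv]
    refine hj.mul_bdd (c := |b|⁻¹) (Continuous.aestronglyMeasurable
      (Continuous.inv₀ (by fun_prop) fun s h0 => hz ?_)) (Eventually.of_forall fun s => ?_)
    · have := congrArg Complex.im h0
      simpa using this
    · rw [norm_inv]
      have := abs_im_le_norm ((s : ℂ) - z)
      rw [sub_im, ofReal_im, zero_sub, abs_neg] at this
      exact inv_anti₀ (abs_pos.2 hz) this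
  have hlim : Tendsto (fun R => ∫ x : ℝ in (a - R)..(a + R), (Hp x - Hm x) / (x - z)) atTop
      (𝓝 (∫ x : ℝ, (Hp x - Hm x) / (x - z))) :=
    intervalIntegral_tendsto_integral hint
      (tendsto_atBot_add_const_left _ a tendsto_neg_atTop_atBot)
      (tendsto_atTop_add_const_left _ a tendsto_id)
  have h1 := hE0.add hlim
  rw [zero_add] at h1
  refine tendsto_nhds_unique (tendsto_const_nhds.congr' ?_) h1
  filter_upwards [eventually_gt_atTop |b|] with R hR
  exact (hEq R hR).symm

open Metric in
/-- The Cauchy representation of a function that is analytic off the real line and finitely many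
circles. -/
theorem eq_add_integral_line_add_sum_cauchyCircle {ι : Type*} [Fintype ι] {c : ι → ℂ} {r : ι → ℝ}
    (hr : ∀ k, 0 < r k) (him : ∀ k, r k < |(c k).im|)
    (hdisj : Pairwise fun j k => Disjoint (closedBall (c j) (r j)) (closedBall (c k) (r k)))
    {h hp hm : ℂ → ℂ} {hin hout : ι → ℂ → ℂ} {h₀ : ℂ}
    (hd : DifferentiableOn ℂ h ({z : ℂ | z.im = 0} ∪ ⋃ k, sphere (c k) (r k))ᶜ)
    (hinf : Tendsto h atInfty (𝓝 h₀))
    (hpc : ContinuousOn hp {z | z.im = 0}) (hmc : ContinuousOn hm {z | z.im = 0})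
    (hp_lim : ∀ z : ℂ, z.im = 0 → Tendsto h (𝓝[{z | 0 < z.im}] z) (𝓝 (hp z)))
    (hm_lim : ∀ z : ℂ, z.im = 0 → Tendsto h (𝓝[{z | z.im < 0}] z) (𝓝 (hm z)))
    (hj : Integrable fun s : ℝ => hp s - hm s)
    (hi : ∀ k, ContinuousOn (hin k) (sphere (c k) (r k)))
    (ho : ∀ k, ContinuousOn (hout k) (sphere (c k) (r k)))
    (hin_lim : ∀ k, ∀ z ∈ sphere (c k) (r k), Tendsto h (𝓝[ball (c k) (r k)] z) (𝓝 (hin k z)))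
    (hout_lim : ∀ k, ∀ z ∈ sphere (c k) (r k),
      Tendsto h (𝓝[(closedBall (c k) (r k))ᶜ] z) (𝓝 (hout k z)))
    {z : ℂ} (hz : z ∉ {z : ℂ | z.im = 0} ∪ ⋃ k, sphere (c k) (r k)) :
    h z = h₀ + (2 * Real.pi * I)⁻¹ * (∫ s : ℝ, (hp s - hm s) / (s - z))
      + ∑ k, cauchyCircle (fun s => hin k s - hout k s) (c k) (r k) z := by
  classical
  set C : ι → ℂ → ℂ := fun k => cauchyCircle (fun s => hin k s - hout k s) (c k) (r k) with hC
  have hCd : ∀ k z, z ∉ sphere (c k) (r k) → DifferentiableAt ℂ (C k) z := fun k z hz =>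
    differentiableAt_cauchyCircle (hr k) ((hi k).sub (ho k)) hz
  have hline : IsClosed {z : ℂ | z.im = 0} := isClosed_eq Complex.continuous_im continuous_const
  have hball0 : ∀ k, ∀ s ∈ closedBall (c k) (r k), s.im ≠ 0 := fun k s hs h0 => by
    rw [mem_closedBall, Complex.dist_eq] at hs
    have := (abs_im_le_norm (s - c k)).trans hs
    rw [sub_im, h0, zero_sub, abs_neg] at this
    exact (him k).not_ge this
  have hother : ∀ j k, j ≠ k → ∀ s ∈ closedBall (c j) (r j), s ∉ sphere (c k) (r k) :=
    fun j k hjk s hs h0 => Set.disjoint_left.1 (hdisj hjk) hs (sphere_subset_closedBall h0)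
  -- the complement of all curves except one circle
  set U : ι → Set ℂ := fun k => ({z : ℂ | z.im = 0} ∪ ⋃ j ∈ {j | j ≠ k}, sphere (c j) (r j))ᶜ with hU
  have hUo : ∀ k, IsOpen (U k) := fun k => by
    rw [hU, isOpen_compl_iff]
    exact hline.union ((Set.toFinite _).isClosed_biUnion fun j _ => isClosed_sphere)
  have hUmem : ∀ k s, s ∈ U k ↔ s.im ≠ 0 ∧ ∀ j, j ≠ k → s ∉ sphere (c j) (r j) := fun k s => by
    simp [hU]
  have hmem : ∀ s : ℂ, s ∉ {z : ℂ | z.im = 0} ∪ ⋃ k, sphere (c k) (r k)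
      ↔ s.im ≠ 0 ∧ ∀ j, s ∉ sphere (c j) (r j) := fun s => by
    simp [not_or]
  have hopen : IsOpen ({z : ℂ | z.im = 0} ∪ ⋃ k, sphere (c k) (r k))ᶜ :=
    (hline.union (isClosed_iUnion_of_finite fun k => isClosed_sphere)).isOpen_compl
  have hex : ∀ k, ∃ H : ℂ → ℂ, DifferentiableOn ℂ H (U k) ∧ ∀ z ∈ U k \ sphere (c k) (r k),
      H z = h z - C k z := fun k => by
    refine exists_differentiableOn_sub_cauchyCircle (hUo k) (hr k) (fun s hs => ?_)
      (hd.mono fun s hs => ?_) (hi k) (ho k) (hin_lim k) (hout_lim k)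
    · exact (hUmem k s).2 ⟨hball0 k s hs, fun j hj => hother k j hj.symm s hs⟩
    · refine (hmem s).2 ⟨((hUmem k s).1 hs.1).1, fun j => ?_⟩
      rcases eq_or_ne j k with rfl | hj
      · exact hs.2
      · exact ((hUmem k s).1 hs.1).2 j hj
  choose G hGd hGe using hex
  -- Off the circles this is `h` minus all Cauchy integrals of the circle jumps and minus the limit
  -- `h₀`. On circle `k` the singular difference is replaced by the analytic function `G k`. The
  -- result jumps across the real line only and tends to `0`.
  set H : ℂ → ℂ := fun z => if hz : ∃ k, z ∈ sphere (c k) (r k) then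
    G hz.choose z - ∑ j ∈ Finset.univ.erase hz.choose, C j z - h₀
    else h z - ∑ j, C j z - h₀ with hH
  have hHn : ∀ s, (∀ j, s ∉ sphere (c j) (r j)) → H s = h s - ∑ j, C j s - h₀ := fun s hs =>
    dif_neg (not_exists.2 hs)
  have hHs : ∀ k, ∀ s ∈ sphere (c k) (r k),
      H s = G k s - ∑ j ∈ Finset.univ.erase k, C j s - h₀ := fun k s hs => by
    have hsk : ∃ k, s ∈ sphere (c k) (r k) := ⟨k, hs⟩
    have : hsk.choose = k := by
      by_contra hne
      exact hother _ _ hne s (sphere_subset_closedBall hsk.choose_spec) hs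
    rw [hH]
    simp only [dif_pos hsk, this]
  have hHd : DifferentiableOn ℂ H {z | z.im ≠ 0} := fun s hs => by
    refine DifferentiableAt.differentiableWithinAt ?_
    by_cases hex : ∃ k, s ∈ sphere (c k) (r k)
    · obtain ⟨k, hk⟩ := hex
      have hsU : s ∈ U k := (hUmem k s).2
        ⟨hs, fun j hj => hother k j hj.symm s (sphere_subset_closedBall hk)⟩
      have h1 : DifferentiableAt ℂ (fun s => G k s - ∑ j ∈ Finset.univ.erase k, C j s - h₀) s := by
        refine ((((hGd k) s hsU).differentiableAt ((hUo k).mem_nhds hsU)).fun_sub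
          (DifferentiableAt.fun_sum fun j hj => hCd j s ?_)).sub_const _
        exact ((hUmem k s).1 hsU).2 j (Finset.ne_of_mem_erase hj)
      refine h1.congr_of_eventuallyEq ?_
      filter_upwards [(hUo k).mem_nhds hsU] with w hw
      by_cases hwk : w ∈ sphere (c k) (r k)
      · exact hHs k w hwk
      · rw [hHn w fun j => ?_, hGe k w ⟨hw, hwk⟩,
          ← Finset.add_sum_erase _ (fun j => C j w) (Finset.mem_univ k)]
        · ring
        · rcases eq_or_ne j k with rfl | hj
          · exact hwk
          · exact ((hUmem k w).1 hw).2 j hj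
    · rw [not_exists] at hex
      have hsU := (hmem s).2 ⟨hs, hex⟩
      have h1 : DifferentiableAt ℂ (fun s => h s - ∑ j, C j s - h₀) s :=
        ((hd s hsU).differentiableAt (hopen.mem_nhds hsU)).fun_sub
          (DifferentiableAt.fun_sum fun j _ => hCd j s (hex j)) |>.sub_const _
      refine h1.congr_of_eventuallyEq ?_
      filter_upwards [hopen.mem_nhds hsU] with w hw
      exact hHn w ((hmem w).1 hw).2
  have hbdd : Bornology.IsBounded (⋃ k, sphere (c k) (r k)) :=
    (Bornology.isBounded_iUnion).2 fun k => isBounded_sphere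
  have hHinf : Tendsto H atInfty (𝓝 0) := by
    have h1 : Tendsto (fun z => h z - ∑ j, C j z - h₀) atInfty (𝓝 (h₀ - ∑ _j : ι, 0 - h₀)) :=
      (hinf.sub (tendsto_finsetSum _ fun j _ => (tendsto_cauchyCircle (hr j).le
        ((hi j).sub (ho j))).mono_left inf_le_left)).sub_const _
    rw [Finset.sum_const_zero, sub_zero, sub_self] at h1
    refine h1.congr' ?_
    have h2 : ∀ᶠ z in atInfty, z ∈ (⋃ k, sphere (c k) (r k))ᶜ :=
      Filter.mem_inf_of_left (Bornology.isBounded_def.1 hbdd)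
    filter_upwards [h2] with w hw
    exact (hHn w (by simpa using hw)).symm
  have hlim : ∀ (V : Set ℂ) (k : ℂ → ℂ) (s : ℂ), s.im = 0 → Tendsto h (𝓝[V] s) (𝓝 (k s)) →
      Tendsto H (𝓝[V] s) (𝓝 (k s - ∑ j, C j s - h₀)) := fun V k s hs hk => by
    have hsj : ∀ j, s ∉ sphere (c j) (r j) := fun j hj =>
      hball0 j s (sphere_subset_closedBall hj) hs
    have h1 : Tendsto (fun z => h z - ∑ j, C j z - h₀) (𝓝[V] s) (𝓝 (k s - ∑ j, C j s - h₀)) :=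
      (hk.sub (tendsto_finsetSum _ fun j _ =>
        (hCd j s (hsj j)).continuousAt.tendsto.mono_left nhdsWithin_le_nhds)).sub_const _
    refine h1.congr' ?_
    have h2 : (⋃ k, sphere (c k) (r k))ᶜ ∈ 𝓝 s :=
      (isClosed_iUnion_of_finite fun k => isClosed_sphere).isOpen_compl.mem_nhds (by simpa using hsj)
    filter_upwards [nhdsWithin_le_nhds h2] with w hw
    exact (hHn w (by simpa using hw)).symm
  have hCc : ContinuousOn (fun s => ∑ j, C j s) {z | z.im = 0} :=
    continuousOn_finsetSum _ fun j _ s hs => (hCd j s fun hj =>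
      hball0 j s (sphere_subset_closedBall hj) hs).continuousAt.continuousWithinAt
  obtain ⟨hz0, hzj⟩ := (hmem z).1 hz
  have key := eq_integral_line_of_tendsto_zero hHd hHinf
    (Hp := fun s => hp s - ∑ j, C j s - h₀) (Hm := fun s => hm s - ∑ j, C j s - h₀)
    ((hpc.sub hCc).sub continuousOn_const) ((hmc.sub hCc).sub continuousOn_const)
    (fun s hs => hlim _ hp s hs (hp_lim s hs)) (fun s hs => hlim _ hm s hs (hm_lim s hs))
    (by simpa using hj) hz0
  have h2pi : (2 * Real.pi * I : ℂ) ≠ 0 := by simp [Real.pi_ne_zero]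
  rw [hHn z hzj] at key
  simp only [sub_sub_sub_cancel_right] at key
  rw [← key, inv_mul_cancel_left₀ h2pi]
  ring

end CauchyLine

end VmKdV

/-! ### Laplace representation of Cauchy integrals -/

namespace VmKdV

open MeasureTheory Filter Set

section Laplace

open Complex

theorem norm_exp_two_I_mul (z : ℂ) (ξ : ℝ) : ‖exp (2 * I * z * ξ)‖ = Real.exp (-(2 * z.im) * ξ) := by
  rw [norm_exp]
  congr 1
  simp [mul_re, mul_im]

theorem norm_exp_two_I_mul_le {z : ℂ} (hz : 0 ≤ z.im) {ξ : ℝ} (hξ : 0 ≤ ξ) :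
    ‖exp (2 * I * z * ξ)‖ ≤ 1 := by
  rw [norm_exp_two_I_mul, Real.exp_le_one_iff]
  nlinarith

theorem integrableOn_exp_neg_mul {b : ℝ} (hb : 0 < b) :
    IntegrableOn (fun ξ : ℝ => Real.exp (-(2 * b) * ξ)) (Ioi 0) :=
  integrableOn_exp_mul_Ioi (by linarith) 0

theorem inv_eq_integral_exp {w : ℂ} (hw : 0 < w.im) :
    w⁻¹ = ∫ ξ : ℝ in Ioi 0, -2 * I * exp (2 * I * w * ξ) := by
  have hre : (2 * I * w).re < 0 := by simpa [mul_re, mul_im] using hw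
  have hw0 : w ≠ 0 := by
    rintro rfl
    simp at hw
  rw [integral_const_mul, integral_exp_mul_complex_Ioi hre]
  simp
  field_simp

/-- The link between spectral variable and space variable: multiplication by `e^{2izξ}` is a
translation in `x`. This is what makes the integral equations below have kernels depending on sums
of arguments. -/
theorem exp_theta_add (x ξ t : ℝ) (z : ℂ) :
    exp (2 * I * theta (x + ξ) t z) = exp (2 * I * theta x t z) * exp (2 * I * z * ξ) := by
  rw [← exp_add]
  congr 1
  simp only [theta]
  push_cast
  ring

variable {μ : Measure ℝ} [SFinite μ] {σ : ℝ → ℂ}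

/-- Since `Im (σ - z) > 0`, the factor `1/(σ - z)` is a Laplace integral. As `Im z < 0`, the factor
`e^{-2izξ}` is exponentially damped, which justifies Fubini for merely integrable `ρ`. -/
theorem integral_div_sub_eq_laplace {ρ : ℝ → ℂ} (hσ : Continuous σ) (hρ : Integrable ρ μ)
    (him : ∀ s, 0 ≤ (σ s).im) {z : ℂ} (hz : z.im < 0) :
    ∫ s, ρ s / (σ s - z) ∂μ = -2 * I * ∫ ξ : ℝ in Ioi 0,
      (∫ s, ρ s * exp (2 * I * σ s * ξ) ∂μ) * exp (2 * I * -z * ξ) := by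
  have hF : Integrable (Function.uncurry fun (s ξ : ℝ) =>
      ρ s * (-2 * I * exp (2 * I * (σ s - z) * ξ))) (μ.prod (volume.restrict (Ioi 0))) := by
    refine ((hρ.norm.mul_prod (integrableOn_exp_neg_mul (neg_pos.2 hz))).const_mul 2).mono' ?_ ?_
    · refine hρ.aestronglyMeasurable.comp_fst.mul (Continuous.aestronglyMeasurable ?_)
      fun_prop
    · have h0 : ∀ᵐ p : ℝ × ℝ ∂(μ.prod (volume.restrict (Ioi 0))), p.2 ∈ Ioi (0 : ℝ) :=
        Measure.quasiMeasurePreserving_snd.ae (ae_restrict_mem measurableSet_Ioi)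
      filter_upwards [h0] with p hp
      have hp0 : (0 : ℝ) < p.2 := hp
      simp only [Function.uncurry]
      rw [norm_mul, norm_mul, norm_exp_two_I_mul]
      have h1 : ‖(-2 * I : ℂ)‖ = 2 := by simp
      have h2 : Real.exp (-(2 * (σ p.1 - z).im) * p.2) ≤ Real.exp (-(2 * -z.im) * p.2) := by
        rw [Real.exp_le_exp, sub_im]
        nlinarith [him p.1, mul_nonneg (him p.1) hp0.le]
      rw [h1]
      nlinarith [norm_nonneg (ρ p.1)]
  have e1 : ∀ s, ρ s / (σ s - z)
      = ∫ ξ : ℝ in Ioi 0, ρ s * (-2 * I * exp (2 * I * (σ s - z) * ξ)) := fun s => by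
    rw [integral_const_mul, ← inv_eq_integral_exp, div_eq_mul_inv]
    rw [sub_im]
    linarith [him s]
  simp_rw [e1]
  rw [integral_integral_swap hF, ← integral_const_mul]
  congr 1
  ext ξ
  rw [← integral_mul_const, ← integral_const_mul]
  congr 1
  ext s
  have : exp (2 * I * (σ s - z) * ξ) = exp (2 * I * σ s * ξ) * exp (2 * I * -z * ξ) := by
    rw [← exp_add]
    congr 1
    ring
  rw [this]
  ring

theorem integral_div_sub_eq_laplace_expIntegral {w : ℝ → ℂ} (h : HasExpMoments μ σ w)
    (him : ∀ s, 0 ≤ (σ s).im) (x t : ℝ) {z : ℂ} (hz : z.im < 0) :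
    ∫ s, w s * exp (2 * I * theta x t (σ s)) / (σ s - z) ∂μ = -2 * I * ∫ ξ : ℝ in Ioi 0,
      expIntegral μ σ w 0 (x + ξ) t * exp (2 * I * -z * ξ) := by
  have h1 := h.integrable_integrand 0 x t
  simp only [pow_zero, one_mul] at h1
  rw [integral_div_sub_eq_laplace h.continuous_curve h1 him hz]
  simp only [expIntegral, exp_theta_add, pow_zero, one_mul, ← mul_assoc]

/-- The function `δ + ∫_0^∞ β(ζ) e^{2izζ} dζ`. -/
noncomputable def laplaceAdd (δ : ℂ) (β : ℝ → ℂ) (z : ℂ) : ℂ :=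
  δ + ∫ ζ : ℝ in Ioi 0, β ζ * exp (2 * I * z * ζ)

/-- Multiplying the weight by a boundary value of `δ + ∫ β(ζ) e^{2izζ} dζ` amounts to integrating
translates of the flow against `β`. As `β` is only bounded, the Laplace integral need not converge
on the curve itself. The curve is raised by `iε`, Fubini is applied there, and `ε → 0` by dominated
convergence on both sides, the majorants being `C |ρ|` and the decay of the flow. -/
theorem expIntegral_mul_eq {w a β : ℝ → ℂ} {δ : ℂ} {B C K ε₀ y t : ℝ} {k : ℕ}
    (h : HasExpMoments μ σ w) (him : ∀ s, 0 ≤ (σ s).im) (hβ : Continuous β)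
    (hB : ∀ ζ, 0 < ζ → ‖β ζ‖ ≤ B) (hε₀ : 0 < ε₀)
    (hC : ∀ s ε, 0 < ε → ε < ε₀ → ‖laplaceAdd δ β (σ s + ε * I)‖ ≤ C)
    (hlim : ∀ s, Tendsto (fun ε : ℝ => laplaceAdd δ β (σ s + ε * I)) (𝓝[>] 0) (𝓝 (a s)))
    (hK : ∀ ζ, 0 < ζ → ‖expIntegral μ σ w k (y + ζ) t‖ ≤ K * (1 + ζ ^ 2)⁻¹) :
    expIntegral μ σ (fun s => a s * w s) k y t = δ * expIntegral μ σ w k y t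
      + ∫ ζ : ℝ in Ioi 0, β ζ * expIntegral μ σ w k (y + ζ) t := by
  obtain ⟨ρ, hρ_def⟩ : ∃ ρ : ℝ → ℂ, ρ = fun s =>
    (2 * I * σ s) ^ k * w s * exp (2 * I * theta y t (σ s)) := ⟨_, rfl⟩
  have hσ := h.continuous_curve
  have hρ : Integrable ρ μ := hρ_def ▸ h.integrable_integrand k y t
  have hρc : Continuous ρ := hρ_def ▸ h.continuous_integrand k y t
  have hshift : ∀ ζ : ℝ, expIntegral μ σ w k (y + ζ) t = ∫ s, ρ s * exp (2 * I * σ s * ζ) ∂μ :=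
    fun ζ => by simp only [expIntegral, exp_theta_add, hρ_def, ← mul_assoc]
  have hBnn : 0 ≤ B := (norm_nonneg _).trans (hB 1 one_pos)
  have hprod : ∀ ε : ℝ, 0 < ε → Integrable (Function.uncurry fun (s ζ : ℝ) =>
      ρ s * (β ζ * exp (2 * I * (σ s + ε * I) * ζ))) (μ.prod (volume.restrict (Ioi 0))) :=
    fun ε hε => by
      refine ((hρ.norm.mul_prod (integrableOn_exp_neg_mul hε)).const_mul B).mono'
        (Continuous.aestronglyMeasurable (by fun_prop)) ?_
      have h0 : ∀ᵐ p : ℝ × ℝ ∂(μ.prod (volume.restrict (Ioi 0))), p.2 ∈ Ioi (0 : ℝ) :=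
        Measure.quasiMeasurePreserving_snd.ae (ae_restrict_mem measurableSet_Ioi)
      filter_upwards [h0] with p hp
      have hp0 : (0 : ℝ) < p.2 := hp
      simp only [Function.uncurry]
      rw [norm_mul, norm_mul, norm_exp_two_I_mul]
      have h2 : Real.exp (-(2 * (σ p.1 + ε * I).im) * p.2) ≤ Real.exp (-(2 * ε) * p.2) := by
        have : (σ p.1 + ε * I).im = (σ p.1).im + ε := by simp
        rw [Real.exp_le_exp, this]
        nlinarith [mul_nonneg (him p.1) hp0.le]
      have h3 := mul_le_mul (hB p.2 hp0) h2 (Real.exp_pos _).le hBnn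
      calc _ ≤ ‖ρ p.1‖ * (B * Real.exp (-(2 * ε) * p.2)) :=
            mul_le_mul_of_nonneg_left h3 (norm_nonneg _)
        _ = _ := by ring
  have hG : ∀ (s ε : ℝ), laplaceAdd δ β (σ s + ε * I) * ρ s
      = δ * ρ s + ∫ ζ : ℝ in Ioi 0, ρ s * (β ζ * exp (2 * I * (σ s + ε * I) * ζ)) := fun s ε => by
    rw [integral_const_mul, laplaceAdd]
    ring
  have hGi : ∀ ε : ℝ, 0 < ε → Integrable (fun s => laplaceAdd δ β (σ s + ε * I) * ρ s) μ :=
    fun ε hε => by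
      simp only [hG]
      exact (hρ.const_mul δ).add (hprod ε hε).integral_prod_left
  have heq : ∀ ε : ℝ, 0 < ε → ∫ s, laplaceAdd δ β (σ s + ε * I) * ρ s ∂μ
      = δ * expIntegral μ σ w k y t + ∫ ζ : ℝ in Ioi 0, (Real.exp (-(2 * ε) * ζ) : ℂ)
        * (β ζ * expIntegral μ σ w k (y + ζ) t) := fun ε hε => by
    have hi : Integrable (fun s => ∫ ζ : ℝ in Ioi 0,
        ρ s * (β ζ * exp (2 * I * (σ s + ε * I) * ζ))) μ := (hprod ε hε).integral_prod_left
    simp only [hG]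
    rw [integral_add (hρ.const_mul δ) hi, integral_const_mul,
      integral_integral_swap (hprod ε hε)]
    have h0 : expIntegral μ σ w k y t = ∫ s, ρ s ∂μ := by rw [hρ_def, expIntegral]
    rw [h0]
    congr 1
    refine integral_congr_ae (Eventually.of_forall fun ζ => ?_)
    dsimp only
    rw [hshift, ← integral_const_mul, ← integral_const_mul]
    congr 1
    ext s
    have : exp (2 * I * (σ s + ε * I) * ζ) = exp (2 * I * σ s * ζ) * Real.exp (-(2 * ε) * ζ) := by
      rw [ofReal_exp, ← exp_add]
      congr 1
      push_cast
      linear_combination (2 * ε * ζ) * I_sq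
    rw [this]
    ring
  have hleft : Tendsto (fun ε : ℝ => ∫ s, laplaceAdd δ β (σ s + ε * I) * ρ s ∂μ) (𝓝[>] 0)
      (𝓝 (expIntegral μ σ (fun s => a s * w s) k y t)) := by
    have : expIntegral μ σ (fun s => a s * w s) k y t = ∫ s, a s * ρ s ∂μ := by
      simp only [expIntegral, hρ_def]
      congr 1
      ext s
      ring
    rw [this]
    refine tendsto_integral_filter_of_dominated_convergence (fun s => C * ‖ρ s‖) ?_ ?_
      (hρ.norm.const_mul C) (Eventually.of_forall fun s => (hlim s).mul_const _)
    · filter_upwards [self_mem_nhdsWithin] with ε hε using (hGi ε hε).aestronglyMeasurable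
    · filter_upwards [Ioo_mem_nhdsGT hε₀] with ε hε
      refine Eventually.of_forall fun s => ?_
      rw [norm_mul]
      exact mul_le_mul_of_nonneg_right (hC s ε hε.1 hε.2) (norm_nonneg _)
  have hEc : Continuous fun ζ => expIntegral μ σ w k (y + ζ) t := by
    have : Continuous fun y => expIntegral μ σ w k y t :=
      continuous_iff_continuousAt.2 fun y => (h.hasDerivAt_space k y t).continuousAt
    exact this.comp (continuous_const.add continuous_id)
  have hright : Tendsto (fun ε : ℝ => ∫ ζ : ℝ in Ioi 0, (Real.exp (-(2 * ε) * ζ) : ℂ)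
      * (β ζ * expIntegral μ σ w k (y + ζ) t)) (𝓝[>] 0)
      (𝓝 (∫ ζ : ℝ in Ioi 0, β ζ * expIntegral μ σ w k (y + ζ) t)) := by
    refine tendsto_integral_filter_of_dominated_convergence
      (fun ζ => B * (K * (1 + ζ ^ 2)⁻¹)) (Eventually.of_forall fun ε => ?_) ?_ ?_ ?_
    · exact Continuous.aestronglyMeasurable (by fun_prop)
    · filter_upwards [self_mem_nhdsWithin] with ε hε
      filter_upwards [ae_restrict_mem measurableSet_Ioi] with ζ hζ
      have hε0 : (0 : ℝ) < ε := hε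
      have hζ0 : (0 : ℝ) < ζ := hζ
      rw [norm_mul, norm_mul, norm_real, Real.norm_of_nonneg (Real.exp_pos _).le]
      have h1 : Real.exp (-(2 * ε) * ζ) ≤ 1 := by
        rw [Real.exp_le_one_iff]
        nlinarith [mul_pos hε0 hζ0]
      have h2 := mul_le_mul (hB ζ hζ) (hK ζ hζ) (norm_nonneg _) hBnn
      exact (mul_le_of_le_one_left (by positivity) h1).trans h2
    · exact ((integrable_inv_one_add_sq.const_mul K).const_mul B).integrableOn
    · refine Eventually.of_forall fun ζ => ?_
      have h1 : Continuous fun ε : ℝ => (Real.exp (-(2 * ε) * ζ) : ℂ)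
          * (β ζ * expIntegral μ σ w k (y + ζ) t) := by fun_prop
      have := (h1.tendsto 0).mono_left (nhdsWithin_le_nhds (s := Ioi 0))
      simpa using this
  refine tendsto_nhds_unique hleft ((hright.const_add _).congr' ?_)
  filter_upwards [self_mem_nhdsWithin] with ε hε using (heq ε hε).symm

theorem tendsto_inv_one_add_sq : Tendsto (fun ξ : ℝ => (1 + ξ ^ 2)⁻¹) atTop (𝓝 0) :=
  (tendsto_atTop_add_const_left _ _ (tendsto_pow_atTop two_ne_zero)).inv_tendsto_atTop

/-- Integration by parts in a Laplace integral. -/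
theorem laplace_deriv {g g' : ℝ → ℂ} {C : ℝ} (hg : ∀ ξ, HasDerivAt g (g' ξ) ξ)
    (hg' : Continuous g') (hC : ∀ ξ, 0 ≤ ξ → ‖g ξ‖ ≤ C * (1 + ξ ^ 2)⁻¹)
    (hC' : ∀ ξ, 0 ≤ ξ → ‖g' ξ‖ ≤ C * (1 + ξ ^ 2)⁻¹) {w : ℂ} (hw : 0 ≤ w.im) :
    2 * I * w * ∫ ξ : ℝ in Ioi 0, g ξ * exp (2 * I * w * ξ)
      = -(g 0 + ∫ ξ : ℝ in Ioi 0, g' ξ * exp (2 * I * w * ξ)) := by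
  have hgc : Continuous g := continuous_iff_continuousAt.2 fun ξ => (hg ξ).continuousAt
  have hint : ∀ k : ℝ → ℂ, Continuous k → (∀ ξ, 0 ≤ ξ → ‖k ξ‖ ≤ C * (1 + ξ ^ 2)⁻¹) →
      IntegrableOn (fun ξ : ℝ => k ξ * exp (2 * I * w * ξ)) (Ioi 0) := fun k hk hkC => by
    refine ((integrable_inv_one_add_sq.const_mul C).integrableOn).mono'
      (Continuous.aestronglyMeasurable (by fun_prop)) ?_
    filter_upwards [ae_restrict_mem measurableSet_Ioi] with ξ hξ
    rw [norm_mul]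
    exact (mul_le_of_le_one_right (norm_nonneg _) (norm_exp_two_I_mul_le hw (le_of_lt hξ))).trans
      (hkC ξ (le_of_lt hξ))
  have hd : ∀ ξ ∈ Ici (0 : ℝ), HasDerivAt (fun ξ : ℝ => g ξ * exp (2 * I * w * ξ))
      (g' ξ * exp (2 * I * w * ξ) + 2 * I * w * (g ξ * exp (2 * I * w * ξ))) ξ := fun ξ _ => by
    have h1 : HasDerivAt (fun ξ : ℝ => 2 * I * w * ξ) (2 * I * w) ξ := by
      simpa using (hasDerivAt_id ξ).ofReal_comp.const_mul (2 * I * w)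
    refine ((hg ξ).mul h1.cexp).congr_deriv ?_
    ring
  have hlim : Tendsto (fun ξ : ℝ => g ξ * exp (2 * I * w * ξ)) atTop (𝓝 0) := by
    refine squeeze_zero_norm' (a := fun ξ => C * (1 + ξ ^ 2)⁻¹) ?_ (by
      simpa using tendsto_inv_one_add_sq.const_mul C)
    filter_upwards [eventually_ge_atTop 0] with ξ hξ
    rw [norm_mul]
    exact (mul_le_of_le_one_right (norm_nonneg _) (norm_exp_two_I_mul_le hw hξ)).trans (hC ξ hξ)
  have h2 := integral_Ioi_of_hasDerivAt_of_tendsto' hd ((hint g' hg' hC').add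
    ((hint g hgc hC).const_mul (2 * I * w))) hlim
  rw [integral_add (hint g' hg' hC') ((hint g hgc hC).const_mul _), integral_const_mul] at h2
  simp only [ofReal_zero, mul_zero, exp_zero, mul_one] at h2
  linear_combination h2

/-- The leading term of a Laplace integral at infinity. -/
theorem tendsto_mul_laplace {g g' g'' : ℝ → ℂ} {C : ℝ} (hg : ∀ ξ, HasDerivAt g (g' ξ) ξ)
    (hg' : ∀ ξ, HasDerivAt g' (g'' ξ) ξ) (hg'' : Continuous g'')
    (hC : ∀ ξ, 0 ≤ ξ → ‖g ξ‖ ≤ C * (1 + ξ ^ 2)⁻¹) (hC' : ∀ ξ, 0 ≤ ξ → ‖g' ξ‖ ≤ C * (1 + ξ ^ 2)⁻¹)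
    (hC'' : ∀ ξ, 0 ≤ ξ → ‖g'' ξ‖ ≤ C * (1 + ξ ^ 2)⁻¹) :
    Tendsto (fun w : ℂ => 2 * I * w * ∫ ξ : ℝ in Ioi 0, g ξ * exp (2 * I * w * ξ))
      (Bornology.cobounded ℂ ⊓ 𝓟 {w | 0 < w.im}) (𝓝 (-g 0)) := by
  have hg'c : Continuous g' := continuous_iff_continuousAt.2 fun ξ => (hg' ξ).continuousAt
  set J : ℝ := ∫ ξ in Ioi (0 : ℝ), C * (1 + ξ ^ 2)⁻¹ with hJ
  have h1 : Tendsto (fun w : ℂ => (‖g' 0‖ + J) / (2 * ‖w‖)) (Bornology.cobounded ℂ) (𝓝 0) :=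
    (tendsto_norm_cobounded_atTop.const_mul_atTop two_pos).const_div_atTop _
  -- A second integration by parts bounds the transform of `g'` by a multiple of `1/|w|`.
  have h2 : Tendsto (fun w : ℂ => ∫ ξ : ℝ in Ioi 0, g' ξ * exp (2 * I * w * ξ))
      (Bornology.cobounded ℂ ⊓ 𝓟 {w | 0 < w.im}) (𝓝 0) := by
    refine squeeze_zero_norm' ?_ (h1.mono_left inf_le_left)
    rw [eventually_inf_principal]
    filter_upwards [tendsto_norm_cobounded_atTop.eventually_gt_atTop 0] with w hw0 hw
    have h3 := laplace_deriv hg' hg'' hC' hC'' (le_of_lt hw)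
    have h4 : ‖∫ ξ : ℝ in Ioi 0, g'' ξ * exp (2 * I * w * ξ)‖ ≤ J := by
      refine norm_integral_le_of_norm_le ((integrable_inv_one_add_sq.const_mul C).integrableOn) ?_
      filter_upwards [ae_restrict_mem measurableSet_Ioi] with ξ hξ
      rw [norm_mul]
      exact (mul_le_of_le_one_right (norm_nonneg _)
        (norm_exp_two_I_mul_le (le_of_lt hw) (le_of_lt hξ))).trans (hC'' ξ (le_of_lt hξ))
    have h5 := congrArg norm h3
    rw [norm_mul, norm_neg] at h5
    have h6 : ‖2 * I * w‖ = 2 * ‖w‖ := by simp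
    rw [le_div_iff₀ (by positivity), mul_comm, ← h6, h5]
    exact (norm_add_le _ _).trans (add_le_add le_rfl h4)
  have h3 : Tendsto (fun w : ℂ => -(g 0 + ∫ ξ : ℝ in Ioi 0, g' ξ * exp (2 * I * w * ξ)))
      (Bornology.cobounded ℂ ⊓ 𝓟 {w | 0 < w.im}) (𝓝 (-g 0)) := by
    simpa using (h2.const_add (g 0)).neg
  refine h3.congr' ?_
  filter_upwards [mem_inf_of_right (mem_principal_self _)] with w hw
  exact (laplace_deriv hg hg'c hC hC' (le_of_lt hw)).symm

end Laplace

end VmKdV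

/-! ### The jump conditions, entry by entry -/

namespace VmKdV

open MeasureTheory Filter Set

open Complex

section LowerUnit

variable {n : ℕ}

/-- The block matrix `((1, 0), (v, I))`. -/
def lowerUnit (v : Fin n → ℂ) : BlockMat n :=
  Matrix.fromBlocks 1 0 (Matrix.of fun i _ => v i) 1

theorem lowerUnit_inv (v : Fin n → ℂ) : (lowerUnit v)⁻¹ = lowerUnit (-v) := by
  refine Matrix.inv_eq_right_inv ?_
  rw [lowerUnit, lowerUnit, Matrix.fromBlocks_multiply, ← Matrix.fromBlocks_one]
  congr 1 <;> ext <;> simp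

theorem mul_lowerUnit_inl (B : BlockMat n) (v : Fin n → ℂ) (a : Unit ⊕ Fin n) :
    (B * lowerUnit v) a (Sum.inl ()) = B a (Sum.inl ()) + ∑ j, B a (Sum.inr j) * v j := by
  simp [Matrix.mul_apply, lowerUnit, Fintype.sum_sum_type]

theorem mul_lowerUnit_inr (B : BlockMat n) (v : Fin n → ℂ) (a : Unit ⊕ Fin n) (j : Fin n) :
    (B * lowerUnit v) a (Sum.inr j) = B a (Sum.inr j) := by
  simp [Matrix.mul_apply, lowerUnit, Fintype.sum_sum_type, Matrix.one_apply]

theorem mul_lowerUnit_transpose_inl (B : BlockMat n) (v : Fin n → ℂ) (a : Unit ⊕ Fin n) :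
    (B * (lowerUnit v)ᵀ) a (Sum.inl ()) = B a (Sum.inl ()) := by
  simp [Matrix.mul_apply, lowerUnit, Fintype.sum_sum_type]

theorem mul_lowerUnit_transpose_inr (B : BlockMat n) (v : Fin n → ℂ) (a : Unit ⊕ Fin n)
    (j : Fin n) :
    (B * (lowerUnit v)ᵀ) a (Sum.inr j) = B a (Sum.inl ()) * v j + B a (Sum.inr j) := by
  simp [Matrix.mul_apply, lowerUnit, Fintype.sum_sum_type, Matrix.one_apply]

theorem lowerUnit_map_conj (v : Fin n → ℂ) :
    (lowerUnit v).map conj = lowerUnit fun j => conj (v j) := by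
  rw [lowerUnit, lowerUnit, Matrix.fromBlocks_map]
  congr 1 <;> ext <;> simp [Matrix.one_apply, apply_ite]

theorem lowerUnit_conjTranspose (v : Fin n → ℂ) :
    (lowerUnit v)ᴴ = (lowerUnit fun j => conj (v j))ᵀ := by
  rw [← lowerUnit_map_conj]
  rfl

end LowerUnit

namespace ScatteringData

variable {n : ℕ} (D : ScatteringData n)

open Metric

section Circles

/-- The centres of all circles of the contour. -/
def circleCenter : D.Disk ⊕ D.Disk → ℂ := Sum.elim D.diskCenter fun d => conj (D.diskCenter d)

/-- The radii of all circles of the contour. -/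
def circleRadius (r : Fin D.N → ℝ) : D.Disk ⊕ D.Disk → ℝ :=
  Sum.elim (D.diskRadius r) (D.diskRadius r)

variable {D} {r : Fin D.N → ℝ}

theorem contour_eq : D.contour r
    = {z : ℂ | z.im = 0} ∪ ⋃ k, sphere (D.circleCenter k) (D.circleRadius r k) := by
  ext z
  simp only [contour, Set.mem_union, mem_iUnion, Set.mem_ofPred_eq, circleCenter, circleRadius,
    Sum.exists, Sum.elim_inl, Sum.elim_inr, diskCenter, diskRadius, Subtype.exists, map_neg,
    Complex.conj_conj]
  constructor
  · rintro ((h | ⟨k, h | h⟩) | ⟨k, hk, h | h⟩)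
    · exact Or.inl h
    · exact Or.inr (Or.inl (Or.inl ⟨k, h⟩))
    · exact Or.inr (Or.inr (Or.inl ⟨k, h⟩))
    · exact Or.inr (Or.inr (Or.inr ⟨k, hk, h⟩))
    · exact Or.inr (Or.inl (Or.inr ⟨k, hk, h⟩))
  · rintro (h | (⟨k, h⟩ | ⟨k, hk, h⟩) | (⟨k, h⟩ | ⟨k, hk, h⟩))
    · exact Or.inl (Or.inl h)
    · exact Or.inl (Or.inr ⟨k, Or.inl h⟩)
    · exact Or.inr ⟨k, hk, Or.inr h⟩
    · exact Or.inl (Or.inr ⟨k, Or.inr h⟩)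
    · exact Or.inr ⟨k, hk, Or.inl h⟩

variable (hr : D.AdmissibleRadii r)
include hr

theorem circleRadius_pos (k : D.Disk ⊕ D.Disk) : 0 < D.circleRadius r k := by
  rcases k with d | d <;> exact diskRadius_pos hr d

theorem circleRadius_lt_abs_im (k : D.Disk ⊕ D.Disk) :
    D.circleRadius r k < |(D.circleCenter k).im| := by
  rcases k with d | d
  · exact (diskRadius_lt_im hr d).trans_le (le_abs_self _)
  · simpa [circleCenter, circleRadius] using (diskRadius_lt_im hr d).trans_le (le_abs_self _)

/-- The admissibility condition does not compare two reflected disks with each other. Their distance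
equals that of the original disks, because reflection is an isometry. -/
theorem diskRadius_add_lt_dist {d e : D.Disk} (h : d ≠ e) :
    D.diskRadius r d + D.diskRadius r e < dist (D.diskCenter d) (D.diskCenter e) := by
  have key : ∀ j k : Fin D.N, j ≠ k → r j + r k < dist (D.pole j) (D.pole k) := fun j k hjk =>
    (disjoint_closedBall_closedBall_iff (hr.pos j).le (hr.pos k).le).1 (hr.disjoint j k hjk)
  have key2 : ∀ (j : Fin D.N) (k : {k : Fin D.N // (D.pole k).re ≠ 0}),
      r j + r k < dist (D.pole j) (-conj (D.pole k)) := fun j k =>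
    (disjoint_closedBall_closedBall_iff (hr.pos j).le (hr.pos _).le).1
      (hr.disjoint_reflected j k k.2)
  rcases d with j | j <;> rcases e with k | k
  · exact key j k fun h0 => h (h0 ▸ rfl)
  · exact key2 j k
  · have := key2 k j
    rwa [add_comm, dist_comm] at this
  · have := key j k fun h0 => h (congrArg Sum.inr (Subtype.ext h0))
    simpa [diskRadius, diskCenter, dist_neg_neg, Complex.dist_conj_conj] using this

theorem pairwise_disjoint_circles : Pairwise fun j k =>
    Disjoint (closedBall (D.circleCenter j) (D.circleRadius r j))
      (closedBall (D.circleCenter k) (D.circleRadius r k)) := by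
  have key : ∀ d e : D.Disk, D.diskRadius r d + D.diskRadius r e
      < dist (D.diskCenter d) (conj (D.diskCenter e)) := fun d e => by
    have h1 := diskRadius_lt_im hr d
    have h2 := diskRadius_lt_im hr e
    have h3 := (le_abs_self _).trans (abs_im_le_norm (D.diskCenter d - conj (D.diskCenter e)))
    rw [sub_im, conj_im] at h3
    rw [Complex.dist_eq]
    linarith
  intro j k hjk
  rw [disjoint_closedBall_closedBall_iff (circleRadius_pos hr j).le (circleRadius_pos hr k).le]
  rcases j with d | d <;> rcases k with e | e
  · exact diskRadius_add_lt_dist hr fun h0 => hjk (congrArg Sum.inl h0)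
  · exact key d e
  · have := key e d
    rwa [add_comm, dist_comm] at this
  · have := diskRadius_add_lt_dist hr fun h0 => hjk (congrArg Sum.inr h0)
    simpa [circleRadius, circleCenter, Complex.dist_conj_conj] using this

end Circles

section Jumps

variable {D} {r : Fin D.N → ℝ} {x t : ℝ} {M : ℂ → BlockMat n}

variable (D) in
/-- The singular factor of the jump on a circle, with the phase. -/
noncomputable def jumpWeight (x t : ℝ) (j : Fin n) (d : D.Disk) (z : ℂ) : ℂ :=
  D.diskWeight j d z * exp (2 * I * theta x t z)

theorem P_eq (k : Fin D.N) (z : ℂ) :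
    D.P k x t z = lowerUnit fun j => -D.jumpWeight x t j (Sum.inl k) z := by
  rw [P, lowerUnit]
  congr 1
  ext j _
  simp only [Matrix.of_apply, jumpWeight, diskWeight, Sum.elim_inl]
  ring

theorem conj_jumpWeight_inl (j : Fin n) (k : {k : Fin D.N // (D.pole k).re ≠ 0}) (z : ℂ) :
    conj (D.jumpWeight x t j (Sum.inl k.1) (-conj z)) = D.jumpWeight x t j (Sum.inr k) z := by
  rw [jumpWeight, map_mul, conj_exp_theta, jumpWeight, diskWeight_reflect]
  simp

/-- The orientations and the inverses in the jump matrices are arranged so that all upper circles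
have the same normal form: only the first column jumps, by combinations of the other columns, which
are continuous across the circle. -/
theorem exists_jump_upper (h : IsRHSolution D r x t M) (d : D.Disk) :
    ∃ Bi Bo : ℂ → BlockMat n,
      ContinuousOn Bi (sphere (D.diskCenter d) (D.diskRadius r d)) ∧
      ContinuousOn Bo (sphere (D.diskCenter d) (D.diskRadius r d)) ∧
      ∀ z ∈ sphere (D.diskCenter d) (D.diskRadius r d),
        Tendsto M (𝓝[ball (D.diskCenter d) (D.diskRadius r d)] z) (𝓝 (Bi z)) ∧
        Tendsto M (𝓝[(closedBall (D.diskCenter d) (D.diskRadius r d))ᶜ] z) (𝓝 (Bo z)) ∧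
        ∀ a, Bi z a (Sum.inl ()) = Bo z a (Sum.inl ())
            - ∑ j, Bo z a (Sum.inr j) * D.jumpWeight x t j d z ∧
          ∀ j, Bi z a (Sum.inr j) = Bo z a (Sum.inr j) := by
  rcases d with k | k
  · obtain ⟨Mp, Mm, hp, hm, hj⟩ := h.jump_disk k
    refine ⟨Mm, Mp, hm, hp, fun z hz => ⟨(hj z hz).2.1, (hj z hz).1, fun a => ?_⟩⟩
    have e := (hj z hz).2.2
    beta_reduce at e
    rw [e, P_eq, lowerUnit_inv, mul_lowerUnit_inl]
    simp [mul_lowerUnit_inr]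
  · obtain ⟨Mp, Mm, hp, hm, hj⟩ := h.jump_neg_conj_disk k k.2
    refine ⟨Mp, Mm, hp, hm, fun z hz => ⟨(hj z hz).1, (hj z hz).2.1, fun a => ?_⟩⟩
    have e := (hj z hz).2.2
    beta_reduce at e
    rw [e, P_eq, lowerUnit_map_conj, mul_lowerUnit_inl]
    simp [mul_lowerUnit_inr, conj_jumpWeight_inl, sub_eq_add_neg]

/-- The mirror statement: across lower circles only the last `n` columns jump, by multiples of the
first column, with the conjugate of the weight of the reflected upper circle. -/
theorem exists_jump_lower (h : IsRHSolution D r x t M) (d : D.Disk) :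
    ∃ Bi Bo : ℂ → BlockMat n,
      ContinuousOn Bi (sphere (conj (D.diskCenter d)) (D.diskRadius r d)) ∧
      ContinuousOn Bo (sphere (conj (D.diskCenter d)) (D.diskRadius r d)) ∧
      ∀ z ∈ sphere (conj (D.diskCenter d)) (D.diskRadius r d),
        Tendsto M (𝓝[ball (conj (D.diskCenter d)) (D.diskRadius r d)] z) (𝓝 (Bi z)) ∧
        Tendsto M (𝓝[(closedBall (conj (D.diskCenter d)) (D.diskRadius r d))ᶜ] z) (𝓝 (Bo z)) ∧
        ∀ a, Bi z a (Sum.inl ()) = Bo z a (Sum.inl ()) ∧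
          ∀ j, Bi z a (Sum.inr j) = Bo z a (Sum.inr j)
            + Bi z a (Sum.inl ()) * conj (D.jumpWeight x t j d (conj z)) := by
  rcases d with k | k
  · obtain ⟨Mp, Mm, hp, hm, hj⟩ := h.jump_conj_disk k
    refine ⟨Mp, Mm, hp, hm, fun z hz => ⟨(hj z hz).1, (hj z hz).2.1, fun a => ?_⟩⟩
    have e := (hj z hz).2.2
    beta_reduce at e
    rw [e, P_eq, lowerUnit_conjTranspose, ← Matrix.transpose_nonsing_inv,
      lowerUnit_inv, mul_lowerUnit_transpose_inl]
    simp [mul_lowerUnit_transpose_inr, add_comm]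
  · have hc : conj (D.diskCenter (Sum.inr k)) = -D.pole k := by simp [diskCenter]
    rw [hc]
    obtain ⟨Mp, Mm, hp, hm, hj⟩ := h.jump_neg_disk k k.2
    refine ⟨Mm, Mp, hm, hp, fun z hz => ⟨(hj z hz).2.1, (hj z hz).1, fun a => ?_⟩⟩
    have e := (hj z hz).2.2
    beta_reduce at e
    rw [e, P_eq, mul_lowerUnit_transpose_inl]
    simp [mul_lowerUnit_transpose_inr, ← conj_jumpWeight_inl]

/-- This expresses a triangular factorization of the jump matrix. Measuring the jump of the first
column with the upper boundary values of the others, and the jumps of the others with the lower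
boundary value of the first, removes the quadratic term `γγ†` and leaves the same form as on the
circles. -/
theorem exists_jump_line (h : IsRHSolution D r x t M) :
    ∃ Bp Bm : ℂ → BlockMat n,
      ContinuousOn Bp {z | z.im = 0} ∧ ContinuousOn Bm {z | z.im = 0} ∧
      (∀ z : ℂ, z.im = 0 → Tendsto M (𝓝[{z | 0 < z.im}] z) (𝓝 (Bp z)) ∧
        Tendsto M (𝓝[{z | z.im < 0}] z) (𝓝 (Bm z))) ∧
      ∀ (s : ℝ) (a : Unit ⊕ Fin n),
        (Bp s a (Sum.inl ()) - Bm s a (Sum.inl ()) = -∑ j, Bp s a (Sum.inr j)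
          * (conj (D.γ s j) * exp (2 * I * theta x t s))) ∧
        ∀ j, Bp s a (Sum.inr j) - Bm s a (Sum.inr j) = -(Bm s a (Sum.inl ())
          * conj (conj (D.γ s j) * exp (2 * I * theta x t s))) := by
  obtain ⟨Mp, Mm, hp, hm, hj⟩ := h.jump_real
  refine ⟨Mp, Mm, hp, hm, fun z hz => ⟨(hj z hz).1, (hj z hz).2.1⟩, fun s a => ?_⟩
  have h1 := (hj s (ofReal_im s)).2.2
  have hr : ∀ j, Mp s a (Sum.inr j) - Mm s a (Sum.inr j) = -(Mm s a (Sum.inl ())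
      * conj (conj (D.γ s j) * exp (2 * I * theta x t s))) := fun j => by
    have he : conj (exp (2 * I * theta x t s)) = exp (-2 * I * theta x t s) := by
      rw [conj_exp_theta, conj_ofReal, theta_neg]
      congr 1
      ring
    rw [h1, map_mul, Complex.conj_conj, he]
    simp [Matrix.mul_apply, jumpReal, Fintype.sum_sum_type, Matrix.one_apply]
    left
    ring
  refine ⟨?_, hr⟩
  have he2 : ∀ j, conj (conj (D.γ s j) * exp (2 * I * theta x t s))
      * (conj (D.γ s j) * exp (2 * I * theta x t s)) = D.γ s j * conj (D.γ s j) := fun j => by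
    rw [map_mul, Complex.conj_conj, conj_exp_theta, conj_ofReal, theta_neg]
    have : exp (2 * I * -theta x t s) * exp (2 * I * theta x t s) = 1 := by
      rw [← exp_add]
      simp
    linear_combination D.γ s j * conj (D.γ s j) * this
  have h2 : Mp s a (Sum.inl ()) = Mm s a (Sum.inl ()) * (1 + ∑ j, D.γ s j * conj (D.γ s j))
      - ∑ j, Mm s a (Sum.inr j) * (conj (D.γ s j) * exp (2 * I * theta x t s)) := by
    rw [h1]
    simp [Matrix.mul_apply, jumpReal, Fintype.sum_sum_type, mul_comm (exp _), sub_eq_add_neg]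
  have h3 : ∀ j, Mp s a (Sum.inr j) * (conj (D.γ s j) * exp (2 * I * theta x t s))
      = Mm s a (Sum.inr j) * (conj (D.γ s j) * exp (2 * I * theta x t s))
        - Mm s a (Sum.inl ()) * (D.γ s j * conj (D.γ s j)) := fun j => by
    linear_combination (conj (D.γ s j) * exp (2 * I * theta x t s)) * hr j
      - Mm s a (Sum.inl ()) * he2 j
  simp_rw [h2, h3]
  rw [Finset.sum_sub_distrib, ← Finset.mul_sum]
  ring

end Jumps

end ScatteringData

end VmKdV

/-! ### Closed Cauchy system for one row of the Riemann–Hilbert solution -/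

namespace VmKdV

open MeasureTheory Filter Set

open Complex

/-- The reflection `z ↦ conj z` and circle integrals. -/
theorem conj_circleIntegral_conj (G : ℂ → ℂ) (c : ℂ) (r : ℝ) :
    conj (∮ z in C(conj c, r), G z) = -∮ z in C(c, r), conj (G (conj z)) := by
  have hcm : ∀ s : ℝ, circleMap (conj c) r s = conj (circleMap c r (-s)) := fun s => by
    simp only [circleMap, map_add, map_mul, conj_ofReal, ← exp_conj, conj_I, ofReal_neg, map_neg]
    congr 3
    ring
  have hcd : ∀ s : ℝ, circleMap 0 r s * I = -conj (circleMap 0 r (-s) * I) := fun s => by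
    have h0 := congrArg (fun w => w - conj c) (hcm s)
    simp only [circleMap, map_add, map_mul, map_zero, conj_I, add_sub_cancel_left] at h0 ⊢
    linear_combination I * h0
  have hper : Function.Periodic (fun s => circleMap 0 r s * I * conj (G (conj (circleMap c r s))))
      (2 * Real.pi) := fun s => by
    simp only [periodic_circleMap 0 r s, periodic_circleMap c r s]
  have e : ∀ s : ℝ, conj (deriv (circleMap (conj c) r) s • G (circleMap (conj c) r s))
      = -(fun s => circleMap 0 r s * I * conj (G (conj (circleMap c r s)))) (-s) := fun s => by
    simp only
    rw [deriv_circleMap, hcd s, hcm s, smul_eq_mul, map_mul, map_neg, Complex.conj_conj, neg_mul]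
  have h1 : conj (∮ z in C(conj c, r), G z) = ∫ s in (0 : ℝ)..2 * Real.pi,
      conj (deriv (circleMap (conj c) r) s • G (circleMap (conj c) r s)) := by
    rw [circleIntegral, intervalIntegral.integral_of_le Real.two_pi_pos.le,
      intervalIntegral.integral_of_le Real.two_pi_pos.le, integral_conj]
  simp_rw [h1, e]
  rw [intervalIntegral.integral_neg, intervalIntegral.integral_comp_neg
    (fun s => circleMap 0 r s * I * conj (G (conj (circleMap c r s)))), circleIntegral]
  have := hper.intervalIntegral_add_eq (-(2 * Real.pi)) 0
  simp only [neg_add_cancel, zero_add] at this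
  simp [this]

open Metric in
/-- A function with continuous boundary values on the real line and a limit at infinity is bounded
near the real line. -/
theorem exists_norm_le_of_boundary {h hp : ℂ → ℂ} {h₀ : ℂ} {δ : ℝ} (hδ : 0 < δ)
    (hc : ContinuousOn h {z | 0 < z.im ∧ z.im < δ}) (hpc : ContinuousOn hp {z | z.im = 0})
    (hlim : ∀ z : ℂ, z.im = 0 → Tendsto h (𝓝[{z | 0 < z.im}] z) (𝓝 (hp z)))
    (hinf : Tendsto h atInfty (𝓝 h₀)) :
    ∃ C, (∀ z, 0 < z.im → z.im < δ / 2 → ‖h z‖ ≤ C) ∧ ∀ s : ℝ, ‖hp s‖ ≤ C := by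
  classical
  set S : Set ℂ := {z | z.im = 0} with hS
  have hSc : IsClosed S := isClosed_eq Complex.continuous_im continuous_const
  have hK : ContinuousOn (fun z => if z ∈ S then hp z else h z)
      ({z | 0 < z.im ∧ z.im < δ} ∪ S) :=
    continuousOn_ite_of_tendsto hSc (Set.disjoint_left.2 fun s hs h0 => hs.1.ne' h0) hc hpc
      fun z hz => (hlim z hz).mono_left (nhdsWithin_mono _ fun w hw => hw.1)
  have h1 := hinf.norm.eventually_le_const (lt_add_one ‖h₀‖)
  rw [atInfty, Filter.eventually_inf_principal] at h1
  obtain ⟨R, -, hR⟩ := (Filter.hasBasis_cobounded_norm (E := ℂ)).eventually_iff.1 h1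
  have hcomp : IsCompact (closedBall (0 : ℂ) R ∩ {z | 0 ≤ z.im ∧ z.im ≤ δ / 2}) :=
    (isCompact_closedBall _ _).inter_right ((isClosed_le continuous_const Complex.continuous_im).inter
      (isClosed_le Complex.continuous_im continuous_const))
  obtain ⟨C, hC⟩ := hcomp.exists_bound_of_continuousOn (hK.mono fun z hz => by
    rcases hz.2.1.eq_or_lt with h0 | h0
    · exact Or.inr h0.symm
    · exact Or.inl ⟨h0, hz.2.2.trans_lt (half_lt_self hδ)⟩)
  have key : ∀ z : ℂ, 0 < z.im → z.im < δ / 2 → ‖h z‖ ≤ max C (‖h₀‖ + 1) := fun z hz hz2 => by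
    rcases le_total R ‖z‖ with h2 | h2
    · exact (hR h2 hz.ne').trans (le_max_right _ _)
    · have := hC z ⟨by simpa using h2, hz.le, hz2.le⟩
      rw [if_neg (show z ∉ S from hz.ne')] at this
      exact this.trans (le_max_left _ _)
  refine ⟨_, key, fun s => ?_⟩
  have h3 : (𝓝[{z : ℂ | 0 < z.im}] (s : ℂ)).NeBot := by
    rw [← mem_closure_iff_nhdsWithin_neBot, closure_setOfPred_lt_im]
    simp
  refine le_of_tendsto (hlim s (ofReal_im s)).norm ?_
  have h4 : {z : ℂ | z.im < δ / 2} ∈ 𝓝 (s : ℂ) :=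
    (isOpen_lt Complex.continuous_im continuous_const).mem_nhds (by simp [hδ])
  filter_upwards [self_mem_nhdsWithin, nhdsWithin_le_nhds h4] with w hw hw2 using key w hw hw2

namespace ScatteringData

variable {n : ℕ} {D : ScatteringData n} {r : Fin D.N → ℝ}

open Metric

variable (D r) in
/-- `F` has the boundary values `a` along the pieces of the contour in the closed upper half-plane,
from above on the real line and from the inside on the circles. -/
structure HasPieceBoundary (F : ℂ → ℂ) (a : Option D.Disk → ℝ → ℂ) : Prop where
  continuous : ∀ o, Continuous (a o)
  bounded : ∃ C, ∀ o s, ‖a o s‖ ≤ C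
  line : ∀ s : ℝ, Tendsto F (𝓝[{z | 0 < z.im}] (s : ℂ)) (𝓝 (a none s))
  disk : ∀ d s, Tendsto F (𝓝[ball (D.diskCenter d) (D.diskRadius r d)]
    (D.pieceCurve r (some d) s)) (𝓝 (a (some d) s))
  bounded_near : ∃ C ε, 0 < ε ∧ ∀ z, 0 < z.im → z.im < ε → ‖F z‖ ≤ C

theorem hasPieceBoundary_of_tendsto (hr : D.AdmissibleRadii r) {F Fp : ℂ → ℂ} {F₀ : ℂ} {δ : ℝ}
    {G : D.Disk → ℂ → ℂ} (hδ : 0 < δ) (hc : ContinuousOn F {z | 0 < z.im ∧ z.im < δ})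
    (hpc : ContinuousOn Fp {z | z.im = 0})
    (hlim : ∀ z : ℂ, z.im = 0 → Tendsto F (𝓝[{z | 0 < z.im}] z) (𝓝 (Fp z)))
    (hinf : Tendsto F atInfty (𝓝 F₀))
    (hG : ∀ d, ContinuousOn (G d) (sphere (D.diskCenter d) (D.diskRadius r d)))
    (hGlim : ∀ d, ∀ z ∈ sphere (D.diskCenter d) (D.diskRadius r d),
      Tendsto F (𝓝[ball (D.diskCenter d) (D.diskRadius r d)] z) (𝓝 (G d z))) :
    HasPieceBoundary D r F fun o => match o with
      | none => fun s => Fp s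
      | some d => fun s => G d (D.pieceCurve r (some d) s) := by
  have hmem : ∀ d s, D.pieceCurve r (some d) s ∈ sphere (D.diskCenter d) (D.diskRadius r d) :=
    fun d s => circleMap_mem_sphere _ (diskRadius_pos hr d).le s
  obtain ⟨C, hC1, hC2⟩ := exists_norm_le_of_boundary hδ hc hpc hlim hinf
  choose B hB using fun d => (isCompact_sphere (D.diskCenter d)
    (D.diskRadius r d)).exists_bound_of_continuousOn (hG d)
  refine ⟨fun o => ?_, ⟨max C (∑ d, |B d|), fun o s => ?_⟩, fun s => hlim s (ofReal_im s),
    fun d s => hGlim d _ (hmem d s), C, δ / 2, half_pos hδ, hC1⟩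
  · rcases o with _ | d
    · exact hpc.comp_continuous continuous_ofReal ofReal_im
    · exact (hG d).comp_continuous (continuous_circleMap _ _) (hmem d)
  · rcases o with _ | d
    · exact (hC2 s).trans (le_max_left _ _)
    · refine ((hB d _ (hmem d s)).trans ((le_abs_self _).trans ?_)).trans (le_max_right _ _)
      exact Finset.single_le_sum (f := fun d => |B d|) (fun d _ => abs_nonneg _)
        (Finset.mem_univ d)

variable (D r) in
/-- The Cauchy integral of `a` times the weight and the phase over a piece of the contour. -/
noncomputable def pieceCauchy (x t : ℝ) (j : Fin n) (o : Option D.Disk) (a : ℝ → ℂ) (z : ℂ) : ℂ :=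
  ∫ s, a s * D.pieceWeight r j o s * exp (2 * I * theta x t (D.pieceCurve r o s))
    / (D.pieceCurve r o s - z) ∂D.pieceMeasure o

theorem pieceCauchy_disk (x t : ℝ) (j : Fin n) (d : D.Disk) (g : ℂ → ℂ) (z : ℂ) :
    D.pieceCauchy r x t j (some d) (fun s => g (D.pieceCurve r (some d) s)) z
      = ∮ s in C(D.diskCenter d, D.diskRadius r d), g s * D.jumpWeight x t j d s / (s - z) := by
  rw [circleIntegral, intervalIntegral.integral_of_le Real.two_pi_pos.le]
  simp only [pieceCauchy, pieceMeasure, pieceCurve, pieceWeight, deriv_circleMap, smul_eq_mul,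
    jumpWeight]
  congr 1
  ext s
  ring

theorem integrable_pieceCauchy (hr : D.AdmissibleRadii r) (x t : ℝ) (j : Fin n)
    (o : Option D.Disk) {a : ℝ → ℂ} {C : ℝ} (ha : Continuous a) (hC : ∀ s, ‖a s‖ ≤ C) {z : ℂ}
    (hz : z ∉ D.contour r) :
    Integrable (fun s => a s * D.pieceWeight r j o s
      * exp (2 * I * theta x t (D.pieceCurve r o s)) / (D.pieceCurve r o s - z))
      (D.pieceMeasure o) := by
  rw [contour_eq, Set.mem_union, not_or, mem_iUnion, not_exists] at hz
  have h1 := ((hasExpMoments_piece hr j o).mul_bounded ha hC).integrable_integrand 0 x t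
  simp only [pow_zero, one_mul] at h1
  have hcont := (hasExpMoments_piece hr j o).continuous_curve
  have key : (∀ s, D.pieceCurve r o s - z ≠ 0)
      ∧ ∃ B, ∀ s, ‖(D.pieceCurve r o s - z)⁻¹‖ ≤ B := by
    rcases o with _ | d
    · have hne : ∀ s : ℝ, |z.im| ≤ ‖(s : ℂ) - z‖ := fun s => by
        have := abs_im_le_norm ((s : ℂ) - z)
        rwa [sub_im, ofReal_im, zero_sub, abs_neg] at this
      have hz0 : 0 < |z.im| := abs_pos.2 hz.1
      refine ⟨fun s => norm_pos_iff.1 (hz0.trans_le (hne s)), |z.im|⁻¹, fun s => ?_⟩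
      rw [norm_inv]
      exact inv_anti₀ hz0 (hne s)
    · have hmem : ∀ s, D.pieceCurve r (some d) s ∈ sphere (D.diskCenter d) (D.diskRadius r d) :=
        fun s => circleMap_mem_sphere _ (diskRadius_pos hr d).le s
      have hne : ∀ s ∈ sphere (D.diskCenter d) (D.diskRadius r d), s - z ≠ 0 := fun s hs h0 =>
        hz.2 (Sum.inl d) ((sub_eq_zero.1 h0) ▸ hs)
      obtain ⟨B, hB⟩ := (isCompact_sphere (D.diskCenter d)
        (D.diskRadius r d)).exists_bound_of_continuousOn
        (ContinuousOn.inv₀ (f := fun s => s - z) (by fun_prop) hne)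
      exact ⟨fun s => hne _ (hmem s), B, fun s => hB _ (hmem s)⟩
  obtain ⟨hne, B, hB⟩ := key
  simp only [div_eq_mul_inv]
  exact h1.mul_bdd (Continuous.aestronglyMeasurable (Continuous.inv₀ (by fun_prop) hne))
    (Eventually.of_forall hB)

theorem conj_mem_sphere {z c : ℂ} {ρ : ℝ} : conj z ∈ sphere (conj c) ρ ↔ z ∈ sphere c ρ := by
  rw [mem_sphere, mem_sphere, Complex.dist_conj_conj]

theorem conj_mem_contour {z : ℂ} : conj z ∈ D.contour r ↔ z ∈ D.contour r := by
  have key : ∀ z : ℂ, z ∈ D.contour r → conj z ∈ D.contour r := fun z hz => by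
    rw [contour_eq] at hz ⊢
    rcases hz with hz | hz
    · exact Or.inl (by simpa using hz)
    · obtain ⟨k, hk⟩ := mem_iUnion.1 hz
      refine Or.inr (mem_iUnion.2 ?_)
      rcases k with d | d
      · exact ⟨Sum.inr d, conj_mem_sphere.2 hk⟩
      · refine ⟨Sum.inl d, conj_mem_sphere.1 ?_⟩
        rwa [Complex.conj_conj]
  exact ⟨fun h => by simpa using key _ h, key z⟩

theorem exists_strip (hr : D.AdmissibleRadii r) :
    ∃ δ, 0 < δ ∧ ∀ z : ℂ, z.im ≠ 0 → |z.im| < δ → z ∉ D.contour r := by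
  have h1 : ∀ᶠ δ in 𝓝[>] (0 : ℝ), ∀ k, δ < |(D.circleCenter k).im| - D.circleRadius r k :=
    eventually_all.2 fun k => by
      filter_upwards [Ioo_mem_nhdsGT (sub_pos.2 (circleRadius_lt_abs_im hr k))] with δ hδ
      exact hδ.2
  obtain ⟨δ, hδ, hδ0⟩ := (h1.and self_mem_nhdsWithin).exists
  refine ⟨δ, hδ0, fun z hz hzδ => ?_⟩
  rw [contour_eq, Set.mem_union, not_or, mem_iUnion, not_exists]
  refine ⟨hz, fun k hk => ?_⟩
  rw [mem_sphere, Complex.dist_eq] at hk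
  have h2 := (abs_im_le_norm (z - D.circleCenter k)).trans hk.le
  have h3 := abs_sub_abs_le_abs_sub (D.circleCenter k).im z.im
  rw [sub_im, abs_sub_comm] at h2
  linarith [hδ k]

theorem tendsto_conj_within {U V : Set ℂ} (h : ∀ z ∈ U, conj z ∈ V) (z : ℂ) :
    Tendsto (fun w : ℂ => conj w) (𝓝[U] z) (𝓝[V] (conj z)) :=
  tendsto_nhdsWithin_iff.2 ⟨(continuous_conj.tendsto z).mono_left nhdsWithin_le_nhds, by
    filter_upwards [self_mem_nhdsWithin] with w hw using h w hw⟩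

theorem tendsto_conj_atInfty : Tendsto (fun w : ℂ => conj w) atInfty atInfty := by
  refine tendsto_inf.2 ⟨?_, tendsto_principal.2 ?_⟩
  · refine (tendsto_norm_atTop_iff_cobounded.1 ?_).mono_left inf_le_left
    simpa using tendsto_norm_cobounded_atTop (E := ℂ)
  · filter_upwards [mem_inf_of_right (mem_principal_self _)] with w hw
    simpa using hw

variable {x t : ℝ} {M : ℂ → BlockMat n}

theorem tendsto_entry {l : Filter ℂ} {B : BlockMat n} (h : Tendsto M l (𝓝 B)) (a b : Unit ⊕ Fin n) :
    Tendsto (fun z => M z a b) l (𝓝 (B a b)) :=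
  ((continuous_id.matrix_elem a b).tendsto B).comp h

/-- Conjugation together with `z ↦ conj z` moves the jumps of the last `n` entries of the row to the
upper circles. Then both kinds of entries are Cauchy integrals over the same pieces, with the same
weights and the same phase, and each kind is determined by boundary values of the other: `a` from
above and inside, `b` likewise for the conjugated first entry. The first entry has no constant term
because it is off-diagonal. -/
theorem exists_cauchy_representation (hr : D.AdmissibleRadii r) (h : IsRHSolution D r x t M)
    (i : Fin n) :
    ∃ (a : Fin n → Option D.Disk → ℝ → ℂ) (b : Option D.Disk → ℝ → ℂ),
      (∀ j, HasPieceBoundary D r (fun z => M z (Sum.inr i) (Sum.inr j)) (a j)) ∧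
      HasPieceBoundary D r (fun z => conj (M (conj z) (Sum.inr i) (Sum.inl ()))) b ∧
      (∀ z ∉ D.contour r, M z (Sum.inr i) (Sum.inl ())
        = -((2 * Real.pi * I)⁻¹ * ∑ j, ∑ o, D.pieceCauchy r x t j o (a j o) z)) ∧
      ∀ z ∉ D.contour r, ∀ j, conj (M (conj z) (Sum.inr i) (Sum.inr j))
        = (1 : BlockMat n) (Sum.inr i) (Sum.inr j)
          + (2 * Real.pi * I)⁻¹ * ∑ o, D.pieceCauchy r x t j o (b o) z := by
  choose Ui Uo hUi hUo hU using exists_jump_upper h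
  choose Li Lo hLi hLo hL using exists_jump_lower h
  obtain ⟨Bp, Bm, hBp, hBm, hB, hj⟩ := exists_jump_line h
  obtain ⟨δ, hδ, hstrip⟩ := exists_strip hr
  have hent : ∀ {B : ℂ → BlockMat n} {S : Set ℂ} (a b : Unit ⊕ Fin n), ContinuousOn B S →
      ContinuousOn (fun z => B z a b) S := fun a b hB =>
    (continuous_id.matrix_elem a b).comp_continuousOn hB
  have hMc : ∀ a b, ContinuousOn (fun z => M z a b) (D.contour r)ᶜ := fun a b =>
    (h.analytic a b).continuousOn
  set a : Fin n → Option D.Disk → ℝ → ℂ := fun j o => match o with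
      | none => fun s => Bp s (Sum.inr i) (Sum.inr j)
      | some d => fun s => Ui d (D.pieceCurve r (some d) s) (Sum.inr i) (Sum.inr j) with ha_def
  set b : Option D.Disk → ℝ → ℂ := fun o => match o with
      | none => fun s => conj (Bm (conj (s : ℂ)) (Sum.inr i) (Sum.inl ()))
      | some d => fun s => conj (Li d (conj (D.pieceCurve r (some d) s)) (Sum.inr i) (Sum.inl ()))
    with hb_def
  have ha : ∀ j, HasPieceBoundary D r (fun z => M z (Sum.inr i) (Sum.inr j)) (a j) := fun j =>
    hasPieceBoundary_of_tendsto hr (Fp := fun z => Bp z (Sum.inr i) (Sum.inr j))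
      (G := fun d z => Ui d z (Sum.inr i) (Sum.inr j)) hδ
      ((hMc _ _).mono fun z hz => hstrip z hz.1.ne' (by rw [abs_of_pos hz.1]; exact hz.2))
      (hent _ _ hBp) (fun z hz => tendsto_entry (hB z hz).1 _ _)
      (tendsto_entry h.normalization _ _) (fun d => hent _ _ (hUi d))
      fun d z hz => tendsto_entry (hU d z hz).1 _ _
  have hsph : ∀ (d : D.Disk), ∀ z ∈ sphere (D.diskCenter d) (D.diskRadius r d),
      conj z ∈ sphere (conj (D.diskCenter d)) (D.diskRadius r d) := fun d z hz =>
    conj_mem_sphere.2 hz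
  have hb : HasPieceBoundary D r (fun z => conj (M (conj z) (Sum.inr i) (Sum.inl ()))) b := by
    refine hasPieceBoundary_of_tendsto hr
      (Fp := fun z => conj (Bm (conj z) (Sum.inr i) (Sum.inl ())))
      (G := fun d z => conj (Li d (conj z) (Sum.inr i) (Sum.inl ())))
      (F₀ := conj ((1 : BlockMat n) (Sum.inr i) (Sum.inl ()))) hδ ?_ ?_ ?_ ?_ ?_ ?_
    · refine continuous_conj.comp_continuousOn
        (((hMc (Sum.inr i) (Sum.inl ())).comp (g := fun z => M z _ _) (f := fun z : ℂ => conj z)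
          continuous_conj.continuousOn fun z hz => ?_))
      refine hstrip _ (by simpa using hz.1.ne') ?_
      rw [conj_im, abs_neg, abs_of_pos hz.1]
      exact hz.2
    · exact continuous_conj.comp_continuousOn
        ((hent (Sum.inr i) (Sum.inl ()) hBm).comp (g := fun z => Bm z _ _)
          (f := fun z : ℂ => conj z) continuous_conj.continuousOn fun z hz => by simpa using hz)
    · intro z hz
      have hz' : (conj z).im = 0 := by simpa using hz
      exact (continuous_conj.tendsto _).comp ((tendsto_entry (hB _ hz').2 _ _).comp
        (tendsto_conj_within (fun w hw => by simpa using hw) z))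
    · exact (continuous_conj.tendsto _).comp
        ((tendsto_entry h.normalization _ _).comp tendsto_conj_atInfty)
    · exact fun d => continuous_conj.comp_continuousOn
        ((hent (Sum.inr i) (Sum.inl ()) (hLi d)).comp (g := fun z => Li d z _ _)
          (f := fun z : ℂ => conj z) continuous_conj.continuousOn (hsph d))
    · intro d z hz
      exact (continuous_conj.tendsto _).comp ((tendsto_entry (hL d _ (hsph d z hz)).1 _ _).comp
        (tendsto_conj_within (fun w hw => by simpa [Complex.dist_conj_conj] using hw) z))
  have hmom : ∀ (j : Fin n) (c : Option D.Disk → ℝ → ℂ) (F : ℂ → ℂ), HasPieceBoundary D r F c →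
      Integrable fun s : ℝ => c none s * (conj (D.γ s j) * exp (2 * I * theta x t s)) :=
    fun j c F hc => by
      obtain ⟨C, hC⟩ := hc.bounded
      have := ((hasExpMoments_piece hr j none).mul_bounded (hc.continuous none)
        (hC none)).integrable_integrand 0 x t
      simpa [mul_assoc, pieceCurve, pieceWeight, pieceMeasure] using this
  -- the circles
  set Ci : D.Disk ⊕ D.Disk → ℂ → BlockMat n := Sum.elim Ui Li with hCi
  set Co : D.Disk ⊕ D.Disk → ℂ → BlockMat n := Sum.elim Uo Lo with hCo
  have hrep : ∀ b' : Unit ⊕ Fin n,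
      Integrable (fun s : ℝ => Bp s (Sum.inr i) b' - Bm s (Sum.inr i) b') →
      ∀ z ∉ D.contour r, M z (Sum.inr i) b' = (1 : BlockMat n) (Sum.inr i) b'
        + (2 * Real.pi * I)⁻¹ * (∫ s : ℝ, (Bp s (Sum.inr i) b' - Bm s (Sum.inr i) b') / (s - z))
        + ∑ k, cauchyCircle (fun s => Ci k s (Sum.inr i) b' - Co k s (Sum.inr i) b')
          (D.circleCenter k) (D.circleRadius r k) z := fun b' hint z hz =>
    eq_add_integral_line_add_sum_cauchyCircle (circleRadius_pos hr) (circleRadius_lt_abs_im hr)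
      (pairwise_disjoint_circles hr) (h := fun z => M z (Sum.inr i) b')
      (hp := fun z => Bp z (Sum.inr i) b') (hm := fun z => Bm z (Sum.inr i) b')
      (hin := fun k z => Ci k z (Sum.inr i) b') (hout := fun k z => Co k z (Sum.inr i) b')
      (contour_eq (r := r) ▸ h.analytic _ _) (tendsto_entry h.normalization _ _)
      (hent _ _ hBp) (hent _ _ hBm) (fun z hz => tendsto_entry (hB z hz).1 _ _)
      (fun z hz => tendsto_entry (hB z hz).2 _ _) hint
      (fun k => by rcases k with d | d; exacts [hent _ _ (hUi d), hent _ _ (hLi d)])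
      (fun k => by rcases k with d | d; exacts [hent _ _ (hUo d), hent _ _ (hLo d)])
      (fun k z hz => by
        rcases k with d | d
        exacts [tendsto_entry (hU d z hz).1 _ _, tendsto_entry (hL d z hz).1 _ _])
      (fun k z hz => by
        rcases k with d | d
        exacts [tendsto_entry (hU d z hz).2.1 _ _, tendsto_entry (hL d z hz).2.1 _ _])
      (contour_eq (r := r) ▸ hz)
  have hzero : ∀ (g : ℂ → ℂ) (c : ℂ) (ρ : ℝ) (z : ℂ), 0 ≤ ρ → (∀ s ∈ sphere c ρ, g s = 0) →
      cauchyCircle g c ρ z = 0 := fun g c ρ z hρ hg => by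
    rw [cauchyCircle, circleIntegral.integral_congr (g := fun _ => (0 : ℂ)) hρ fun s hs => by
      simp [hg s hs]]
    simp [circleIntegral]
  have hint : ∀ (F : ℂ → ℂ) (c : Option D.Disk → ℝ → ℂ), HasPieceBoundary D r F c →
      ∀ z ∉ D.contour r, ∀ j o, Integrable (fun s => c o s * D.pieceWeight r j o s
        * exp (2 * I * theta x t (D.pieceCurve r o s)) / (D.pieceCurve r o s - z))
        (D.pieceMeasure o) := fun F c hc z hz j o => by
    obtain ⟨C, hC⟩ := hc.bounded
    exact integrable_pieceCauchy hr x t j o (hc.continuous o) (hC o) hz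
  have hlineI : ∀ (c : Option D.Disk → ℝ → ℂ) (j : Fin n) (z : ℂ),
      D.pieceCauchy r x t j none (c none) z
        = ∫ s : ℝ, c none s * (conj (D.γ s j) * exp (2 * I * theta x t s)) / (s - z) :=
    fun c j z => by
      simp only [pieceCauchy, pieceMeasure, pieceCurve, pieceWeight, mul_assoc]
  refine ⟨a, b, ha, hb, fun z hz => ?_, fun z hz j => ?_⟩
  · rw [hrep (Sum.inl ()) ?_ z hz]
    · have e1 : (∫ s : ℝ, (Bp s (Sum.inr i) (Sum.inl ()) - Bm s (Sum.inr i) (Sum.inl ())) / (s - z))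
          = -∑ j, D.pieceCauchy r x t j none (a j none) z := by
        simp_rw [hlineI (a _) _ z]
        rw [← integral_finsetSum _ fun j _ => ?_, ← integral_neg]
        · congr 1
          ext s
          rw [(hj s (Sum.inr i)).1, neg_div, Finset.sum_div]
        · have := hint _ _ (ha j) z hz j none
          simpa only [pieceMeasure, pieceCurve, pieceWeight, mul_assoc] using this
      have e2 : ∀ d, cauchyCircle (fun s => Ci (Sum.inl d) s (Sum.inr i) (Sum.inl ())
          - Co (Sum.inl d) s (Sum.inr i) (Sum.inl ())) (D.circleCenter (Sum.inl d))
          (D.circleRadius r (Sum.inl d)) z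
          = -((2 * Real.pi * I)⁻¹ * ∑ j, D.pieceCauchy r x t j (some d) (a j (some d)) z) :=
        fun d => by
          have hne : ∀ s ∈ sphere (D.diskCenter d) (D.diskRadius r d), s - z ≠ 0 := fun s hs h0 => by
            rw [contour_eq] at hz
            exact hz (Or.inr (mem_iUnion.2 ⟨Sum.inl d, (sub_eq_zero.1 h0) ▸ hs⟩))
          have hw : ∀ j, ContinuousOn (fun s => D.jumpWeight x t j d s)
              (sphere (D.diskCenter d) (D.diskRadius r d)) := fun j =>
            (continuousOn_diskWeight hr j d).mul
              (continuous_const.mul (continuous_theta x t)).cexp.continuousOn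
          have e3 : ∀ j, D.pieceCauchy r x t j (some d) (a j (some d)) z
              = ∮ s in C(D.diskCenter d, D.diskRadius r d),
                Ui d s (Sum.inr i) (Sum.inr j) * D.jumpWeight x t j d s / (s - z) := fun j =>
            pieceCauchy_disk x t j d (fun s => Ui d s (Sum.inr i) (Sum.inr j)) z
          simp_rw [e3]
          have hci : ∀ j ∈ Finset.univ, CircleIntegrable (fun s => Ui d s (Sum.inr i) (Sum.inr j)
              * D.jumpWeight x t j d s / (s - z)) (D.diskCenter d) (D.diskRadius r d) := fun j _ =>
            ContinuousOn.circleIntegrable (diskRadius_pos hr d).le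
              (((hent (Sum.inr i) (Sum.inr j) (hUi d)).mul (hw j)).div (by fun_prop) hne)
          rw [← circleIntegral.integral_fun_sum hci, ← mul_neg, cauchyCircle]
          congr 1
          rw [neg_eq_neg_one_mul, ← circleIntegral.integral_const_mul]
          refine circleIntegral.integral_congr (diskRadius_pos hr d).le fun s hs => ?_
          have h1 := (hU d s hs).2.2 (Sum.inr i)
          simp only [hCi, hCo, Sum.elim_inl, h1.1, h1.2, ← Finset.sum_div]
          ring
      -- The lower circles drop out, since the first column is continuous across them.
      rw [e1, Fintype.sum_sum_type, Finset.sum_congr rfl fun d _ => e2 d,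
        Finset.sum_eq_zero fun d _ => hzero _ (D.circleCenter (Sum.inr d)) _ z
          (circleRadius_pos hr _).le fun s hs => ?_]
      · simp only [Fintype.sum_option, Finset.sum_add_distrib, Finset.sum_neg_distrib,
          ← Finset.mul_sum]
        rw [Finset.sum_comm]
        simp only [Matrix.one_apply, reduceCtorEq, if_false]
        ring
      · have h1 := ((hL d s hs).2.2 (Sum.inr i)).1
        simp only [hCi, hCo, Sum.elim_inr, h1, sub_self]
    · simp only [(hj _ _).1]
      exact (integrable_finsetSum _ fun j _ => hmom j (a j) _ (ha j)).neg
  · have hconj : ∀ s : ℝ, conj (Bp s (Sum.inr i) (Sum.inr j) - Bm s (Sum.inr i) (Sum.inr j))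
        = -(b none s * (conj (D.γ s j) * exp (2 * I * theta x t s))) := fun s => by
      rw [((hj s (Sum.inr i)).2 j), map_neg, map_mul, Complex.conj_conj]
      simp only [hb_def, conj_ofReal]
    have hpi : conj ((2 * Real.pi * I : ℂ)⁻¹) = -(2 * Real.pi * I)⁻¹ := by
      rw [map_inv₀, map_mul, map_mul, conj_I, conj_ofReal, map_ofNat, mul_neg, inv_neg]
    rw [hrep (Sum.inr j) ?_ (conj z) (by rwa [conj_mem_contour])]
    · have e1 : conj (∫ s : ℝ, (Bp s (Sum.inr i) (Sum.inr j) - Bm s (Sum.inr i) (Sum.inr j))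
          / (s - conj z)) = -D.pieceCauchy r x t j none (b none) z := by
        rw [hlineI b j z, ← integral_conj, ← integral_neg]
        congr 1
        ext s
        rw [map_div₀, hconj, map_sub, conj_ofReal, Complex.conj_conj, neg_div]
      have e2 : ∀ d, conj (cauchyCircle (fun s => Ci (Sum.inr d) s (Sum.inr i) (Sum.inr j)
          - Co (Sum.inr d) s (Sum.inr i) (Sum.inr j)) (D.circleCenter (Sum.inr d))
          (D.circleRadius r (Sum.inr d)) (conj z))
          = (2 * Real.pi * I)⁻¹ * D.pieceCauchy r x t j (some d) (b (some d)) z :=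
        fun d => by
          have e3 : D.pieceCauchy r x t j (some d) (b (some d)) z
              = ∮ s in C(D.diskCenter d, D.diskRadius r d),
                conj (Li d (conj s) (Sum.inr i) (Sum.inl ())) * D.jumpWeight x t j d s / (s - z) :=
            pieceCauchy_disk x t j d (fun s => conj (Li d (conj s) (Sum.inr i) (Sum.inl ()))) z
          rw [cauchyCircle, map_mul, hpi, e3]
          change _ * conj (∮ s in C(conj (D.diskCenter d), D.diskRadius r d), _) = _
          rw [conj_circleIntegral_conj, neg_mul_neg]
          congr 1
          refine circleIntegral.integral_congr (diskRadius_pos hr d).le fun s hs => ?_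
          have h1 := ((hL d _ (hsph d s hs)).2.2 (Sum.inr i)).2 j
          simp only [hCi, hCo, Sum.elim_inr, h1, add_sub_cancel_left, map_div₀, map_mul, map_sub,
            Complex.conj_conj]
      rw [map_add, map_add, map_mul, e1, hpi, map_sum, Fintype.sum_sum_type,
        Finset.sum_congr rfl fun d _ => e2 d,
        Finset.sum_eq_zero (s := Finset.univ) (f := fun d => conj (cauchyCircle
          (fun s => Ci (Sum.inl d) s (Sum.inr i) (Sum.inr j)
            - Co (Sum.inl d) s (Sum.inr i) (Sum.inr j)) (D.circleCenter (Sum.inl d))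
          (D.circleRadius r (Sum.inl d)) (conj z))) fun d _ => ?_]
      · simp only [Fintype.sum_option, ← Finset.mul_sum, Matrix.one_apply]
        rw [apply_ite conj, map_one, map_zero]
        ring
      · rw [hzero _ _ _ _ (circleRadius_pos hr _).le fun s hs => ?_, map_zero]
        have h1 := ((hU d s hs).2.2 (Sum.inr i)).2 j
        simp only [hCi, hCo, Sum.elim_inl, h1, sub_self]
    · have h1 := (conjCLE : ℂ →L[ℝ] ℂ).integrable_comp (hmom j b _ hb).neg
      refine h1.congr (Eventually.of_forall fun s => ?_)
      have h2 := congrArg conj (hconj s)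
      rw [Complex.conj_conj] at h2
      exact h2.symm

end ScatteringData

end VmKdV

/-! ### Boundary values as Laplace transforms and the resulting flows -/

namespace VmKdV

open MeasureTheory Filter Set

open Complex

/-- On curves in the closed upper half-plane, moving `x` to the right only damps the integrand. This
gives boundedness when the weight contains boundary values about which nothing else is known. -/
theorem norm_expIntegral_add_le {μ : Measure ℝ} {σ w : ℝ → ℂ} (h : HasExpMoments μ σ w)
    (him : ∀ s, 0 ≤ (σ s).im) (k : ℕ) (x t : ℝ) {ξ : ℝ} (hξ : 0 ≤ ξ) :
    ‖expIntegral μ σ w k (x + ξ) t‖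
      ≤ ∫ s, ‖(2 * I * σ s) ^ k * w s * exp (2 * I * theta x t (σ s))‖ ∂μ := by
  refine norm_integral_le_of_norm_le (h.integrable_integrand k x t).norm
    (Eventually.of_forall fun s => ?_)
  rw [exp_theta_add, ← mul_assoc, norm_mul]
  exact mul_le_of_le_one_right (norm_nonneg _) (norm_exp_two_I_mul_le (him s) hξ)

/-- For `ξ, ζ ≥ 0` the sum dominates each term, so the two powers of decay can be distributed over
the two variables. -/
theorem AiryFlow.exists_norm_add_le {E : Type*} [NormedAddCommGroup E] [NormedSpace ℝ E]
    {f : ℕ → ℝ → ℝ → E} (hf : AiryFlow 2 f) (k : ℕ) (x t : ℝ) :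
    ∃ C, 0 ≤ C ∧ ∀ ξ ζ, 0 ≤ ξ → 0 ≤ ζ →
      ‖f k (x + ξ + ζ) t‖ ≤ C * ((1 + ξ ^ 2)⁻¹ * (1 + ζ ^ 2)⁻¹) := by
  obtain ⟨C, hC⟩ := hf.decay k |x| |t|
  have hC0 : 0 ≤ C := by
    have := (norm_nonneg _).trans (hC 0 t (by simp) le_rfl)
    simpa using this
  refine ⟨C * (2 * (1 + |x| ^ 2)) ^ 2, by positivity, fun ξ ζ hξ hζ => ?_⟩
  have h1 := hC (x + ξ + ζ) t (by linarith [neg_abs_le x]) le_rfl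
  have h2 := inv_one_add_add_sq_le (le_refl |x|) (ξ + ζ)
  have h3 : (1 + (ξ + ζ) ^ 2)⁻¹ ≤ (1 + ξ ^ 2)⁻¹ := inv_anti₀ (by positivity) (by nlinarith)
  have h4 : (1 + (ξ + ζ) ^ 2)⁻¹ ≤ (1 + ζ ^ 2)⁻¹ := inv_anti₀ (by positivity) (by nlinarith)
  rw [← add_assoc] at h2
  refine h1.trans ?_
  calc C * ((1 + (x + ξ + ζ) ^ 2) ^ 2)⁻¹ = C * ((1 + (x + ξ + ζ) ^ 2)⁻¹ ^ 2) := by rw [inv_pow]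
    _ ≤ C * (2 * (1 + |x| ^ 2) * (1 + (ξ + ζ) ^ 2)⁻¹) ^ 2 := by gcongr
    _ = C * (2 * (1 + |x| ^ 2)) ^ 2 * ((1 + (ξ + ζ) ^ 2)⁻¹ * (1 + (ξ + ζ) ^ 2)⁻¹) := by ring
    _ ≤ _ := by gcongr

theorem norm_mul_exp_le {β : ℝ → ℂ} {B δ₀ : ℝ} (hB : ∀ ζ, 0 < ζ → ‖β ζ‖ ≤ B)
    {z : ℂ} (hz : δ₀ ≤ z.im) {ζ : ℝ} (hζ : 0 < ζ) :
    ‖β ζ * exp (2 * I * z * ζ)‖ ≤ B * Real.exp (-(2 * δ₀) * ζ) := by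
  rw [norm_mul, norm_exp_two_I_mul]
  refine mul_le_mul (hB ζ hζ) (Real.exp_le_exp.2 ?_) (Real.exp_pos _).le
    ((norm_nonneg _).trans (hB ζ hζ))
  nlinarith

theorem norm_laplaceAdd_le {δ : ℂ} {β : ℝ → ℂ} {B δ₀ : ℝ} (hB : ∀ ζ, 0 < ζ → ‖β ζ‖ ≤ B)
    (hδ₀ : 0 < δ₀) {z : ℂ} (hz : δ₀ ≤ z.im) :
    ‖laplaceAdd δ β z‖ ≤ ‖δ‖ + ∫ ζ in Ioi (0 : ℝ), B * Real.exp (-(2 * δ₀) * ζ) := by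
  refine (norm_add_le _ _).trans (add_le_add le_rfl ?_)
  refine norm_integral_le_of_norm_le ((integrableOn_exp_neg_mul hδ₀).const_mul B) ?_
  filter_upwards [ae_restrict_mem measurableSet_Ioi] with ζ hζ using norm_mul_exp_le hB hz hζ

theorem continuousAt_laplaceAdd {δ : ℂ} {β : ℝ → ℂ} {B : ℝ} (hβ : Continuous β)
    (hB : ∀ ζ, 0 < ζ → ‖β ζ‖ ≤ B) {z : ℂ} (hz : 0 < z.im) :
    ContinuousAt (laplaceAdd δ β) z := by
  refine continuousAt_const.add ?_
  refine continuousAt_of_dominated (bound := fun ζ => B * Real.exp (-(2 * (z.im / 2)) * ζ))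
    (Eventually.of_forall fun w => Continuous.aestronglyMeasurable (by fun_prop)) ?_
    ((integrableOn_exp_neg_mul (half_pos hz)).const_mul B)
    (Eventually.of_forall fun ζ => by fun_prop)
  filter_upwards [Complex.continuous_im.continuousAt.eventually_const_lt (half_lt_self hz)]
    with w hw
  filter_upwards [ae_restrict_mem measurableSet_Ioi] with ζ hζ using norm_mul_exp_le hB hw.le hζ

theorem integrableOn_mul_exp {β : ℝ → ℂ} {B : ℝ} (hβ : Continuous β)
    (hB : ∀ ζ, 0 < ζ → ‖β ζ‖ ≤ B) {z : ℂ} (hz : 0 < z.im) :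
    IntegrableOn (fun ζ : ℝ => β ζ * exp (2 * I * z * ζ)) (Ioi 0) := by
  refine ((integrableOn_exp_neg_mul hz).const_mul B).mono'
    (Continuous.aestronglyMeasurable (by fun_prop)) ?_
  filter_upwards [ae_restrict_mem measurableSet_Ioi] with ζ hζ using norm_mul_exp_le hB le_rfl hζ

theorem conj_laplace (β : ℝ → ℂ) (w : ℂ) :
    conj (∫ ξ : ℝ in Ioi 0, β ξ * exp (2 * I * -conj w * ξ))
      = ∫ ξ : ℝ in Ioi 0, conj (β ξ) * exp (2 * I * w * ξ) := by
  rw [← integral_conj]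
  congr 1
  ext ξ
  rw [map_mul, ← exp_conj]
  simp [map_ofNat]

theorem AiryFlow.integrableOn_mul {β : ℝ → ℂ} {B : ℝ}
    (hβ : Continuous β) (hB : ∀ ζ, 0 < ζ → ‖β ζ‖ ≤ B) {f : ℕ → ℝ → ℝ → ℂ} (hf : AiryFlow 2 f) (k : ℕ) (y t : ℝ) : IntegrableOn (fun ζ => β ζ * f k (y + ζ) t) (Ioi 0) := by
  obtain ⟨K, hK0, hK⟩ := hf.exists_norm_add_le k y t
  refine ((integrable_inv_one_add_sq.const_mul K).const_mul B).integrableOn.mono'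
    (hβ.mul ((hf.continuous_left k t).comp
      (continuous_const.add continuous_id))).aestronglyMeasurable ?_
  filter_upwards [ae_restrict_mem measurableSet_Ioi] with ζ hζ
  have h1 := hK 0 ζ le_rfl (le_of_lt hζ)
  rw [add_zero] at h1
  rw [norm_mul]
  exact mul_le_mul (hB ζ hζ) (by simpa using h1) (norm_nonneg _)
    ((norm_nonneg _).trans (hB ζ hζ))

namespace ScatteringData

variable {n : ℕ} {D : ScatteringData n} {r : Fin D.N → ℝ}

open Metric

instance (o : Option D.Disk) : SFinite (D.pieceMeasure o) := by
  rcases o with _ | d <;> (unfold pieceMeasure; infer_instance)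

theorem pieceCurve_im_nonneg (hr : D.AdmissibleRadii r) (o : Option D.Disk) (s : ℝ) :
    0 ≤ (D.pieceCurve r o s).im := by
  rcases o with _ | d
  · simp [pieceCurve]
  · obtain ⟨δ, hδ, h⟩ := exists_im_pieceCurve_ge hr d
    exact hδ.le.trans (h s)

theorem notMem_contour_of_mem_ball (hr : D.AdmissibleRadii r) (d : D.Disk) {z : ℂ}
    (hz : z ∈ ball (D.diskCenter d) (D.diskRadius r d)) : 0 < z.im ∧ z ∉ D.contour r := by
  have hz' : ‖z - D.diskCenter d‖ < D.diskRadius r d := by rwa [← Complex.dist_eq]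
  have him : 0 < z.im := by
    have h1 := (abs_le.1 ((abs_im_le_norm _).trans hz'.le)).1
    rw [sub_im] at h1
    linarith [diskRadius_lt_im hr d]
  refine ⟨him, ?_⟩
  rw [contour_eq, Set.mem_union, not_or, mem_iUnion, not_exists]
  refine ⟨him.ne', fun k hk => ?_⟩
  by_cases hkd : k = Sum.inl d
  · subst hkd
    exact (ne_of_lt (mem_ball.1 hz)) (mem_sphere.1 hk)
  · exact Set.disjoint_left.1 (pairwise_disjoint_circles hr hkd) (sphere_subset_closedBall hk)
      (ball_subset_closedBall hz)

/-- Under the Laplace representation of `F`, the boundary values of `F` are radial limits along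
the pieces of the contour. -/
theorem expIntegral_boundary_mul_eq (hr : D.AdmissibleRadii r) {F : ℂ → ℂ}
    {a : Option D.Disk → ℝ → ℂ} (ha : HasPieceBoundary D r F a) {δ : ℂ} {β : ℝ → ℂ} {B : ℝ}
    (hβ : Continuous β) (hB : ∀ ζ, 0 < ζ → ‖β ζ‖ ≤ B)
    (hF : ∀ z ∉ D.contour r, 0 < z.im → F z = laplaceAdd δ β z) (j : Fin n) (o : Option D.Disk)
    (k : ℕ) (y t : ℝ) :
    expIntegral (D.pieceMeasure o) (D.pieceCurve r o) (fun s => a o s * D.pieceWeight r j o s) k y t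
      = δ * expIntegral (D.pieceMeasure o) (D.pieceCurve r o) (D.pieceWeight r j o) k y t
        + ∫ ζ : ℝ in Ioi 0, β ζ
          * expIntegral (D.pieceMeasure o) (D.pieceCurve r o) (D.pieceWeight r j o) k (y + ζ) t := by
  have hmom := hasExpMoments_piece hr j o
  have him := pieceCurve_im_nonneg hr o
  obtain ⟨K, -, hK⟩ := (airyFlow_piece hr j o).exists_norm_add_le k y t
  have hK' : ∀ ζ, 0 < ζ → ‖expIntegral (D.pieceMeasure o) (D.pieceCurve r o) (D.pieceWeight r j o)
      k (y + ζ) t‖ ≤ K * (1 + ζ ^ 2)⁻¹ := fun ζ hζ => by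
    simpa using hK 0 ζ le_rfl hζ.le
  rcases o with _ | d
  · obtain ⟨C, ε₁, hε₁, hC⟩ := ha.bounded_near
    obtain ⟨ε₂, hε₂, hstrip⟩ := exists_strip hr
    have him' : ∀ s ε : ℝ, (D.pieceCurve r none s + ε * I).im = ε := fun s ε => by
      simp [pieceCurve]
    have heq : ∀ s ε : ℝ, 0 < ε → ε < ε₂ → F (D.pieceCurve r none s + ε * I)
        = laplaceAdd δ β (D.pieceCurve r none s + ε * I) := fun s ε h0 h1 =>
      hF _ (hstrip _ (by rw [him']; exact h0.ne') (by rwa [him', abs_of_pos h0]))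
        (by rwa [him'])
    refine expIntegral_mul_eq hmom him hβ hB (lt_min hε₁ hε₂) (C := C) (fun s ε h0 h1 => ?_)
      (fun s => ?_) hK'
    · rw [← heq s ε h0 (h1.trans_le (min_le_right _ _))]
      exact hC _ (by rwa [him']) (by rw [him']; exact h1.trans_le (min_le_left _ _))
    · have h1 : Tendsto (fun ε : ℝ => D.pieceCurve r none s + ε * I) (𝓝[>] 0)
          (𝓝[{z | 0 < z.im}] (s : ℂ)) := by
        refine tendsto_nhdsWithin_iff.2 ⟨?_, ?_⟩
        · have : Continuous fun ε : ℝ => D.pieceCurve r none s + ε * I := by fun_prop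
          have := (this.tendsto 0).mono_left (nhdsWithin_le_nhds (s := Ioi 0))
          simpa [pieceCurve] using this
        · filter_upwards [self_mem_nhdsWithin] with ε hε
          simpa [pieceCurve] using hε
      refine ((ha.line s).comp h1).congr' ?_
      filter_upwards [Ioo_mem_nhdsGT hε₂] with ε hε using heq s ε hε.1 hε.2
  · obtain ⟨δ₀, hδ₀, hge⟩ := exists_im_pieceCurve_ge hr d
    refine expIntegral_mul_eq hmom him hβ hB one_pos (fun s ε h0 _ =>
      norm_laplaceAdd_le (δ₀ := δ₀) hB hδ₀ ?_) (fun s => ?_) hK'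
    · simpa using (hge s).trans (le_add_of_nonneg_right h0.le)
    · have hcont := continuousAt_laplaceAdd (δ := δ) hβ hB (hδ₀.trans_le (hge s))
      have hmem : D.pieceCurve r (some d) s
          ∈ closure (ball (D.diskCenter d) (D.diskRadius r d)) := by
        rw [closure_ball _ (diskRadius_pos hr d).ne']
        exact sphere_subset_closedBall (circleMap_mem_sphere _ (diskRadius_pos hr d).le s)
      have : (𝓝[ball (D.diskCenter d) (D.diskRadius r d)] (D.pieceCurve r (some d) s)).NeBot :=
        mem_closure_iff_nhdsWithin_neBot.1 hmem
      -- The circle lies at positive height, where the Laplace integral converges and is continuous.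
      -- Hence the interior boundary value of `F` is the Laplace integral itself.
      have heq : a (some d) s = laplaceAdd δ β (D.pieceCurve r (some d) s) := by
        refine tendsto_nhds_unique (ha.disk d s)
          ((hcont.tendsto.mono_left nhdsWithin_le_nhds).congr' ?_)
        filter_upwards [self_mem_nhdsWithin] with w hw
        exact (hF w (notMem_contour_of_mem_ball hr d hw).2
          (notMem_contour_of_mem_ball hr d hw).1).symm
      rw [heq]
      have h1 : Continuous fun ε : ℝ => D.pieceCurve r (some d) s + ε * I := by fun_prop
      have h2 : Tendsto (fun ε : ℝ => D.pieceCurve r (some d) s + ε * I) (𝓝[>] 0)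
          (𝓝 (D.pieceCurve r (some d) s)) := by
        simpa using (h1.tendsto 0).mono_left (nhdsWithin_le_nhds (s := Ioi 0))
      exact hcont.tendsto.comp h2

variable (D r) in
/-- The exponential integral over the whole contour in the closed upper half-plane, with an
additional weight `a`. -/
noncomputable def boundaryFlow (j : Fin n) (a : Option D.Disk → ℝ → ℂ) (k : ℕ) (y t : ℝ) : ℂ :=
  ∑ o, expIntegral (D.pieceMeasure o) (D.pieceCurve r o) (fun s => a o s * D.pieceWeight r j o s)
    k y t

section BoundaryFlow

variable {a : Option D.Disk → ℝ → ℂ} {C : ℝ}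

theorem hasExpMoments_boundary (hr : D.AdmissibleRadii r) (ha : ∀ o, Continuous (a o))
    (hC : ∀ o s, ‖a o s‖ ≤ C) (j : Fin n) (o : Option D.Disk) :
    HasExpMoments (D.pieceMeasure o) (D.pieceCurve r o)
      (fun s => a o s * D.pieceWeight r j o s) :=
  (hasExpMoments_piece hr j o).mul_bounded (ha o) (hC o)

theorem hasDerivAt_boundaryFlow (hr : D.AdmissibleRadii r) (ha : ∀ o, Continuous (a o))
    (hC : ∀ o s, ‖a o s‖ ≤ C) (j : Fin n) (k : ℕ) (y t : ℝ) :
    HasDerivAt (fun y => D.boundaryFlow r j a k y t) (D.boundaryFlow r j a (k + 1) y t) y :=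
  HasDerivAt.fun_sum fun o _ => (hasExpMoments_boundary hr ha hC j o).hasDerivAt_space k y t

theorem continuous_boundaryFlow (hr : D.AdmissibleRadii r) (ha : ∀ o, Continuous (a o))
    (hC : ∀ o s, ‖a o s‖ ≤ C) (j : Fin n) (k : ℕ) (t : ℝ) :
    Continuous fun y => D.boundaryFlow r j a k y t :=
  continuous_iff_continuousAt.2 fun y => (hasDerivAt_boundaryFlow hr ha hC j k y t).continuousAt

theorem exists_boundaryFlow_le (hr : D.AdmissibleRadii r) (ha : ∀ o, Continuous (a o))
    (hC : ∀ o s, ‖a o s‖ ≤ C) (j : Fin n) (k : ℕ) (x t : ℝ) :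
    ∃ B, ∀ ξ, 0 ≤ ξ → ‖D.boundaryFlow r j a k (x + ξ) t‖ ≤ B :=
  ⟨_, fun _ hξ => norm_sum_le_of_le _ fun o _ => norm_expIntegral_add_le
    (hasExpMoments_boundary hr ha hC j o) (pieceCurve_im_nonneg hr o) k x t hξ⟩

/-- In the lower half-plane all pieces lie on one side of `z`, so the whole Cauchy sum is a single
Laplace transform, with density `boundaryFlow`. -/
theorem sum_pieceCauchy_eq (hr : D.AdmissibleRadii r) (ha : ∀ o, Continuous (a o))
    (hC : ∀ o s, ‖a o s‖ ≤ C) (j : Fin n) (x t : ℝ) {z : ℂ} (hz : z.im < 0) :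
    ∑ o, D.pieceCauchy r x t j o (a o) z = -2 * I * ∫ ξ : ℝ in Ioi 0,
      D.boundaryFlow r j a 0 (x + ξ) t * exp (2 * I * -z * ξ) := by
  simp only [boundaryFlow, Finset.sum_mul]
  rw [integral_finsetSum _ fun o _ => ?_, Finset.mul_sum]
  · exact Finset.sum_congr rfl fun o _ => integral_div_sub_eq_laplace_expIntegral
      (hasExpMoments_boundary hr ha hC j o) (pieceCurve_im_nonneg hr o) x t hz
  · have hm := hasExpMoments_boundary hr ha hC j o
    have hc : Continuous fun y => expIntegral (D.pieceMeasure o) (D.pieceCurve r o)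
        (fun s => a o s * D.pieceWeight r j o s) 0 y t :=
      continuous_iff_continuousAt.2 fun y => (hm.hasDerivAt_space 0 y t).continuousAt
    exact integrableOn_mul_exp (hc.comp (continuous_const.add continuous_id))
      (fun ζ hζ => norm_expIntegral_add_le hm (pieceCurve_im_nonneg hr o) 0 x t hζ.le)
      (by simpa using hz)

end BoundaryFlow

/-- The passage to the Marchenko equation: unknown boundary values in the weight are exchanged for
the known kernel integrated against the unknown density `β`. -/
theorem boundaryFlow_eq (hr : D.AdmissibleRadii r) {F : ℂ → ℂ}
    {a : Option D.Disk → ℝ → ℂ} (ha : HasPieceBoundary D r F a) {δ : ℂ} {β : ℝ → ℂ} {B : ℝ}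
    (hβ : Continuous β) (hB : ∀ ζ, 0 < ζ → ‖β ζ‖ ≤ B)
    (hF : ∀ z ∉ D.contour r, 0 < z.im → F z = laplaceAdd δ β z) (j : Fin n) (k : ℕ) (y t : ℝ) :
    D.boundaryFlow r j a k y t = δ * D.complexKernel r j k y t
      + ∫ ζ : ℝ in Ioi 0, β ζ * D.complexKernel r j k (y + ζ) t := by
  simp only [boundaryFlow, complexKernel, Finset.mul_sum]
  rw [integral_finsetSum _ fun o _ =>
    (airyFlow_piece hr j o).integrableOn_mul hβ hB k y t,
    ← Finset.sum_add_distrib]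
  exact Finset.sum_congr rfl fun o _ => expIntegral_boundary_mul_eq hr ha hβ hB hF j o k y t

/-- A gain of regularity: boundedness of `β` is enough, because the kernel alone supplies
integrability in `ζ` and decay in `ξ`. -/
theorem exists_boundaryFlow_decay (hr : D.AdmissibleRadii r) {F : ℂ → ℂ}
    {a : Option D.Disk → ℝ → ℂ} (ha : HasPieceBoundary D r F a) {δ : ℂ} {β : ℝ → ℂ} {B : ℝ}
    (hβ : Continuous β) (hB : ∀ ζ, 0 < ζ → ‖β ζ‖ ≤ B)
    (hF : ∀ z ∉ D.contour r, 0 < z.im → F z = laplaceAdd δ β z) (j : Fin n) (k : ℕ) (x t : ℝ) :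
    ∃ C, ∀ ξ, 0 ≤ ξ → ‖D.boundaryFlow r j a k (x + ξ) t‖ ≤ C * (1 + ξ ^ 2)⁻¹ := by
  obtain ⟨K, hK0, hK⟩ := (airyFlow_complexKernel hr j).exists_norm_add_le k x t
  have hB0 : 0 ≤ B := (norm_nonneg _).trans (hB 1 one_pos)
  refine ⟨‖δ‖ * K + B * K * Real.pi, fun ξ hξ => ?_⟩
  rw [boundaryFlow_eq hr ha hβ hB hF, add_mul]
  refine (norm_add_le _ _).trans (add_le_add ?_ ?_)
  · rw [norm_mul, mul_assoc]
    gcongr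
    simpa using hK ξ 0 hξ le_rfl
  · have h1 : ‖∫ ζ : ℝ in Ioi 0, β ζ * D.complexKernel r j k (x + ξ + ζ) t‖
        ≤ ∫ ζ : ℝ in Ioi 0, B * K * (1 + ξ ^ 2)⁻¹ * (1 + ζ ^ 2)⁻¹ := by
      refine norm_integral_le_of_norm_le (integrable_inv_one_add_sq.const_mul _).integrableOn ?_
      filter_upwards [ae_restrict_mem measurableSet_Ioi] with ζ hζ
      rw [norm_mul]
      refine (mul_le_mul (hB ζ hζ) (hK ξ ζ hξ (le_of_lt hζ)) (norm_nonneg _) hB0).trans_eq (by ring)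
    refine h1.trans ?_
    rw [integral_const_mul, mul_right_comm (B * K)]
    refine mul_le_mul_of_nonneg_right (mul_le_mul_of_nonneg_left ?_ (by positivity)) (by positivity)
    rw [← integral_univ_inv_one_add_sq]
    exact setIntegral_le_integral integrable_inv_one_add_sq
      (Eventually.of_forall fun ζ => inv_nonneg.2 (by positivity))

end ScatteringData

end VmKdV

/-! ### The Marchenko equations of a Riemann–Hilbert solution -/

namespace VmKdV

open MeasureTheory Filter Set

open Complex

/-- Peetre's inequality for the weight `(1 + x²)⁻¹`. -/
theorem inv_one_add_sq_mul_le (ξ ζ : ℝ) :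
    (1 + ζ ^ 2)⁻¹ * (1 + (ζ - ξ) ^ 2)⁻¹ ≤ 2 * (1 + ξ ^ 2)⁻¹ := by
  have h1 := one_add_sq_le_mul (-ζ) ξ
  rw [← mul_inv, ← div_eq_mul_inv, inv_eq_one_div, div_le_div_iff₀ (by positivity) (by positivity)]
  nlinarith

namespace ScatteringData

variable {n : ℕ} {D : ScatteringData n} {r : Fin D.N → ℝ}

open Metric

/-- The decay in the backward direction of the contribution of the real line. -/
theorem exists_line_decay (hr : D.AdmissibleRadii r) {F : ℂ → ℂ}
    {a : Option D.Disk → ℝ → ℂ} (ha : HasPieceBoundary D r F a) {δ : ℂ} {β : ℝ → ℂ} {B : ℝ}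
    (hβ : Continuous β) (hB0 : 0 ≤ B) (hB : ∀ ζ, 0 ≤ ζ → ‖β ζ‖ ≤ B * (1 + ζ ^ 2)⁻¹)
    (hF : ∀ z ∉ D.contour r, 0 < z.im → F z = laplaceAdd δ β z) (j : Fin n) (k : ℕ) (x t : ℝ) :
    ∃ C, ∀ ξ, 0 ≤ ξ → ‖expIntegral (D.pieceMeasure none) (D.pieceCurve r none)
      (fun s => a none s * D.pieceWeight r j none s) k (x - ξ) t‖ ≤ C * (1 + ξ ^ 2)⁻¹ := by
  obtain ⟨K, hK⟩ : ∃ C, ∀ x s, |s| ≤ |t| → ‖expIntegral (D.pieceMeasure none) (D.pieceCurve r none)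
      (D.pieceWeight r j none) k x s‖ ≤ C * ((1 + x ^ 2) ^ 2)⁻¹ :=
    exists_expIntegral_schwartz_decay k |t| (D.conjReflection j)
  have hK0 : 0 ≤ K := by
    have := (norm_nonneg _).trans (hK 0 t le_rfl)
    simpa using this
  set A : ℝ := 2 * (1 + |x| ^ 2) with hA
  have hA0 : 0 ≤ A := by positivity
  have hshift : ∀ y, ‖expIntegral (D.pieceMeasure none) (D.pieceCurve r none)
      (D.pieceWeight r j none) k (x + y) t‖ ≤ K * A ^ 2 * ((1 + y ^ 2)⁻¹ * (1 + y ^ 2)⁻¹) :=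
    fun y => by
      have h1 := inv_one_add_add_sq_le (le_refl |x|) y
      calc _ ≤ K * ((1 + (x + y) ^ 2) ^ 2)⁻¹ := hK _ t le_rfl
        _ = K * ((1 + (x + y) ^ 2)⁻¹) ^ 2 := by rw [inv_pow]
        _ ≤ K * (A * (1 + y ^ 2)⁻¹) ^ 2 := by gcongr
        _ = _ := by ring
  have hle1 : ∀ y : ℝ, (1 + y ^ 2)⁻¹ ≤ 1 := fun y => inv_le_one_of_one_le₀ (by nlinarith)
  have hB' : ∀ ζ, 0 < ζ → ‖β ζ‖ ≤ B := fun ζ hζ =>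
    (hB ζ hζ.le).trans (mul_le_of_le_one_right hB0 (hle1 ζ))
  refine ⟨‖δ‖ * (K * A ^ 2) + B * (K * A ^ 2) * 2 * Real.pi, fun ξ hξ => ?_⟩
  -- Translating backwards concentrates the kernel near `ζ = ξ`, so the decay in `ξ` has to come
  -- from `β`. Peetre's inequality combines the two, and one power of the kernel is kept for
  -- integrability.
  rw [expIntegral_boundary_mul_eq hr ha hβ hB' hF, add_mul]
  refine (norm_add_le _ _).trans (add_le_add ?_ ?_)
  · rw [norm_mul, mul_assoc]
    gcongr
    have h1 := hshift (-ξ)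
    rw [← sub_eq_add_neg, neg_sq] at h1
    refine h1.trans (mul_le_mul_of_nonneg_left ?_ (by positivity))
    exact mul_le_of_le_one_right (by positivity) (hle1 ξ)
  · have hi : Integrable fun ζ : ℝ => B * (K * A ^ 2) * 2 * (1 + ξ ^ 2)⁻¹ * (1 + (ζ - ξ) ^ 2)⁻¹ :=
      (integrable_inv_one_add_sq.comp_sub_right ξ).const_mul _
    calc _ ≤ ∫ ζ : ℝ in Ioi 0, B * (K * A ^ 2) * 2 * (1 + ξ ^ 2)⁻¹ * (1 + (ζ - ξ) ^ 2)⁻¹ := by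
          refine norm_integral_le_of_norm_le hi.integrableOn ?_
          filter_upwards [ae_restrict_mem measurableSet_Ioi] with ζ hζ
          have h1 := hshift (ζ - ξ)
          rw [show x + (ζ - ξ) = x - ξ + ζ by ring] at h1
          rw [norm_mul]
          calc _ ≤ B * (1 + ζ ^ 2)⁻¹
                * (K * A ^ 2 * ((1 + (ζ - ξ) ^ 2)⁻¹ * (1 + (ζ - ξ) ^ 2)⁻¹)) :=
                mul_le_mul (hB ζ (le_of_lt hζ)) h1 (norm_nonneg _) (by positivity)
            _ = B * (K * A ^ 2) * ((1 + ζ ^ 2)⁻¹ * (1 + (ζ - ξ) ^ 2)⁻¹) * (1 + (ζ - ξ) ^ 2)⁻¹ := by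
                ring
            _ ≤ B * (K * A ^ 2) * (2 * (1 + ξ ^ 2)⁻¹) * (1 + (ζ - ξ) ^ 2)⁻¹ := by
                exact mul_le_mul_of_nonneg_right (mul_le_mul_of_nonneg_left
                  (inv_one_add_sq_mul_le ξ ζ) (by positivity)) (by positivity)
            _ = _ := by ring
      _ ≤ ∫ ζ : ℝ, B * (K * A ^ 2) * 2 * (1 + ξ ^ 2)⁻¹ * (1 + (ζ - ξ) ^ 2)⁻¹ :=
          setIntegral_le_integral hi (Eventually.of_forall fun ζ => by
            simp only [Pi.zero_apply]
            positivity)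
      _ = _ := by
          rw [integral_const_mul, integral_sub_right_eq_self fun ζ : ℝ => (1 + ζ ^ 2)⁻¹,
            integral_univ_inv_one_add_sq]
          ring

variable {x t : ℝ} {M : ℂ → BlockMat n}

/-- The Marchenko equations: the boundary values of a solution of the Riemann–Hilbert problem
generate the value of `dressed`. -/
theorem exists_marchenko_representation (hr : D.AdmissibleRadii r) (h : IsRHSolution D r x t M)
    (i : Fin n) :
    ∃ (a : Fin n → Option D.Disk → ℝ → ℂ) (C : ℝ), (∀ j o, Continuous (a j o)) ∧
      (∀ j o s, ‖a j o s‖ ≤ C) ∧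
      (∀ z ∉ D.contour r, M z (Sum.inr i) (Sum.inl ())
        = -((2 * Real.pi * I)⁻¹ * ∑ j, ∑ o, D.pieceCauchy r x t j o (a j o) z)) ∧
      (∀ j k, ∃ C, ∀ ξ, 0 ≤ ξ → ‖D.boundaryFlow r j (a j) k (x + ξ) t‖ ≤ C * (1 + ξ ^ 2)⁻¹) ∧
      (∀ j k, ∃ C, ∀ ξ, 0 ≤ ξ → ‖expIntegral (D.pieceMeasure none) (D.pieceCurve r none)
        (fun s => a j none s * D.pieceWeight r j none s) k (x - ξ) t‖ ≤ C * (1 + ξ ^ 2)⁻¹) ∧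
      ∑ j, D.boundaryFlow r j (a j) 0 x t
        = -(Real.pi * dressed (fun j => (airyFlow_kernel hr j).translate) (D.kernel r) 0 x t i) := by
  obtain ⟨a, b, ha, hb, hM1, hM2⟩ := exists_cauchy_representation hr h i
  choose Ca hCa using fun j => (ha j).bounded
  obtain ⟨Cb, hCb⟩ := hb.bounded
  have hac := fun j => (ha j).continuous
  have hπ : (Real.pi : ℂ) ≠ 0 := ofReal_ne_zero.2 Real.pi_ne_zero
  set δ : Fin n → ℂ := fun j => (1 : BlockMat n) (Sum.inr i) (Sum.inr j) with hδ
  -- `α` is the Laplace density of the first entry of the row in the lower half-plane, and `β j`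
  -- that of entry `j` minus `δ j` in the upper half-plane.
  set α : ℝ → ℂ := fun ξ => (Real.pi : ℂ)⁻¹ * ∑ j, D.boundaryFlow r j (a j) 0 (x + ξ) t with hα
  set β : Fin n → ℝ → ℂ := fun j ξ => -(Real.pi : ℂ)⁻¹ * conj (D.boundaryFlow r j b 0 (x + ξ) t)
    with hβ
  have hαc : Continuous α := continuous_const.mul (continuous_finsetSum _ fun j _ =>
    (continuous_boundaryFlow hr (hac j) (hCa j) j 0 t).comp (continuous_const.add continuous_id))
  have hβc : ∀ j, Continuous (β j) := fun j => continuous_const.mul (continuous_conj.comp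
    ((continuous_boundaryFlow hr hb.continuous hCb j 0 t).comp
      (continuous_const.add continuous_id)))
  obtain ⟨Bα, hBα⟩ : ∃ B, ∀ ξ, 0 ≤ ξ → ‖α ξ‖ ≤ B := by
    choose B hB using fun j => exists_boundaryFlow_le hr (hac j) (hCa j) j 0 x t
    refine ⟨‖(Real.pi : ℂ)⁻¹‖ * ∑ j, B j, fun ξ hξ => ?_⟩
    rw [hα, norm_mul]
    gcongr
    exact norm_sum_le_of_le _ fun j _ => hB j ξ hξ
  obtain ⟨Bβ, hBβ⟩ : ∃ B : Fin n → ℝ, ∀ j ξ, 0 ≤ ξ → ‖β j ξ‖ ≤ B j := by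
    choose B hB using fun j => exists_boundaryFlow_le hr hb.continuous hCb j 0 x t
    refine ⟨fun j => ‖(Real.pi : ℂ)⁻¹‖ * B j, fun j ξ hξ => ?_⟩
    rw [hβ, norm_mul, norm_neg, norm_conj]
    exact mul_le_mul_of_nonneg_left (hB j ξ hξ) (norm_nonneg _)
  have hF1 : ∀ z ∉ D.contour r, 0 < z.im → conj (M (conj z) (Sum.inr i) (Sum.inl ()))
      = laplaceAdd 0 (fun ξ => conj (α ξ)) z := fun z hz him => by
    have him' : (conj z).im < 0 := by simpa using him
    rw [hM1 _ (by rwa [conj_mem_contour]), laplaceAdd, zero_add, ← conj_laplace]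
    congr 1
    simp only [sum_pieceCauchy_eq hr (hac _) (hCa _) _ x t him', hα, Finset.mul_sum, Finset.sum_mul]
    rw [integral_finsetSum _ fun j _ => ?_]
    · rw [← Finset.sum_neg_distrib]
      refine Finset.sum_congr rfl fun j _ => ?_
      simp_rw [mul_assoc (Real.pi : ℂ)⁻¹]
      rw [integral_const_mul]
      field_simp
    · obtain ⟨B, hB⟩ := exists_boundaryFlow_le hr (hac j) (hCa j) j 0 x t
      simp_rw [mul_assoc (Real.pi : ℂ)⁻¹]
      exact (integrableOn_mul_exp ((continuous_boundaryFlow hr (hac j) (hCa j) j 0 t).comp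
        (continuous_const.add continuous_id)) (fun ζ hζ => hB ζ hζ.le) (by simpa using him)).const_mul _
  have hF2 : ∀ j, ∀ z ∉ D.contour r, 0 < z.im → M z (Sum.inr i) (Sum.inr j)
      = laplaceAdd (δ j) (β j) z := fun j z hz him => by
    have him' : (conj z).im < 0 := by simpa using him
    have h1 := congrArg conj (hM2 (conj z) (by rwa [conj_mem_contour]) j)
    rw [Complex.conj_conj, Complex.conj_conj] at h1
    rw [h1, sum_pieceCauchy_eq hr hb.continuous hCb j x t him', laplaceAdd]
    rw [map_add]
    congr 1
    · simp only [hδ, Matrix.one_apply]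
      split_ifs <;> simp
    · have h2 : ∀ w : ℂ, (2 * Real.pi * I : ℂ)⁻¹ * (-2 * I * w) = -(Real.pi : ℂ)⁻¹ * w := fun w => by
        field_simp
      rw [h2, map_mul, conj_laplace]
      simp only [hβ, mul_assoc (-(Real.pi : ℂ)⁻¹)]
      rw [integral_const_mul, map_neg, map_inv₀, conj_ofReal]
  -- the integral equations
  have hκ : ∀ j y, D.complexKernel r j 0 y t = -(Real.pi * D.kernel r j 0 y t : ℂ) := fun j y =>
    complexKernel_eq hr j y t
  have hker : ∀ j, AiryFlow 2 (D.kernel r j) := fun j => airyFlow_kernel hr j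
  have hBcα : ∀ ζ, 0 < ζ → ‖conj (α ζ)‖ ≤ Bα := fun ζ hζ => by
    rw [norm_conj]
    exact hBα ζ hζ.le
  have hαeq : ∀ ξ, α ξ = -(D.kernel r i 0 (x + ξ) t : ℂ)
      - ∑ j, ∫ ζ : ℝ in Ioi 0, β j ζ * D.kernel r j 0 (x + ξ + ζ) t := fun ξ => by
    simp only [hα]
    simp only [boundaryFlow_eq hr (ha _) (hβc _) (fun ζ hζ => hBβ _ ζ hζ.le) (hF2 _), hκ]
    have e1 : ∀ j, ∫ ζ : ℝ in Ioi 0, β j ζ * -(Real.pi * D.kernel r j 0 (x + ξ + ζ) t : ℂ)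
        = -Real.pi * ∫ ζ : ℝ in Ioi 0, β j ζ * D.kernel r j 0 (x + ξ + ζ) t := fun j => by
      rw [← integral_const_mul]
      congr 1
      ext ζ
      ring
    have e2 : ∑ j, δ j * -(Real.pi * D.kernel r j 0 (x + ξ) t : ℂ)
        = -(Real.pi * D.kernel r i 0 (x + ξ) t : ℂ) := by
      simp [hδ, Matrix.one_apply]
    simp only [e1]
    rw [Finset.sum_add_distrib, e2, ← Finset.mul_sum]
    field_simp
    ring
  -- The constant is `0` here, so `β` has no inhomogeneous term, while the equation for `α` inherits
  -- the term `i` from the identity matrix. The minus signs from `β` and from the kernel cancel, and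
  -- the kernel is real.
  have hβeq : ∀ j ξ, β j ξ = ∫ ζ : ℝ in Ioi 0, α ζ * D.kernel r j 0 (x + ξ + ζ) t := fun j ξ => by
    simp only [hβ]
    rw [boundaryFlow_eq hr hb (continuous_conj.comp hαc) hBcα hF1, zero_mul, zero_add,
      ← integral_conj, ← integral_const_mul]
    congr 1
    ext ζ
    rw [hκ, map_mul, Function.comp_apply, Complex.conj_conj, map_neg, map_mul, conj_ofReal,
      conj_ofReal]
    field_simp
  have hBF : ∀ j k, ∃ C, ∀ ξ, 0 ≤ ξ →
      ‖D.boundaryFlow r j (a j) k (x + ξ) t‖ ≤ C * (1 + ξ ^ 2)⁻¹ := fun j k =>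
    exists_boundaryFlow_decay hr (ha j) (hβc j) (fun ζ hζ => hBβ j ζ hζ.le) (hF2 j) j k x t
  obtain ⟨K, hK⟩ : ∃ K, ∀ ξ, 0 ≤ ξ → ‖α ξ‖ ≤ K * (1 + ξ ^ 2)⁻¹ := by
    choose C hC using fun j => hBF j 0
    refine ⟨‖(Real.pi : ℂ)⁻¹‖ * ∑ j, C j, fun ξ hξ => ?_⟩
    rw [hα, norm_mul, mul_assoc, Finset.sum_mul]
    exact mul_le_mul_of_nonneg_left (norm_sum_le_of_le _ fun j _ => hC j ξ hξ) (norm_nonneg _)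
  -- The density is complex a priori. As the kernel is real, any real-linear functional of the
  -- system solves the real Marchenko system with right side scaled by `L 1`. Taking real and
  -- imaginary parts (`L 1 = 1` and `L 1 = 0`) yields the value and the reality of the limit
  -- together.
  have hreal : ∀ L : ℂ →L[ℝ] ℝ, L (-α 0)
      = L 1 * dressed (fun j => (hker j).translate) (D.kernel r) 0 x t i := fun L => by
    have hL : ∀ (w : ℂ) (s : ℝ), L (w * s) = L w * s := fun w s => by
      rw [mul_comm, ← real_smul, map_smul, smul_eq_mul, mul_comm]
    have hLint : ∀ (j : Fin n) (g : ℝ → ℂ) (B y : ℝ), Continuous g → (∀ ζ, 0 < ζ → ‖g ζ‖ ≤ B) →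
        L (∫ ζ : ℝ in Ioi 0, g ζ * D.kernel r j 0 (y + ζ) t)
          = ∫ ζ : ℝ in Ioi 0, L (g ζ) * D.kernel r j 0 (y + ζ) t := fun j g B y hg hB => by
      have h1 := ((hker j).map ofRealCLM).integrableOn_mul hg hB 0 y t
      refine (L.integral_comp_comm h1).symm.trans ?_
      simp only [ofRealCLM_apply, hL]
    refine eq_dressed_of_marchenko hker i (φ := fun ξ => L (-α ξ)) (ψ := fun j ζ => L (β j ζ))
      (C := ‖L‖ * K) (L.continuous.comp hαc.neg).aestronglyMeasurable (fun y hy => ?_)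
      (fun j z _ => ?_) fun y _ => ?_
    · refine (L.le_opNorm _).trans ?_
      rw [norm_neg, mul_assoc]
      exact mul_le_mul_of_nonneg_left (hK y hy.le) (norm_nonneg _)
    · simp only [map_neg, neg_mul]
      rw [integral_neg, neg_neg, hβeq, hLint j α Bα _ hαc fun ζ hζ => hBα ζ hζ.le]
    · have h1 : -α y = 1 * (D.kernel r i 0 (x + y) t : ℂ)
          + ∑ j, ∫ ζ : ℝ in Ioi 0, β j ζ * D.kernel r j 0 (x + y + ζ) t := by
        rw [hαeq]
        ring
      rw [h1, map_add, hL, map_sum]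
      congr 1
      refine Finset.sum_congr rfl fun j _ => ?_
      rw [hLint j (β j) (Bβ j) _ (hβc j) fun ζ hζ => hBβ j ζ hζ.le]
      simp only [add_right_comm x y]
  refine ⟨a, ∑ j, |Ca j|, hac, fun j o s => (hCa j o s).trans ((le_abs_self _).trans
    (Finset.single_le_sum (f := fun j => |Ca j|) (fun j _ => abs_nonneg _) (Finset.mem_univ j))),
    hM1, hBF, fun j k => ?_, ?_⟩
  -- Up to conjugation and the factor `-1/π`, `β j` is the flow with weight `b`, so it inherits the
  -- decay that `exists_line_decay` requires.
  · obtain ⟨C, hC⟩ := exists_boundaryFlow_decay hr hb (continuous_conj.comp hαc) hBcα hF1 j 0 x t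
    have hC0 : 0 ≤ C := by
      have := (norm_nonneg _).trans (hC 0 le_rfl)
      simpa using this
    refine exists_line_decay hr (ha j) (hβc j) (B := ‖(Real.pi : ℂ)⁻¹‖ * C) (by positivity)
      (fun ζ hζ => ?_) (hF2 j) j k x t
    rw [hβ, norm_mul, norm_neg, norm_conj, mul_assoc]
    exact mul_le_mul_of_nonneg_left (hC ζ hζ) (norm_nonneg _)
  · have h1 : ∑ j, D.boundaryFlow r j (a j) 0 x t = -(Real.pi * -α 0) := by
      simp only [hα, add_zero]
      field_simp
    rw [h1]
    congr 2
    apply Complex.ext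
    · simpa using hreal reCLM
    · simpa using hreal imCLM

end ScatteringData

end VmKdV

/-! ### Asymptotics at infinity and the reconstruction formula -/

namespace VmKdV

open MeasureTheory Filter Set

open Complex

/-- The leading term at infinity of a Cauchy integral over a bounded set. -/
theorem tendsto_mul_cauchy_of_bounded {μ : Measure ℝ} {σ ρ : ℝ → ℂ} {R : ℝ}
    (hσ : Continuous σ) (hR : ∀ s, ‖σ s‖ ≤ R) (hρ : Integrable ρ μ) :
    Tendsto (fun z : ℂ => z * ∫ s, ρ s / (σ s - z) ∂μ) (Bornology.cobounded ℂ)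
      (𝓝 (-∫ s, ρ s ∂μ)) := by
  rw [tendsto_iff_norm_sub_tendsto_zero]
  have h1 : Tendsto (fun z : ℂ => (R * ∫ s, ‖ρ s‖ ∂μ) / (‖z‖ - R)) (Bornology.cobounded ℂ)
      (𝓝 0) :=
    (tendsto_atTop_add_const_right _ (-R) tendsto_norm_cobounded_atTop).const_div_atTop _
  refine squeeze_zero' (Eventually.of_forall fun _ => norm_nonneg _) ?_ h1
  filter_upwards [tendsto_norm_cobounded_atTop.eventually_gt_atTop R] with z hz
  have hz0 : 0 < ‖z‖ - R := sub_pos.2 hz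
  have hR0 : 0 ≤ R := (norm_nonneg _).trans (hR 0)
  have hge : ∀ s, ‖z‖ - R ≤ ‖σ s - z‖ := fun s => by
    rw [norm_sub_rev]
    linarith [norm_sub_norm_le z (σ s), hR s]
  have hne : ∀ s, σ s - z ≠ 0 := fun s => norm_pos_iff.1 (hz0.trans_le (hge s))
  have hinv : ∀ s, ‖(σ s - z)⁻¹‖ ≤ (‖z‖ - R)⁻¹ := fun s => by
    rw [norm_inv]
    exact inv_anti₀ hz0 (hge s)
  have hi : Integrable (fun s => ρ s / (σ s - z)) μ := by
    simp only [div_eq_mul_inv]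
    exact hρ.mul_bdd (Continuous.aestronglyMeasurable (Continuous.inv₀ (by fun_prop) hne))
      (Eventually.of_forall hinv)
  rw [← integral_const_mul, sub_neg_eq_add, ← integral_add (hi.const_mul z) hρ, ← integral_const_mul,
    div_eq_mul_inv, ← integral_mul_const]
  refine norm_integral_le_of_norm_le ((hρ.norm.const_mul R).mul_const _)
    (Eventually.of_forall fun s => ?_)
  have e : z * (ρ s / (σ s - z)) + ρ s = σ s * ρ s * (σ s - z)⁻¹ := by
    have := hne s
    field_simp
    ring
  rw [e, norm_mul, norm_mul]
  exact mul_le_mul (mul_le_mul_of_nonneg_right (hR s) (norm_nonneg _)) (hinv s) (norm_nonneg _)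
    (by positivity)

theorem atInfty_eq : atInfty = (Bornology.cobounded ℂ ⊓ 𝓟 {w | 0 < w.im})
    ⊔ (Bornology.cobounded ℂ ⊓ 𝓟 {w | w.im < 0}) := by
  rw [atInfty, ← inf_sup_left, sup_principal]
  congr 2
  ext z
  simp only [Set.mem_ofPred_eq, mem_union]
  rw [ne_iff_lt_or_gt, or_comm]

/-- The Cauchy integral over the real line, seen from the upper half-plane. -/
theorem integral_line_div_sub_eq_laplace {w : ℝ → ℂ}
    (h : HasExpMoments volume (fun s : ℝ => (s : ℂ)) w) (x t : ℝ) {z : ℂ} (hz : 0 < z.im) :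
    ∫ s : ℝ, w s * exp (2 * I * theta x t s) / (s - z) = 2 * I * ∫ ξ : ℝ in Ioi 0,
      expIntegral volume (fun s : ℝ => (s : ℂ)) w 0 (x - ξ) t * exp (2 * I * z * ξ) := by
  have h1 := h.integrable_integrand 0 x t
  simp only [pow_zero, one_mul] at h1
  have h2 := integral_div_sub_eq_laplace (σ := fun s : ℝ => -(s : ℂ)) (by fun_prop) h1
    (fun s => by simp) (z := -z) (by simpa using hz)
  have e1 : ∀ s : ℝ, w s * exp (2 * I * theta x t s) / (s - z)
      = -(w s * exp (2 * I * theta x t s) / (-(s : ℂ) - -z)) := fun s => by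
    rw [← neg_sub' (s : ℂ) z, div_neg, neg_neg]
  simp_rw [e1]
  rw [integral_neg, h2, neg_mul, neg_mul, neg_neg, neg_neg]
  congr 2
  ext ξ
  congr 1
  simp only [expIntegral, pow_zero, one_mul]
  congr 1
  ext s
  rw [sub_eq_add_neg, exp_theta_add, ← mul_assoc]
  congr 2
  push_cast
  ring

namespace ScatteringData

variable {n : ℕ} {D : ScatteringData n} {r : Fin D.N → ℝ} {a : Option D.Disk → ℝ → ℂ} {B x t : ℝ}
  {j : Fin n}

/-- Below the real line the sum is one Laplace transform, and its leading coefficient is the value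
of the density at `0`. -/
theorem tendsto_mul_sum_pieceCauchy_lower (hr : D.AdmissibleRadii r) (ha : ∀ o, Continuous (a o))
    (hB : ∀ o s, ‖a o s‖ ≤ B)
    (hdecay : ∀ k, ∃ C, ∀ ξ, 0 ≤ ξ → ‖D.boundaryFlow r j a k (x + ξ) t‖ ≤ C * (1 + ξ ^ 2)⁻¹) :
    Tendsto (fun z => z * ∑ o, D.pieceCauchy r x t j o (a o) z)
      (Bornology.cobounded ℂ ⊓ 𝓟 {w | w.im < 0}) (𝓝 (-D.boundaryFlow r j a 0 x t)) := by
  choose C hC using hdecay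
  have hd : ∀ k ξ, HasDerivAt (fun ξ => D.boundaryFlow r j a k (x + ξ) t)
      (D.boundaryFlow r j a (k + 1) (x + ξ) t) ξ := fun k ξ =>
    (hasDerivAt_boundaryFlow hr ha hB j k (x + ξ) t).comp_const_add x ξ
  have hle : ∀ k, ∀ ξ : ℝ, 0 ≤ ξ → C k ≤ max (max (C 0) (C 1)) (C 2) →
      ‖D.boundaryFlow r j a k (x + ξ) t‖ ≤ max (max (C 0) (C 1)) (C 2) * (1 + ξ ^ 2)⁻¹ :=
    fun k ξ hξ hk => (hC k ξ hξ).trans (mul_le_mul_of_nonneg_right hk (by positivity))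
  have h1 := tendsto_mul_laplace (hd 0) (hd 1) ((continuous_boundaryFlow hr ha hB j 2 t).comp
    (continuous_const.add continuous_id)) (fun ξ hξ => hle 0 ξ hξ (by simp))
    (fun ξ hξ => hle 1 ξ hξ (by simp)) (fun ξ hξ => hle 2 ξ hξ (by simp))
  rw [add_zero] at h1
  have hneg : Tendsto (fun z : ℂ => -z) (Bornology.cobounded ℂ ⊓ 𝓟 {w | w.im < 0})
      (Bornology.cobounded ℂ ⊓ 𝓟 {w | 0 < w.im}) := by
    refine tendsto_inf.2 ⟨?_, tendsto_principal.2 ?_⟩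
    · refine (tendsto_norm_atTop_iff_cobounded.1 ?_).mono_left inf_le_left
      simpa using tendsto_norm_cobounded_atTop (E := ℂ)
    · filter_upwards [mem_inf_of_right (mem_principal_self _)] with w hw
      simpa using hw
  refine (h1.comp hneg).congr' ?_
  filter_upwards [mem_inf_of_right (mem_principal_self _)] with z hz
  rw [sum_pieceCauchy_eq hr ha hB j x t hz, Function.comp_apply]
  ring

/-- Above the real line the circles no longer lie on one side of `z`. They are bounded, and `1/(σ -
z) ≈ -1/z` suffices for them. The real line gives a Laplace transform of the backward translates,
which explains the different decay hypothesis. The limit is the same as from below. -/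
theorem tendsto_mul_sum_pieceCauchy_upper (hr : D.AdmissibleRadii r) (ha : ∀ o, Continuous (a o))
    (hB : ∀ o s, ‖a o s‖ ≤ B)
    (hdecay : ∀ k, ∃ C, ∀ ξ, 0 ≤ ξ → ‖expIntegral (D.pieceMeasure none) (D.pieceCurve r none)
      (fun s => a none s * D.pieceWeight r j none s) k (x - ξ) t‖ ≤ C * (1 + ξ ^ 2)⁻¹) :
    Tendsto (fun z => z * ∑ o, D.pieceCauchy r x t j o (a o) z)
      (Bornology.cobounded ℂ ⊓ 𝓟 {w | 0 < w.im}) (𝓝 (-D.boundaryFlow r j a 0 x t)) := by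
  simp only [Finset.mul_sum, boundaryFlow]
  rw [← Finset.sum_neg_distrib]
  refine tendsto_finsetSum _ fun o _ => ?_
  have hm := hasExpMoments_boundary hr ha hB j o
  rcases o with _ | d
  · choose C hC using hdecay
    set E : ℕ → ℝ → ℂ := fun k y => expIntegral (D.pieceMeasure none) (D.pieceCurve r none)
      (fun s => a none s * D.pieceWeight r j none s) k y t with hE
    have hd : ∀ k ξ, HasDerivAt (fun ξ => E k (x - ξ)) (-E (k + 1) (x - ξ)) ξ := fun k ξ =>
      (hm.hasDerivAt_space k (x - ξ) t).comp_const_sub x ξ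
    have hEc : Continuous fun ξ => E 2 (x - ξ) :=
      continuous_iff_continuousAt.2 fun ξ => (hd 2 ξ).continuousAt
    have hle : ∀ k, ∀ ξ : ℝ, 0 ≤ ξ → C k ≤ max (max (C 0) (C 1)) (C 2) →
        ‖E k (x - ξ)‖ ≤ max (max (C 0) (C 1)) (C 2) * (1 + ξ ^ 2)⁻¹ :=
      fun k ξ hξ hk => (hC k ξ hξ).trans (mul_le_mul_of_nonneg_right hk (by positivity))
    have h1 := tendsto_mul_laplace (g'' := fun ξ => E 2 (x - ξ)) (hd 0)
      (fun ξ => (hd 1 ξ).neg.congr_deriv (neg_neg _)) hEc (fun ξ hξ => hle 0 ξ hξ (by simp))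
      (fun ξ hξ => (norm_neg _).trans_le (hle 1 ξ hξ (by simp)))
      (fun ξ hξ => hle 2 ξ hξ (by simp))
    rw [sub_zero] at h1
    refine h1.congr' ?_
    filter_upwards [mem_inf_of_right (mem_principal_self _)] with z hz
    have h2 := integral_line_div_sub_eq_laplace hm x t hz
    refine Eq.trans ?_ (congrArg (z * ·) h2).symm
    simp only [hE, pieceMeasure]
    ring!
  · have hR : ∀ s, ‖D.pieceCurve r (some d) s‖ ≤ ‖D.diskCenter d‖ + D.diskRadius r d := fun s => by
      have h1 := circleMap_mem_sphere (D.diskCenter d) (diskRadius_pos hr d).le s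
      rw [Metric.mem_sphere, Complex.dist_eq] at h1
      have h2 := norm_le_norm_add_norm_sub (D.diskCenter d)
        (circleMap (D.diskCenter d) (D.diskRadius r d) s)
      exact h2.trans_eq (by rw [norm_sub_rev, h1])
    have h1 := hm.integrable_integrand 0 x t
    simp only [pow_zero, one_mul] at h1
    have h2 := tendsto_mul_cauchy_of_bounded hm.continuous_curve hR h1
    simpa only [pieceCauchy, expIntegral, pow_zero, one_mul] using h2.mono_left inf_le_left

theorem eventually_notMem_contour : ∀ᶠ z in atInfty, z ∉ D.contour r := by
  have h1 : ∀ᶠ z in Bornology.cobounded ℂ, ∀ k,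
      z ∉ Metric.sphere (D.circleCenter k) (D.circleRadius r k) :=
    eventually_all.2 fun k => Bornology.isBounded_def.1 Metric.isBounded_sphere
  rw [atInfty, eventually_inf_principal]
  filter_upwards [h1] with z hz him
  rw [contour_eq, Set.mem_union, not_or, mem_iUnion, not_exists]
  exact ⟨him, hz⟩

theorem tendsto_mul_entry (hr : D.AdmissibleRadii r) {M : ℂ → BlockMat n}
    (h : IsRHSolution D r x t M) (i : Fin n) :
    Tendsto (fun z : ℂ => -2 * I * (z * M z (Sum.inr i) (Sum.inl ()))) atInfty
      (𝓝 (dressed (fun j => (airyFlow_kernel hr j).translate) (D.kernel r) 0 x t i : ℂ)) := by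
  obtain ⟨a, B, ha, hB, hM, hlower, hupper, hval⟩ := exists_marchenko_representation hr h i
  have h1 : ∀ j, Tendsto (fun z => z * ∑ o, D.pieceCauchy r x t j o (a j o) z) atInfty
      (𝓝 (-D.boundaryFlow r j (a j) 0 x t)) := fun j => by
    rw [atInfty_eq]
    exact (tendsto_mul_sum_pieceCauchy_upper hr (ha j) (hB j) (hupper j)).sup
      (tendsto_mul_sum_pieceCauchy_lower hr (ha j) (hB j) (hlower j))
  -- The constant is `-2i · (-(2πi)⁻¹) = 1/π`, which cancels the `π` in the value of the flow.
  have h2 := (tendsto_finsetSum Finset.univ fun j _ => h1 j).const_mul (Real.pi : ℂ)⁻¹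
  have hπ : (Real.pi : ℂ) ≠ 0 := ofReal_ne_zero.2 Real.pi_ne_zero
  rw [Finset.sum_neg_distrib, hval, neg_neg, inv_mul_cancel_left₀ hπ] at h2
  refine h2.congr' ?_
  filter_upwards [eventually_notMem_contour (D := D) (r := r)] with z hz
  rw [hM z hz, ← Finset.mul_sum]
  field_simp

end ScatteringData

end VmKdV

/-- The witness for `q` is `dressed`, built from the scattering data alone and defined for all real
`t`. Its regularity and the equation are independent of `M`, which is used only to identify the
limit at each fixed `(x,t)`. -/
theorem mainTheorem6 (n : ℕ) (D : VmKdV.ScatteringData n) (r : Fin D.N → ℝ)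
    (hr : D.AdmissibleRadii r) (M : ℝ → ℝ → ℂ → VmKdV.BlockMat n)
    (hM : ∀ x t : ℝ, 0 < t → VmKdV.IsRHSolution D r x t (M x t)) :
    ∃ q : ℝ → ℝ → Fin n → ℝ,
      (∀ x t : ℝ, 0 < t → ∀ i : Fin n,
        Filter.Tendsto (fun z : ℂ => -2 * Complex.I * (z * M x t z (Sum.inr i) (Sum.inl ())))
          VmKdV.atInfty (nhds ((q x t i : ℝ) : ℂ))) ∧
      VmKdV.IsSolution q :=
  ⟨_, fun x t ht i => VmKdV.ScatteringData.tendsto_mul_entry hr (hM x t ht) i,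
    VmKdV.isSolution_dressed_translate fun j => VmKdV.ScatteringData.airyFlow_kernel hr j⟩
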